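/- Setting. Let $G$ be a compact Lie group (e.g. $SU(2)$) with a bi-invariant Riemannian metric, normalized Haar measure and Lie algebra $\mathfrak g$, and let $\kappa,m,\lambda\in\mathbb R$. Fields are smooth functions $\phi^c:M\to\mathbb C$, with $M=G^{\times n}$; write $\phi_{1,2,3}=\phi(g_1,g_2,g_3)$, etc. All models have the local Lagrangian $L^L=\sum_c(\kappa\nabla\bar\phi^c\cdot\nabla\phi^c+m\bar\phi^c\phi^c)$ and the action $S=\int_M L^L+S^I$. The fields are either all smooth functions or only the gauge-invariant ones, $\phi^c(g_1h,\dots,g_nh)=\phi^c(g_1,\dots,g_n)$ for all $h\in G$; "on shell" means that $S$ is stationary at $\phi$ with respect to all variations in the chosen space of fields. A one-parameter group of transformations acts by a flow $C_t$ on $M$ with generator $X_M$ and by phases $\phi^c\mapsto e^{it\theta_c}\phi^c$; put $X_Q^c=\frac{d}{dt}\big|_0e^{it\theta_c}\phi^c\circ C_{-t}=i\theta_c\phi^c-X_M(\phi^c)$, where $X_M(\phi)$ is the Lie derivative. The Noether current of the local part is the vector field $$J=\kappa\sum_c\left(\nabla\phi^c\,\bar X^c_Q+\nabla\bar\phi^c\,X^c_Q\right)+L^L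 X_M .$$ For a factor of an interaction monomial, $\phi\int\phi\cdots\phi$ denotes $\phi$ at the point $x\in M$ times the integral of the other factors, in which the variables shared with the omitted factor are set to the components of $x$ and the remaining ones are integrated over. If no factor is named, the first one is omitted. "Left multiplication by $C$" means that $C_t$ multiplies the arguments from the left by one-parameter subgroups arranged in the pattern $C$. Theorem. On shell the current satisfies, pointwise on $M$, $\mathrm{Div}(J)=\Delta$ (in place of a conservation law) with the following correction terms. 1. $S^I=\lambda\int\phi^1_{1,2,3}\phi^2_{1,4,5}\phi^3_{6,2,5}\phi^4_{6,4,3}+c.c.$: for left multiplication by $(c^1,c^2,c^3)$, $\Delta=-2\lambda\sum_c\Re\left(X_M(\phi^c)\int\prod_{c'\ne c}\phi^{c'}\right)$; for $\phi^c\mapsto e^{i\theta_c}\phi^c$ with $\sum_c\theta_c=0$, $\Delta=-2\lambda\sum_c\theta_c\,\Im\left(\phi^c\int\prod_{c'\neq c}\phi^{c'}\right)$. 2. $S^I=\lambda\int\phi_{1,2,3}\phi_{3,4,5}\phi_{5,2,6}\phi_{6,4,1}+c.c.$: for left multiplication by $(c^1,c^2,c^1)$, $\Delta=-8\lambda\,\Re\left(X_M(\phi)\int\phi\phi\phi\right)$.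 3. Fields (and variations) that are in addition invariant under cyclic permutations of their three arguments, $S^I=\lambda\int\phi_{1,2,3}\phi_{1,4,5}\phi_{2,5,6}\phi_{3,6,4}+c.c.$: for left multiplication by $(c,c,c)$, $\Delta=-8\lambda\,\Re\left(X_M(\phi)\int\phi\phi\phi\right)$. For the variant $\phi_{1,2,3}\phi_{4,3,5}\phi_{5,2,6}\phi_{6,4,1}$, the same holds with $4\int\phi\phi\phi$ replaced by the sum of the four integrals in which one factor is omitted, averaged over the cyclic permutations of the arguments $(x_1,x_2,x_3)$. 4. $S^I=\lambda\int\phi_{1,2,3}\bar\phi_{3,4,5}\phi_{5,2,6}\bar\phi_{6,4,1}$: for left multiplication by $(c^1,c^2,c^1)$, $\Delta=-4\lambda\,\Re\left(X_M(\phi)\int\bar\phi\phi\bar\phi\right)$; for $\phi\mapsto e^{i\theta}\phi$, $\Delta=-4\lambda\theta\,\Im\left(\phi\int\bar\phi\phi\bar\phi\right)$. 5. $n=4$, $S^I=\lambda\int\phi_{1,2,3,4}\phi_{4,5,6,7}\phi_{7,3,8,9}\phi_{9,6,2,10}\phi_{10,8,5,1}+c.c.$: for left multiplication by $(c^1,c^2,c^2,c^1)$,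 $\Delta=-10\lambda\,\Re\left(X_M(\phi)\int\phi\phi\phi\phi\right)$. 6. Barrett–Crane model: $G=SU(2)$, $M=Spin(4)^{\times4}\times SU(2)$ with $Spin(4)=SU(2)_-\times SU(2)_+$, fields $\phi(\vec g;k)$ invariant under $(g^j_-,g^j_+;k)\mapsto(g_-^jku^jk^{-1}h_-,\,g_+^ju^jh_+;\,h_-^{-1}kh_+)$ for all $u^j,h_\pm\in SU(2)$, and $S^I=\lambda\int\phi_{1,2,3,4,k_1}\phi_{4,5,6,7,k_2}\phi_{7,3,8,9,k_3}\phi_{9,6,2,10,k_4}\phi_{10,8,5,1,k_5}+c.c.$ Both for left multiplication of $\vec g$ by $(s^1,s^2,s^2,s^1)$, $s^i\in Spin(4)$, and for simultaneous conjugation of all $g^j_\pm$ and $k$ by $c\in SU(2)$: if $S$ is stationary at $\phi$ under all smooth variations, then $\Delta=-10\lambda\,\Re\left(X_M(\phi)\int\phi\phi\phi\phi\right)$; if it is stationary under the variations that obey the constraints, then the same holds with $\int\phi\phi\phi\phi$ averaged over $u\in SU(2)^{\times4}$ (with $h_\pm=1$). Here the kinetic term may have coupling $\kappa$ along $Spin(4)^{\times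 4}$ and $\kappa'$ along the normal $k$, with $\kappa'=0$ in the second case. (The static model is $\kappa=\kappa'=0$.) 7. For static models, $\kappa=0$, the current $J$ of the $U(1)$ symmetries in 1 and 4 vanishes identically. -/

import Mathlib

open MeasureTheory Finset
open scoped ContDiff ComplexConjugate

noncomputable section

namespace GFT

/-! ## Compact Lie groups

A compact Lie group is given as a compact topological group `G` with a faithful continuous
finite-dimensional matrix representation `ρ` (by the Peter–Weyl theorem every compact Lie group
is of this form; for `SU(2)` take the inclusion into the 2 by 2 matrices). Then `ρ` identifies `G`
with a closed embedded submanifold of the space of matrices. -/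

variable {G : Type*} [Group G] {N : ℕ}

/-- Smooth one-parameter subgroups of `G`. -/
structure OneParam (ρ : G →* Matrix (Fin N) (Fin N) ℂ) where
  toFun : ℝ → G
  map_add : ∀ s t, toFun (s + t) = toFun s * toFun t
  smooth : ∀ i j, ContDiff ℝ ∞ (fun t => ρ (toFun t) i j)

instance (ρ : G →* Matrix (Fin N) (Fin N) ℂ) : CoeFun (OneParam ρ) (fun _ => ℝ → G) :=
  ⟨OneParam.toFun⟩

/-- The trivial one-parameter subgroup. -/
def OneParam.trivial (ρ : G →* Matrix (Fin N) (Fin N) ℂ) : OneParam ρ where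
  toFun _ := 1
  map_add _ _ := (one_mul 1).symm
  smooth _ _ := contDiff_const

/-- The velocity at `0` of a curve in `G`, as a matrix. -/
def velocity (ρ : G →* Matrix (Fin N) (Fin N) ℂ) (c : ℝ → G) : Matrix (Fin N) (Fin N) ℂ :=
  Matrix.of fun i j => deriv (fun t => ρ (c t) i j) 0

/-- A bi-invariant Riemannian metric on `G`: an inner product `B` on the Lie algebra (the set of
velocities of one-parameter subgroups) that is invariant under the adjoint action of `G`, together
with an orthonormal basis of the Lie algebra. The basis elements are given by one-parameter
subgroups `e a`. Symmetry and positivity of `B` on the Lie algebra follow from orthonormality. -/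
structure InvariantMetric (ρ : G →* Matrix (Fin N) (Fin N) ℂ) (d : ℕ) where
  B : Matrix (Fin N) (Fin N) ℂ →ₗ[ℝ] Matrix (Fin N) (Fin N) ℂ →ₗ[ℝ] ℝ
  e : Fin d → OneParam ρ
  ad_invariant : ∀ (g : G) (γ δ : OneParam ρ),
    B (ρ g * velocity ρ γ * ρ g⁻¹) (ρ g * velocity ρ δ * ρ g⁻¹) =
      B (velocity ρ γ) (velocity ρ δ)
  orthonormal : ∀ a b, B (velocity ρ (e a)) (velocity ρ (e b)) = if a = b then 1 else 0
  spanning : ∀ γ : OneParam ρ,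
    velocity ρ γ ∈ Submodule.span ℝ (Set.range fun a => velocity ρ (e a))

/-! ## Calculus on the base manifold `M = ι → G`, a product of copies of `G` -/

section Calculus

variable {ι : Type*} [Fintype ι] [DecidableEq ι]
variable {ρ : G →* Matrix (Fin N) (Fin N) ℂ} {d : ℕ}

/-- Smooth functions on the closed embedded submanifold `M` of a space of tuples of matrices:
restrictions of smooth functions on the ambient space. -/
def IsSmooth (ρ : G →* Matrix (Fin N) (Fin N) ℂ) (u : (ι → G) → ℂ) : Prop :=
  ∃ F : (ι → Fin N → Fin N → ℂ) → ℂ, ContDiff ℝ ∞ F ∧ ∀ x, u x = F fun A i j => ρ (x A) i j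

/-- Derivative of `u` along the left-invariant vector field `E_(A,a)`, which is generated by
right translation of the `A`-th copy of `G` by the one-parameter subgroup `e a`. The fields
`E_(A,a)` form an orthonormal frame of `M` (product metric). -/
def frameDeriv (Q : InvariantMetric ρ d) (A : ι) (a : Fin d) (u : (ι → G) → ℂ) (x : ι → G) : ℂ :=
  deriv (fun t : ℝ => u (Function.update x A (x A * Q.e a t))) 0

/-- Divergence of the vector field `∑ J^(A,a) E_(A,a)`. The left-invariant fields `E_(A,a)` of a
compact group are divergence-free, so it is `∑ E_(A,a) (J^(A,a))`. -/
def divergence (Q : InvariantMetric ρ d) (J : ι → Fin d → (ι → G) → ℂ) (x : ι → G) : ℂ :=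
  ∑ A, ∑ a, frameDeriv Q A a (J A a) x

/-- The Lie derivative `X_M(u)`, where `X_M` is the generator of the flow `Φ` on `M`. -/
def lieDeriv (Φ : ℝ → (ι → G) → (ι → G)) (u : (ι → G) → ℂ) (x : ι → G) : ℂ :=
  deriv (fun t => u (Φ t x)) 0

/-- The `(A,a)`-component, in the frame `E_(A,a)`, of the generator `X_M` of the flow `Φ`. -/
def generatorComponent (Q : InvariantMetric ρ d) (Φ : ℝ → (ι → G) → (ι → G))
    (A : ι) (a : Fin d) (x : ι → G) : ℝ :=
  Q.B (velocity ρ fun t => (x A)⁻¹ * Φ t x A) (velocity ρ (Q.e a))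

/-- The flow of left multiplications by one-parameter subgroups. -/
def leftFlow (γ : ι → OneParam ρ) (t : ℝ) (x : ι → G) : ι → G := fun A => γ A t * x A

/-- The flow of conjugations by a one-parameter subgroup, in all copies simultaneously. -/
def conjFlow (γ : OneParam ρ) (t : ℝ) (x : ι → G) : ι → G := fun A => γ t * x A * (γ t)⁻¹

/-- The trivial flow: its generator is `X_M = 0`. -/
def trivialFlow (_ : ℝ) (x : ι → G) : ι → G := x

end Calculus

/-! ## Fields, local Lagrangian and Noether current

A field configuration is `φ : C → (ι → G) → ℂ`, where `C` is the set of colors. -/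

section Fields

variable {ι : Type*} [Fintype ι] [DecidableEq ι] {C : Type*} [Fintype C]
variable {ρ : G →* Matrix (Fin N) (Fin N) ℂ} {d : ℕ}

/-- Smooth configurations, all components of which are invariant under the maps in `𝒯`. -/
def fields (ρ : G →* Matrix (Fin N) (Fin N) ℂ) (C : Type*) (𝒯 : Set ((ι → G) → (ι → G))) :
    Set (C → (ι → G) → ℂ) :=
  {φ | ∀ c, IsSmooth ρ (φ c) ∧ ∀ T ∈ 𝒯, φ c ∘ T = φ c}

/-- The gauge transformations: right multiplications by the diagonal subgroup. -/
def gaugeMaps (G : Type*) [Group G] (ι : Type*) : Set ((ι → G) → (ι → G)) :=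
  {T | ∃ h : G, T = fun x A => x A * h}

/-- `φ` is a stationary point of `S` with respect to variations in the directions `η ∈ 𝓥`. -/
def IsStationary (S : (C → (ι → G) → ℂ) → ℂ) (𝓥 : Set (C → (ι → G) → ℂ))
    (φ : C → (ι → G) → ℂ) : Prop :=
  ∀ η ∈ 𝓥, HasDerivAt (fun s : ℝ => S fun c x => φ c x + (s : ℂ) * η c x) 0 0

/-- The local Lagrangian `L^L = ∑_c (κ ∇φ̄^c · ∇φ^c + m φ̄^c φ^c)`. The coupling `κ A` is allowed to
depend on the copy `A` of `G`. -/
def localLagrangian (Q : InvariantMetric ρ d) (κ : ι → ℝ) (m : ℝ) (φ : C → (ι → G) → ℂ)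
    (x : ι → G) : ℂ :=
  ∑ c, ((∑ A, (κ A : ℂ) * ∑ a,
      frameDeriv Q A a (fun y => conj (φ c y)) x * frameDeriv Q A a (φ c) x)
    + (m : ℂ) * (conj (φ c x) * φ c x))

/-- The characteristic `X_Q^c = d/dt|₀ Q_t ∘ φ^c ∘ Φ_t⁻¹` of the one-parameter group of
transformations that acts on `M` by the flow `Φ` and on the fields by the phases `exp (i t θ_c)`. -/
def characteristic (Φ : ℝ → (ι → G) → (ι → G)) (θ : C → ℝ) (φ : C → (ι → G) → ℂ)
    (c : C) (x : ι → G) : ℂ :=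
  deriv (fun t : ℝ => Complex.exp (Complex.I * t * θ c) * φ c (Φ (-t) x)) 0

/-- The Noether current of the local part,
`J = κ ∑_c (∇φ^c X̄_Q^c + ∇φ̄^c X_Q^c) + L^L X_M`, by its components in the frame `E_(A,a)`. -/
def current (Q : InvariantMetric ρ d) (κ : ι → ℝ) (m : ℝ) (φ : C → (ι → G) → ℂ)
    (Φ : ℝ → (ι → G) → (ι → G)) (θ : C → ℝ) (A : ι) (a : Fin d) (x : ι → G) : ℂ :=
  (κ A : ℂ) * ∑ c, (frameDeriv Q A a (φ c) x * conj (characteristic Φ θ φ c x)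
      + frameDeriv Q A a (fun y => conj (φ c y)) x * characteristic Φ θ φ c x)
    + localLagrangian Q κ m φ x * (generatorComponent Q Φ A a x : ℂ)

end Fields

/-! ## Non-local interactions

The combinatorics of an interaction is given by `f : V → ι → ε`: the `i`-th argument of the `v`-th
factor is the variable `g (f v i)`. -/

section Interaction

variable [MeasurableSpace G] {ι V ε C : Type*} [Fintype ι] [DecidableEq ι] [Fintype V]
  [DecidableEq V] [Fintype ε] [Fintype C]
variable {ρ : G →* Matrix (Fin N) (Fin N) ℂ} {d : ℕ}

/-- `∫ ∏_v ψ_v (g_(f v 1), …, g_(f v n))`, integrated over all variables. -/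
def interaction (μ : Measure G) (f : V → ι → ε) (ψ : V → (ι → G) → ℂ) : ℂ :=
  ∫ g : ε → G, ∏ v, ψ v (g ∘ f v) ∂Measure.pi fun _ => μ

/-- The integral `∫ ∏_(w ≠ v) ψ_w` as a function of the arguments `x` of the omitted factor `v`:
the variables that occur in factor `v` are set to `x`, the others are integrated out. (`μ` is a
probability measure, so integrating over the unused variables has no effect.) -/
def omitIntegral (μ : Measure G) (f : V → ι → ε) (ψ : V → (ι → G) → ℂ) (v : V) (x : ι → G) : ℂ :=
  ∫ g : ε → G, ∏ w ∈ univ.erase v, ψ w (Function.extend (f v) x g ∘ f w) ∂Measure.pi fun _ => μ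

/-- The local action `∫_M L^L`. -/
def localAction (μ : Measure G) (Q : InvariantMetric ρ d) (κ : ι → ℝ) (m : ℝ)
    (φ : C → (ι → G) → ℂ) : ℂ :=
  ∫ x : ι → G, localLagrangian Q κ m φ x ∂Measure.pi fun _ => μ

/-- The action `∫_M L^L + (λ ∫ ∏_v φ^(col v) + c.c.)`; `col v` is the color of the factor `v`. -/
def action (μ : Measure G) (Q : InvariantMetric ρ d) (κ : ι → ℝ) (m l : ℝ)
    (f : V → ι → ε) (col : V → C) (φ : C → (ι → G) → ℂ) : ℂ :=
  localAction μ Q κ m φ + ((l : ℂ) * interaction μ f (fun v => φ (col v))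
    + conj ((l : ℂ) * interaction μ f (fun v => φ (col v))))

/-- The four factors `φ φ̄ φ φ̄`. -/
def alternating (φ : (ι → G) → ℂ) : Fin 4 → (ι → G) → ℂ :=
  ![φ, fun x => conj (φ x), φ, fun x => conj (φ x)]

/-- The action `∫_M L^L + λ ∫ φ φ̄ φ φ̄` of a single field. -/
def alternatingAction (μ : Measure G) (Q : InvariantMetric ρ d) (κ : ι → ℝ) (m l : ℝ)
    (f : Fin 4 → ι → ε) (φ : Unit → (ι → G) → ℂ) : ℂ :=
  localAction μ Q κ m φ + (l : ℂ) * interaction μ f (alternating (φ ()))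

end Interaction

/-! ## The combinatorics of the models (variables are numbered from 0) -/

/-- `φ¹_{1,2,3} φ²_{1,4,5} φ³_{6,2,5} φ⁴_{6,4,3}` -/
def coloredPattern : Fin 4 → Fin 3 → Fin 6 :=
  ![![0, 1, 2], ![0, 3, 4], ![5, 1, 4], ![5, 3, 2]]

/-- `φ_{1,2,3} φ_{3,4,5} φ_{5,2,6} φ_{6,4,1}` -/
def simplicialPattern : Fin 4 → Fin 3 → Fin 6 :=
  ![![0, 1, 2], ![2, 3, 4], ![4, 1, 5], ![5, 3, 0]]

/-- `φ_{1,2,3} φ_{1,4,5} φ_{2,5,6} φ_{3,6,4}` (original Boulatov interaction) -/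
def boulatovPattern : Fin 4 → Fin 3 → Fin 6 :=
  ![![0, 1, 2], ![0, 3, 4], ![1, 4, 5], ![2, 5, 3]]

/-- `φ_{1,2,3} φ_{4,3,5} φ_{5,2,6} φ_{6,4,1}` -/
def boulatovPattern' : Fin 4 → Fin 3 → Fin 6 :=
  ![![0, 1, 2], ![3, 2, 4], ![4, 1, 5], ![5, 3, 0]]

/-- `φ_{1,2,3,4} φ_{4,5,6,7} φ_{7,3,8,9} φ_{9,6,2,10} φ_{10,8,5,1}` -/
def ooguriPattern : Fin 5 → Fin 4 → Fin 10 :=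
  ![![0, 1, 2, 3], ![3, 4, 5, 6], ![6, 2, 7, 8], ![8, 5, 1, 9], ![9, 7, 4, 0]]

/-- Cyclic permutations of the three arguments of a field. -/
def cyclicMaps (G : Type*) : Set ((Fin 3 → G) → (Fin 3 → G)) :=
  {T | ∃ r : Fin 3, T = fun x i => x (i + r)}

/-- The slots of `Spin(4)^4 × SU(2)`, where `Spin(4) = SU(2)_- × SU(2)_+`: the slot
`inl (j, false)` holds `g^j_-`, the slot `inl (j, true)` holds `g^j_+`, and `inr ()` holds `k`. -/
abbrev BCSlot := (Fin 4 × Bool) ⊕ Unit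

/-- `φ_{1,2,3,4,k₁} φ_{4,5,6,7,k₂} φ_{7,3,8,9,k₃} φ_{9,6,2,10,k₄} φ_{10,8,5,1,k₅}`, with ten
variables in `Spin(4)` and five variables in `SU(2)`. -/
def bcPattern (v : Fin 5) : BCSlot → (Fin 10 × Bool) ⊕ Fin 5 :=
  Sum.map (Prod.map (ooguriPattern v) id) fun _ => v

/-- The map `(g_-^j, g_+^j; k) ↦ (g_-^j k u^j k⁻¹ h_-, g_+^j u^j h_+; h_-⁻¹ k h_+)`. -/
def bcMap (h : Bool → G) (u : Fin 4 → G) (x : BCSlot → G) : BCSlot → G :=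
  Sum.elim
    (fun p => match p with
      | (j, false) =>
          x (.inl (j, false)) * (x (.inr ()) * u j * (x (.inr ()))⁻¹) * h false
      | (j, true) => x (.inl (j, true)) * u j * h true)
    (fun _ => (h false)⁻¹ * x (.inr ()) * h true)

/-- The transformations of the combined gauge invariance and simplicity constraints. -/
def bcMaps (G : Type*) [Group G] : Set ((BCSlot → G) → (BCSlot → G)) :=
  {T | ∃ (h : Bool → G) (u : Fin 4 → G), T = bcMap h u}

/-- The average of a function over the simplicity transformations (`h = 1`). -/
def simplicityAverage [MeasurableSpace G] (μ : Measure G) (w : (BCSlot → G) → ℂ)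
    (x : BCSlot → G) : ℂ :=
  ∫ u : Fin 4 → G, w (bcMap 1 u x) ∂Measure.pi fun _ => μ

/-- Left multiplication of `(g₁, g₂, g₃, g₄; k)` by `(s₁, s₂, s₂, s₁)`, with `s₁`, `s₂`
one-parameter subgroups of `Spin(4)`; `σ i false` and `σ i true` are the two components. -/
def spinFlow {ρ : G →* Matrix (Fin N) (Fin N) ℂ} (σ : Fin 2 → Bool → OneParam ρ) :
    ℝ → (BCSlot → G) → (BCSlot → G) :=
  leftFlow (Sum.elim (fun p => σ (![0, 1, 1, 0] p.1) p.2) fun _ => OneParam.trivial ρ)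

/-- Couplings of the Barrett–Crane model: `κ` on the copies of `Spin(4)`, `κ'` on the normal. -/
def bcCoupling (κ κ' : ℝ) : BCSlot → ℝ := Sum.elim (fun _ => κ) fun _ => κ'

end GFT

end

open MeasureTheory Finset
open scoped ContDiff ComplexConjugate

noncomputable section

set_option linter.unusedSectionVars false

namespace GFT

/-! The theorem combines an off-shell Noether identity for the local Lagrangian with the field
equation of the full action. All flows considered are two-sided translations `x A ↦ α A t * x A * (β
A t)⁻¹`, hence isometries of the bi-invariant metric. For such a flow, with arbitrary phases,
`divergence_current` gives `Div J = ∑ ((Δ_κ φ - m φ) X̄_Q + c.c.)` for every smooth `φ`, on shell or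
not.

Two facts carry this identity. The component of `X_M` along `E_(A,a)` is constant in the direction
`E_(A,a)` (`generatorComponent_update`), so the divergence of `L^L X_M` is just `X_M (L^L)`. And the
commutator of `X_M` with the frame is an infinitesimal rotation (`frameDeriv_lieDeriv`,
`adRate_antisymm`), which drops out of the symmetric expression `∇φ̄ · ∇φ`. Ad-invariance of the
metric is behind both.

For the field equation, the first variation of the action in direction `η` has the form `Z + Z̄`
with `Z = ∑ ∫ η (conj (m φ - Δ_κ φ) + λ I)`, where `I` represents the derivative of the interaction.
Taking `η` to be the complex conjugate of the bracket turns `Z` into an integral of `‖η‖²`, and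
stationarity forces `η = 0` (`field_equation`). This variation must itself lie in the chosen space
of fields, so the Laplacian and `I` must respect the constraints. The Laplacian does because the
constraints act isometrically on the slots with nonzero coupling (`laplacian_comp`). The integral
`I` with one factor omitted inherits right translation invariance by a change of variables
(`omitIntegral_translate`). Where it need not inherit a constraint, its average over the constraint
group replaces it: averaging does not change the pairing with invariant variations
(`integral_mul_cyclicAverage`, `integral_mul_simplicityAverage`).

Substituting the field equation leaves `Div J = 2 λ ∑ Re (X_Q I)`. The numerical factors of the
models count equal omitted integrals: relabelling symmetries of the interaction pattern identify
these integrals with one another (`omitIntegral_symm`).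

Analytically, everything is reduced through the matrix embedding to smooth functions on a vector
space; compactness supplies bounds for differentiation under the integral and unimodularity of Haar
measure. -/

/-! ## Smooth dependence through an embedding -/

section SmoothAlong

variable {X Y E E' F F' : Type*} [NormedAddCommGroup E] [NormedSpace ℝ E]
  [NormedAddCommGroup E'] [NormedSpace ℝ E'] [NormedAddCommGroup F] [NormedSpace ℝ F]
  [NormedAddCommGroup F'] [NormedSpace ℝ F']

/-- `u` is the restriction along `r` of a smooth function on the normed space `E`. -/
def SmoothAlong (r : X → E) (u : X → F) : Prop :=
  ∃ U : E → F, ContDiff ℝ ∞ U ∧ ∀ x, u x = U (r x)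

theorem SmoothAlong.const (r : X → E) (c : F) : SmoothAlong r fun _ => c :=
  ⟨fun _ => c, contDiff_const, fun _ => rfl⟩

theorem SmoothAlong.contDiff_comp {r : X → E} {u : X → F} (hu : SmoothAlong r u) {f : F → F'}
    (hf : ContDiff ℝ ∞ f) : SmoothAlong r fun x => f (u x) := by
  obtain ⟨U, hU, h⟩ := hu
  exact ⟨fun y => f (U y), hf.comp hU, fun x => congrArg f (h x)⟩

theorem SmoothAlong.prodMk {r : X → E} {u : X → F} {v : X → F'} (hu : SmoothAlong r u)
    (hv : SmoothAlong r v) : SmoothAlong r fun x => (u x, v x) := by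
  obtain ⟨U, hU, h⟩ := hu
  obtain ⟨V, hV, h'⟩ := hv
  exact ⟨fun y => (U y, V y), hU.prodMk hV, fun x => Prod.ext (h x) (h' x)⟩

theorem SmoothAlong.pi {ι : Type*} [Fintype ι] {F : ι → Type*} [∀ i, NormedAddCommGroup (F i)]
    [∀ i, NormedSpace ℝ (F i)] {r : X → E} {u : X → ∀ i, F i}
    (hu : ∀ i, SmoothAlong r fun x => u x i) : SmoothAlong r u := by
  choose U hU h using hu
  exact ⟨fun y i => U i y, contDiff_pi.2 hU, fun x => funext fun i => h i x⟩

/-- The spaces `X` and `Y` carry no smooth structure of their own, so smoothness of the substitution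
is only ever tested after embedding by `r`. -/
theorem SmoothAlong.comp {r : X → E} {u : X → F} (hu : SmoothAlong r u) {s : Y → E'} {c : Y → X}
    (hc : SmoothAlong s fun y => r (c y)) : SmoothAlong s fun y => u (c y) := by
  obtain ⟨U, hU, h⟩ := hu
  obtain ⟨V, hV, h'⟩ := hc
  exact ⟨fun y => U (V y), hU.comp hV, fun y => (h _).trans (congrArg U (h' y))⟩

theorem SmoothAlong.id (r : X → E) : SmoothAlong r r := ⟨_root_.id, contDiff_id, fun _ => rfl⟩

theorem smoothAlong_id {u : E → F} : SmoothAlong _root_.id u ↔ ContDiff ℝ ∞ u := by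
  refine ⟨?_, fun h => ⟨u, h, fun _ => rfl⟩⟩
  rintro ⟨U, hU, h⟩
  rwa [show u = U from funext h]

theorem SmoothAlong.continuous [TopologicalSpace X] {r : X → E} {u : X → F} (hr : Continuous r)
    (hu : SmoothAlong r u) : Continuous u := by
  obtain ⟨U, hU, h⟩ := hu
  rw [show u = U ∘ r from funext h]
  exact hU.continuous.comp hr

theorem SmoothAlong.add {r : X → E} {u v : X → F} (hu : SmoothAlong r u) (hv : SmoothAlong r v) :
    SmoothAlong r fun x => u x + v x :=
  (hu.prodMk hv).contDiff_comp (f := fun p : F × F => p.1 + p.2) (by fun_prop)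

theorem SmoothAlong.neg {r : X → E} {u : X → F} (hu : SmoothAlong r u) :
    SmoothAlong r fun x => -u x :=
  hu.contDiff_comp (f := fun y => -y) (by fun_prop)

theorem SmoothAlong.sub {r : X → E} {u v : X → F} (hu : SmoothAlong r u) (hv : SmoothAlong r v) :
    SmoothAlong r fun x => u x - v x :=
  (hu.prodMk hv).contDiff_comp (f := fun p : F × F => p.1 - p.2) (by fun_prop)

theorem SmoothAlong.mul {r : X → E} {u v : X → ℂ} (hu : SmoothAlong r u) (hv : SmoothAlong r v) :
    SmoothAlong r fun x => u x * v x :=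
  (hu.prodMk hv).contDiff_comp (f := fun p : ℂ × ℂ => p.1 * p.2) (by fun_prop)

theorem SmoothAlong.conj {r : X → E} {u : X → ℂ} (hu : SmoothAlong r u) :
    SmoothAlong r fun x => (starRingEnd ℂ) (u x) :=
  hu.contDiff_comp (f := fun z : ℂ => (starRingEnd ℂ) z) Complex.conjCLE.contDiff

theorem SmoothAlong.sum {α : Type*} {s : Finset α} {r : X → E} {u : α → X → F}
    (hu : ∀ a ∈ s, SmoothAlong r (u a)) : SmoothAlong r fun x => ∑ a ∈ s, u a x := by
  classical
  induction s using Finset.induction_on with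
  | empty => simpa using SmoothAlong.const r 0
  | insert a s ha ih =>
    simp only [Finset.sum_insert ha]
    exact (hu a (by simp)).add (ih fun b hb => hu b (by simp [hb]))

theorem SmoothAlong.prod {α : Type*} {s : Finset α} {r : X → E} {u : α → X → ℂ}
    (hu : ∀ a ∈ s, SmoothAlong r (u a)) : SmoothAlong r fun x => ∏ a ∈ s, u a x := by
  classical
  induction s using Finset.induction_on with
  | empty => simpa using SmoothAlong.const r 1
  | insert a s ha ih =>
    simp only [Finset.prod_insert ha]
    exact (hu a (by simp)).mul (ih fun b hb => hu b (by simp [hb]))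

end SmoothAlong

/-! ## Integrals depending smoothly on parameters -/

section ParametricIntegral

variable {P E K : Type*} [NormedAddCommGroup P] [NormedSpace ℝ P] [FiniteDimensional ℝ P]
  [NormedAddCommGroup E] [NormedSpace ℝ E] [TopologicalSpace K] [CompactSpace K]
  [MeasurableSpace K] [BorelSpace K] {ν : Measure K} [IsFiniteMeasure ν]

theorem integrable_of_continuous_compactSpace {F : Type*} [NormedAddCommGroup F]
    {f : K → F} (hf : Continuous f) : Integrable f ν := by
  rw [← integrableOn_univ]
  exact hf.continuousOn.integrableOn_compact' isCompact_univ MeasurableSet.univ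

/-- Dominated convergence with a constant bound: the derivative is continuous on the product of a
closed ball, compact since `P` is finite-dimensional, with the compact space `K`. -/
theorem hasFDerivAt_integral_of_contDiff {f : P × E → ℂ} (hf : ContDiff ℝ ∞ f) {r : K → E}
    (hr : Continuous r) (p : P) :
    HasFDerivAt (fun p => ∫ k, f (p, r k) ∂ν)
      (∫ k, (fderiv ℝ f (p, r k)).comp (ContinuousLinearMap.inl ℝ P E) ∂ν) p := by
  have hcont : Continuous fun q : P × K =>
      (fderiv ℝ f (q.1, r q.2)).comp (ContinuousLinearMap.inl ℝ P E) :=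
    ((hf.continuous_fderiv (by simp)).comp
      (continuous_fst.prodMk (hr.comp continuous_snd))).clm_comp continuous_const
  have : ProperSpace P := FiniteDimensional.proper_real P
  obtain ⟨C, hC⟩ := ((isCompact_closedBall p 1).prod (isCompact_univ (X := K))).bddAbove_image
    hcont.norm.continuousOn
  refine hasFDerivAt_integral_of_dominated_of_fderiv_le (bound := fun _ => C)
    (F := fun p k => f (p, r k)) (Metric.closedBall_mem_nhds p one_pos)
    (F' := fun p k => (fderiv ℝ f (p, r k)).comp (ContinuousLinearMap.inl ℝ P E)) ?_ ?_ ?_ ?_ ?_ ?_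
  · exact Filter.Eventually.of_forall fun q =>
      (hf.continuous.comp (continuous_const.prodMk hr)).aestronglyMeasurable
  · exact integrable_of_continuous_compactSpace (hf.continuous.comp (continuous_const.prodMk hr))
  · exact (hcont.comp (continuous_const.prodMk continuous_id)).aestronglyMeasurable
  · exact Filter.Eventually.of_forall fun k q hq =>
      hC ⟨(q, k), ⟨hq, Set.mem_univ k⟩, rfl⟩
  · exact integrable_const C
  · refine Filter.Eventually.of_forall fun k q _ => ?_
    have h1 : HasFDerivAt f (fderiv ℝ f (q, r k)) (q, r k) :=
      (hf.differentiable (by simp) _).hasFDerivAt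
    exact h1.comp q (hasFDerivAt_prodMk_left q (r k))

/-- Each directional derivative in the parameter is again an integral of the same kind, so one
induction over the order, uniform in the integrand, suffices. -/
theorem contDiff_integral_of_contDiff {f : P × E → ℂ} (hf : ContDiff ℝ ∞ f) {r : K → E}
    (hr : Continuous r) : ContDiff ℝ ∞ fun p => ∫ k, f (p, r k) ∂ν := by
  rw [contDiff_infty]
  intro n
  induction n generalizing f with
  | zero =>
    exact contDiff_zero.2 (continuous_iff_continuousAt.2 fun p =>
      (hasFDerivAt_integral_of_contDiff hf hr p).continuousAt)
  | succ n ih =>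
    push_cast
    refine contDiff_succ_iff_fderiv_apply.2
      ⟨fun p => (hasFDerivAt_integral_of_contDiff hf hr p).differentiableAt, by simp, fun y => ?_⟩
    have hy : ContDiff ℝ ∞ fun q : P × E => fderiv ℝ f q (y, 0) :=
      (hf.fderiv_right (m := ∞) (by simp)).clm_apply contDiff_const
    convert ih hy using 2 with p
    rw [(hasFDerivAt_integral_of_contDiff hf hr p).fderiv, ContinuousLinearMap.integral_apply]
    · simp
    · exact integrable_of_continuous_compactSpace (((hf.continuous_fderiv (by simp)).comp
        (continuous_const.prodMk hr)).clm_comp continuous_const)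

theorem SmoothAlong.integral {X : Type*} {r : X → P} {s : K → E} (hs : Continuous s)
    {u : X → K → ℂ} (hu : SmoothAlong (fun p : X × K => (r p.1, s p.2)) fun p => u p.1 p.2) :
    SmoothAlong r fun x => ∫ k, u x k ∂ν := by
  obtain ⟨U, hU, h⟩ := hu
  exact ⟨fun p => ∫ k, U (p, s k) ∂ν, contDiff_integral_of_contDiff hU hs, fun x => by
    simp only [← h (x, _)]⟩

theorem hasDerivAt_integral_of_smoothAlong {s : K → E} (hs : Continuous s) {u : ℝ → K → ℂ}
    (hu : SmoothAlong (fun p : ℝ × K => (p.1, s p.2)) fun p => u p.1 p.2) (t : ℝ) :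
    HasDerivAt (fun t => ∫ k, u t k ∂ν) (∫ k, deriv (fun t => u t k) t ∂ν) t := by
  obtain ⟨U, hU, h⟩ := hu
  have h' : u = fun t k => U (t, s k) := funext fun t => funext fun k => h (t, k)
  subst h'
  have hd : ∀ k, deriv (fun t => U (t, s k)) t = fderiv ℝ U (t, s k) (1, 0) := fun k =>
    (((hU.differentiable (by simp) _).hasFDerivAt.comp t
      (hasFDerivAt_prodMk_left t (s k))).hasDerivAt.deriv).trans (by simp)
  convert (hasFDerivAt_integral_of_contDiff (ν := ν) hU hs t).hasDerivAt using 1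
  rw [ContinuousLinearMap.integral_apply]
  · simp [hd]
  · exact integrable_of_continuous_compactSpace (((hU.continuous_fderiv (by simp)).comp
        (continuous_const.prodMk hs)).clm_comp continuous_const)

end ParametricIntegral

/-- Symmetry of the second derivative, in the form needed to interchange a flow with a right
translation in `frameDeriv_lieDeriv`. -/
theorem deriv_deriv_comm {g : ℝ × ℝ → ℂ} (hg : ContDiff ℝ ∞ g) :
    deriv (fun s => deriv (fun t => g (s, t)) 0) 0 =
      deriv (fun t => deriv (fun s => g (s, t)) 0) 0 := by
  have hd : ∀ q, HasFDerivAt g (fderiv ℝ g q) q := fun q =>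
    (hg.differentiable (by simp) q).hasFDerivAt
  have hd2 : HasFDerivAt (fderiv ℝ g) (fderiv ℝ (fderiv ℝ g) (0, 0)) (0, 0) :=
    ((hg.fderiv_right (m := ∞) (by simp)).differentiable (by simp) _).hasFDerivAt
  have h1 : ∀ s, deriv (fun t => g (s, t)) 0 = fderiv ℝ g (s, 0) (0, 1) := fun s =>
    (((hd (s, 0)).comp (0 : ℝ) (hasFDerivAt_prodMk_right s 0)).hasDerivAt.deriv).trans (by simp)
  have h2 : ∀ t, deriv (fun s => g (s, t)) 0 = fderiv ℝ g (0, t) (1, 0) := fun t =>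
    (((hd (0, t)).comp (0 : ℝ) (hasFDerivAt_prodMk_left 0 t)).hasDerivAt.deriv).trans (by simp)
  simp only [h1, h2]
  have e1 : HasDerivAt (fun s : ℝ => fderiv ℝ g (s, 0) (0, 1))
      (fderiv ℝ (fderiv ℝ g) (0, 0) (1, 0) (0, 1)) 0 := by
    have := (HasFDerivAt.comp_hasDerivAt (0 : ℝ) (f := fun s : ℝ => (s, (0 : ℝ))) hd2
      ((hasDerivAt_id (0 : ℝ)).prodMk (hasDerivAt_const (0 : ℝ) (0 : ℝ)))).clm_apply
      (hasDerivAt_const (0 : ℝ) ((0 : ℝ), (1 : ℝ)))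
    simpa using this
  have e2 : HasDerivAt (fun t : ℝ => fderiv ℝ g (0, t) (1, 0))
      (fderiv ℝ (fderiv ℝ g) (0, 0) (0, 1) (1, 0)) 0 := by
    have := (HasFDerivAt.comp_hasDerivAt (0 : ℝ) (f := fun t : ℝ => ((0 : ℝ), t)) hd2
      ((hasDerivAt_const (0 : ℝ) (0 : ℝ)).prodMk (hasDerivAt_id (0 : ℝ)))).clm_apply
      (hasDerivAt_const (0 : ℝ) ((1 : ℝ), (0 : ℝ)))
    simpa using this
  rw [e1.deriv, e2.deriv]
  exact (hg.contDiffAt.isSymmSndFDerivAt (by simpa using WithTop.coe_le_coe.2 (le_top : (2 : ℕ∞) ≤ ⊤))).eq _ _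

/-! ## Smooth group-valued maps -/

section SmoothGroup

variable {G : Type*} [Group G] {N : ℕ} {ι : Type*} [Fintype ι] [DecidableEq ι]
variable {ρ : G →* Matrix (Fin N) (Fin N) ℂ}
variable {X E : Type*} [NormedAddCommGroup E] [NormedSpace ℝ E] {r : X → E}

/-- The embedding of `ι → G` into tuples of matrices. -/
def matEmb (ρ : G →* Matrix (Fin N) (Fin N) ℂ) (x : ι → G) : ι → Fin N → Fin N → ℂ :=
  fun A i j => ρ (x A) i j

/-- The matrix coefficients of `c` are restrictions along `r` of smooth functions. -/
def SmoothGroup (ρ : G →* Matrix (Fin N) (Fin N) ℂ) (r : X → E) (c : X → G) : Prop :=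
  ∀ i j, SmoothAlong r fun x => ρ (c x) i j

theorem SmoothGroup.const (r : X → E) (g : G) : SmoothGroup ρ r fun _ => g :=
  fun _ _ => SmoothAlong.const _ _

theorem SmoothGroup.mul {c c' : X → G} (hc : SmoothGroup ρ r c) (hc' : SmoothGroup ρ r c') :
    SmoothGroup ρ r fun x => c x * c' x := by
  intro i j
  simp only [map_mul, Matrix.mul_apply]
  exact SmoothAlong.sum fun k _ => (hc i k).mul (hc' k j)

theorem OneParam.smoothGroup (γ : OneParam ρ) {τ : X → ℝ} (hτ : SmoothAlong r τ) :
    SmoothGroup ρ r fun x => γ (τ x) :=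
  fun i j => hτ.contDiff_comp (γ.smooth i j)

theorem smoothAlong_matEmb {c : X → ι → G} :
    SmoothAlong r (fun x => matEmb ρ (c x)) ↔ ∀ A, SmoothGroup ρ r fun x => c x A := by
  refine ⟨fun h A i j => ?_, fun h => ?_⟩
  · exact h.contDiff_comp (f := fun Y : ι → Fin N → Fin N → ℂ => Y A i j) (by fun_prop)
  · exact SmoothAlong.pi fun A => SmoothAlong.pi fun i => SmoothAlong.pi fun j => h A i j

theorem smoothGroup_eval (A : ι) : SmoothGroup ρ (matEmb ρ) fun x : ι → G => x A :=
  smoothAlong_matEmb.1 (SmoothAlong.id _) A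

/-- Reduces smoothness of any substitution into a field to smoothness of each group-valued slot,
where closure under products and inverses is available. -/
theorem IsSmooth.comp_smoothGroup {u : (ι → G) → ℂ} (hu : IsSmooth ρ u) {c : X → ι → G}
    (hc : ∀ A, SmoothGroup ρ r fun x => c x A) : SmoothAlong r fun x => u (c x) :=
  SmoothAlong.comp (r := matEmb ρ) hu (smoothAlong_matEmb.2 hc)

theorem SmoothGroup.update {c : X → ι → G} (hc : ∀ A, SmoothGroup ρ r fun x => c x A) (A : ι)
    {g : X → G} (hg : SmoothGroup ρ r g) (B : ι) :
    SmoothGroup ρ r fun x => Function.update (c x) A (g x) B := by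
  by_cases h : B = A
  · subst h; simpa using hg
  · simpa [h] using hc B

end SmoothGroup

/-! ## One-parameter subgroups -/

section OneParam

variable {G : Type*} [Group G] {N : ℕ} {ρ : G →* Matrix (Fin N) (Fin N) ℂ}

theorem OneParam.map_zero (γ : OneParam ρ) : γ 0 = 1 := by
  have := γ.map_add 0 0
  simpa using this

theorem OneParam.map_neg (γ : OneParam ρ) (t : ℝ) : γ (-t) = (γ t)⁻¹ := by
  have := γ.map_add (-t) t
  rw [neg_add_cancel, γ.map_zero] at this
  exact eq_inv_of_mul_eq_one_left this.symm

theorem OneParam.comm (γ : OneParam ρ) (s t : ℝ) : γ s * γ t = γ t * γ s := by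
  rw [← γ.map_add, add_comm, γ.map_add]

theorem OneParam.hasDerivAt (γ : OneParam ρ) (i j : Fin N) :
    HasDerivAt (fun t => ρ (γ t) i j) (velocity ρ γ i j) 0 :=
  ((γ.smooth i j).differentiable (by simp) 0).hasDerivAt

theorem velocity_eq {c : ℝ → G} {v : Matrix (Fin N) (Fin N) ℂ}
    (h : ∀ i j, HasDerivAt (fun t => ρ (c t) i j) (v i j) 0) : velocity ρ c = v :=
  Matrix.ext fun i j => (h i j).deriv

theorem hasDerivAt_matrix_mul {c c' : ℝ → G} {v v' : Matrix (Fin N) (Fin N) ℂ} {t : ℝ}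
    (h : ∀ i j, HasDerivAt (fun t => ρ (c t) i j) (v i j) t)
    (h' : ∀ i j, HasDerivAt (fun t => ρ (c' t) i j) (v' i j) t) (i j : Fin N) :
    HasDerivAt (fun t => ρ (c t * c' t) i j) ((v * ρ (c' t) + ρ (c t) * v') i j) t := by
  simp only [map_mul, Matrix.mul_apply, Matrix.add_apply, ← Finset.sum_add_distrib]
  exact HasDerivAt.fun_sum fun k _ => (h i k).mul (h' k j)

theorem hasDerivAt_matrix_const (g : G) (i j : Fin N) (t : ℝ) :
    HasDerivAt (fun _ : ℝ => ρ g i j) ((0 : Matrix (Fin N) (Fin N) ℂ) i j) t :=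
  hasDerivAt_const _ _

theorem hasDerivAt_const_mul_mul_const (γ : OneParam ρ) (g h : G) (i j : Fin N) :
    HasDerivAt (fun t => ρ (g * γ t * h) i j) ((ρ g * velocity ρ γ * ρ h) i j) 0 := by
  simpa [OneParam.map_zero] using hasDerivAt_matrix_mul (hasDerivAt_matrix_mul
    (fun i j => hasDerivAt_matrix_const g i j 0) γ.hasDerivAt)
    (fun i j => hasDerivAt_matrix_const h i j 0) i j

/-- The conjugate `g γ g⁻¹` of a one-parameter subgroup. -/
def OneParam.conjBy (g : G) (γ : OneParam ρ) : OneParam ρ where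
  toFun t := g * γ t * g⁻¹
  map_add s t := by rw [γ.map_add]; group
  smooth i j := smoothAlong_id.1 (((SmoothGroup.const _ g).mul
    (γ.smoothGroup (SmoothAlong.id _root_.id))).mul (SmoothGroup.const _ g⁻¹) i j)

theorem velocity_conjBy (g : G) (γ : OneParam ρ) :
    velocity ρ (γ.conjBy g) = ρ g * velocity ρ γ * ρ g⁻¹ :=
  velocity_eq fun i j => hasDerivAt_const_mul_mul_const γ g g⁻¹ i j

/-- A one-parameter subgroup is commutative, so its own elements conjugate it trivially. -/
theorem velocity_conjBy_self (γ : OneParam ρ) (t : ℝ) :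
    velocity ρ (γ.conjBy (γ t)) = velocity ρ γ := by
  congr 1
  funext s
  change γ t * γ s * (γ t)⁻¹ = γ s
  rw [γ.comm t s, mul_inv_cancel_right]

theorem OneParam.conjBy_mul (g h : G) (γ : OneParam ρ) :
    γ.conjBy (g * h) = (γ.conjBy h).conjBy g := by
  simp only [OneParam.conjBy, mul_inv_rev, mul_assoc]

theorem OneParam.hasDerivAt_inv (γ : OneParam ρ) (i j : Fin N) :
    HasDerivAt (fun t => ρ (γ t)⁻¹ i j) ((-velocity ρ γ) i j) 0 := by
  have h : HasDerivAt (fun t => ρ (γ t) i j) (velocity ρ γ i j) (-0) := by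
    simpa using γ.hasDerivAt i j
  simpa [← γ.map_neg, Function.comp_def] using h.scomp (0 : ℝ) (hasDerivAt_neg 0)

end OneParam

/-! ## The invariant metric -/

section Metric

variable {G : Type*} [Group G] {N d : ℕ} {ρ : G →* Matrix (Fin N) (Fin N) ℂ}
variable (Q : InvariantMetric ρ d)

theorem InvariantMetric.expand {w : Matrix (Fin N) (Fin N) ℂ}
    (hw : w ∈ Submodule.span ℝ (Set.range fun a => velocity ρ (Q.e a))) :
    w = ∑ a, Q.B w (velocity ρ (Q.e a)) • velocity ρ (Q.e a) := by
  obtain ⟨c, rfl⟩ := (Submodule.mem_span_range_iff_exists_fun ℝ).1 hw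
  refine Finset.sum_congr rfl fun a _ => ?_
  congr 1
  simp [map_sum, LinearMap.sum_apply, Q.orthonormal]

theorem InvariantMetric.parseval (γ δ : OneParam ρ) :
    Q.B (velocity ρ γ) (velocity ρ δ) =
      ∑ a, Q.B (velocity ρ γ) (velocity ρ (Q.e a)) * Q.B (velocity ρ δ) (velocity ρ (Q.e a)) := by
  conv_lhs => rw [Q.expand (Q.spanning δ)]
  simp [map_sum, mul_comm]

/-- Symmetry is visible on the right-hand side of Parseval's identity, which needs only
orthonormality and spanning. -/
theorem InvariantMetric.symm (γ δ : OneParam ρ) :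
    Q.B (velocity ρ γ) (velocity ρ δ) = Q.B (velocity ρ δ) (velocity ρ γ) := by
  rw [Q.parseval γ δ, Q.parseval δ γ]
  exact Finset.sum_congr rfl fun a _ => mul_comm _ _

theorem InvariantMetric.conjBy_conjBy (g : G) (γ δ : OneParam ρ) :
    Q.B (velocity ρ (γ.conjBy g)) (velocity ρ (δ.conjBy g)) =
      Q.B (velocity ρ γ) (velocity ρ δ) := by
  rw [velocity_conjBy, velocity_conjBy, Q.ad_invariant]

theorem InvariantMetric.conjBy_left (g : G) (γ δ : OneParam ρ) :
    Q.B (velocity ρ (γ.conjBy g)) (velocity ρ δ) =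
      Q.B (velocity ρ γ) (velocity ρ (δ.conjBy g⁻¹)) := by
  have h := Q.conjBy_conjBy g⁻¹ (γ.conjBy g) δ
  rw [← OneParam.conjBy_mul, inv_mul_cancel] at h
  have h1 : γ.conjBy 1 = γ := by simp [OneParam.conjBy]
  rw [← h, h1]

/-- The columns of the matrix of `Ad g` in an orthonormal basis are orthonormal. -/
theorem InvariantMetric.adjoint_orthogonal (g : G) (b c : Fin d) :
    ∑ a, Q.B (velocity ρ ((Q.e a).conjBy g)) (velocity ρ (Q.e b)) *
      Q.B (velocity ρ ((Q.e a).conjBy g)) (velocity ρ (Q.e c)) = if b = c then 1 else 0 := by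
  -- Moving the conjugation onto the other argument turns the sum over `a` into a Parseval expansion
  -- of the product of two conjugated basis vectors.
  simp only [Q.conjBy_left g, Q.symm (Q.e _) ((Q.e _).conjBy g⁻¹)]
  rw [← Q.parseval, Q.conjBy_conjBy, Q.orthonormal]

end Metric

/-! ## Derivatives on products of copies of `G` -/

section Derivatives

variable {G : Type*} [Group G] {N d : ℕ} {ι : Type*} [Fintype ι] [DecidableEq ι]
variable {ρ : G →* Matrix (Fin N) (Fin N) ℂ}

theorem hasDerivAt_smooth_curve {F : (ι → Fin N → Fin N → ℂ) → ℂ} (hF : ContDiff ℝ ∞ F)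
    {u : (ι → G) → ℂ} (hu : ∀ x, u x = F (matEmb ρ x)) {c : ℝ → ι → G}
    {K : ι → Fin N → Fin N → ℂ}
    (hc : ∀ A i j, HasDerivAt (fun t => ρ (c t A) i j) (K A i j) 0) :
    HasDerivAt (fun t => u (c t)) (fderiv ℝ F (matEmb ρ (c 0)) K) 0 := by
  simp only [hu]
  have h : HasDerivAt (fun t => matEmb ρ (c t)) K 0 :=
    hasDerivAt_pi.2 fun A => hasDerivAt_pi.2 fun i => hasDerivAt_pi.2 fun j => hc A i j
  exact (hF.differentiable (by simp) _).hasFDerivAt.comp_hasDerivAt (0 : ℝ) h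

/-- The derivative of `u` along right translation of the `A`-th copy of `G` by `δ`. -/
def rightDeriv (A : ι) (δ : OneParam ρ) (u : (ι → G) → ℂ) (x : ι → G) : ℂ :=
  deriv (fun t : ℝ => u (Function.update x A (x A * δ t))) 0

/-- Expressing the derivative through the ambient differential makes it visibly linear in the
velocity of `δ`. This is what later allows expansion in the frame. -/
theorem exists_linear_rightDeriv {F : (ι → Fin N → Fin N → ℂ) → ℂ} (hF : ContDiff ℝ ∞ F)
    {u : (ι → G) → ℂ} (hu : ∀ x, u x = F (matEmb ρ x)) (A : ι) (δ : OneParam ρ) (x : ι → G) :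
    HasDerivAt (fun t : ℝ => u (Function.update x A (x A * δ t)))
      (fderiv ℝ F (matEmb ρ x)
        (Pi.single A (Matrix.of.symm (ρ (x A) * velocity ρ δ)))) 0 := by
  have h := hasDerivAt_smooth_curve hF hu (c := fun t => Function.update x A (x A * δ t))
    (K := Pi.single A (Matrix.of.symm (ρ (x A) * velocity ρ δ))) ?_
  · simpa [δ.map_zero] using h
  · intro B i j
    by_cases hB : B = A
    · subst hB
      simpa using hasDerivAt_const_mul_mul_const δ (x B) 1 i j
    · simpa [hB] using hasDerivAt_const (0 : ℝ) (ρ (x B) i j)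

theorem IsSmooth.hasDerivAt_right {u : (ι → G) → ℂ} (hu : IsSmooth ρ u) (A : ι) (δ : OneParam ρ)
    (x : ι → G) :
    HasDerivAt (fun t : ℝ => u (Function.update x A (x A * δ t))) (rightDeriv A δ u x) 0 := by
  obtain ⟨F, hF, hu⟩ := hu
  exact (exists_linear_rightDeriv hF hu A δ x).differentiableAt.hasDerivAt

theorem IsSmooth.rightDeriv {u : (ι → G) → ℂ} (hu : IsSmooth ρ u) (A : ι) (δ : OneParam ρ) :
    IsSmooth ρ (rightDeriv A δ u) := by
  obtain ⟨F, hF, hu⟩ := hu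
  refine ⟨fun X => fderiv ℝ F X (Pi.single A fun i j => ∑ k, X A i k * velocity ρ δ k j), ?_,
    fun x => (exists_linear_rightDeriv hF hu A δ x).deriv⟩
  refine (hF.fderiv_right (m := ∞) (by simp)).clm_apply (contDiff_pi.2 fun B => ?_)
  by_cases hB : B = A
  · subst hB
    simp only [Pi.single_eq_same]
    fun_prop
  · simp only [Pi.single_apply, hB, if_false]
    exact contDiff_const

variable (Q : InvariantMetric ρ d)

theorem frameDeriv_eq_rightDeriv (A : ι) (a : Fin d) :
    frameDeriv Q A a = rightDeriv A (Q.e a) := rfl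

theorem IsSmooth.frameDeriv {u : (ι → G) → ℂ} (hu : IsSmooth ρ u) (A : ι) (a : Fin d) :
    IsSmooth ρ (frameDeriv Q A a u) := hu.rightDeriv A (Q.e a)

theorem fderiv_single_expand (F : (ι → Fin N → Fin N → ℂ) → ℂ) (A : ι) (x : ι → G)
    {w : Matrix (Fin N) (Fin N) ℂ}
    (hw : w ∈ Submodule.span ℝ (Set.range fun a => velocity ρ (Q.e a))) :
    fderiv ℝ F (matEmb ρ x) (Pi.single A (Matrix.of.symm (ρ (x A) * w))) =
      ∑ b, (Q.B w (velocity ρ (Q.e b)) : ℂ) *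
        fderiv ℝ F (matEmb ρ x)
          (Pi.single A (Matrix.of.symm (ρ (x A) * velocity ρ (Q.e b)))) := by
  let L : Matrix (Fin N) (Fin N) ℂ →ₗ[ℝ] ℂ :=
    (fderiv ℝ F (matEmb ρ x)).toLinearMap ∘ₗ
      LinearMap.single ℝ (fun _ : ι => Fin N → Fin N → ℂ) A ∘ₗ
      (Matrix.ofLinearEquiv ℝ).symm.toLinearMap ∘ₗ LinearMap.mulLeft ℝ (ρ (x A))
  change L w = ∑ b, _ * L _
  conv_lhs => rw [Q.expand hw]
  simp only [map_sum, map_smul, Complex.real_smul]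

theorem IsSmooth.rightDeriv_expand {u : (ι → G) → ℂ} (hu : IsSmooth ρ u) (A : ι) (δ : OneParam ρ)
    (x : ι → G) :
    GFT.rightDeriv A δ u x = ∑ b, (Q.B (velocity ρ δ) (velocity ρ (Q.e b)) : ℂ) *
      GFT.frameDeriv Q A b u x := by
  obtain ⟨F, hF, hu⟩ := hu
  simp only [frameDeriv_eq_rightDeriv, GFT.rightDeriv, (exists_linear_rightDeriv hF hu A _ x).deriv]
  exact fderiv_single_expand Q F A x (Q.spanning δ)

theorem frameDeriv_sum_mul {d' : ℕ} {A : ι} {a : Fin d} (z : Fin d' → ℂ)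
    {u : Fin d' → (ι → G) → ℂ} (hu : ∀ b, IsSmooth ρ (u b)) (x : ι → G) :
    frameDeriv Q A a (fun y => ∑ b, z b * u b y) x = ∑ b, z b * frameDeriv Q A a (u b) x :=
  (HasDerivAt.fun_sum fun b _ => ((hu b).hasDerivAt_right A (Q.e a) x).const_mul (z b)).deriv

theorem frameDeriv_add {A : ι} {a : Fin d} {u v : (ι → G) → ℂ} (hu : IsSmooth ρ u)
    (hv : IsSmooth ρ v) (x : ι → G) :
    frameDeriv Q A a (fun y => u y + v y) x = frameDeriv Q A a u x + frameDeriv Q A a v x :=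
  ((hu.hasDerivAt_right A (Q.e a) x).add (hv.hasDerivAt_right A (Q.e a) x)).deriv

theorem frameDeriv_sub {A : ι} {a : Fin d} {u v : (ι → G) → ℂ} (hu : IsSmooth ρ u)
    (hv : IsSmooth ρ v) (x : ι → G) :
    frameDeriv Q A a (fun y => u y - v y) x = frameDeriv Q A a u x - frameDeriv Q A a v x :=
  ((hu.hasDerivAt_right A (Q.e a) x).sub (hv.hasDerivAt_right A (Q.e a) x)).deriv

theorem frameDeriv_mul {A : ι} {a : Fin d} {u v : (ι → G) → ℂ} (hu : IsSmooth ρ u)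
    (hv : IsSmooth ρ v) (x : ι → G) :
    frameDeriv Q A a (fun y => u y * v y) x =
      frameDeriv Q A a u x * v x + u x * frameDeriv Q A a v x := by
  have h := ((hu.hasDerivAt_right A (Q.e a) x).fun_mul (hv.hasDerivAt_right A (Q.e a) x)).deriv
  simpa [(Q.e a).map_zero, frameDeriv, rightDeriv] using h

theorem frameDeriv_const_mul {A : ι} {a : Fin d} (z : ℂ) (u : (ι → G) → ℂ) (x : ι → G) :
    frameDeriv Q A a (fun y => z * u y) x = z * frameDeriv Q A a u x :=
  deriv_const_mul_field z

theorem frameDeriv_sum {α : Type*} {s : Finset α} {A : ι} {a : Fin d} {u : α → (ι → G) → ℂ}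
    (hu : ∀ c ∈ s, IsSmooth ρ (u c)) (x : ι → G) :
    frameDeriv Q A a (fun y => ∑ c ∈ s, u c y) x = ∑ c ∈ s, frameDeriv Q A a (u c) x :=
  (HasDerivAt.fun_sum fun c hc => (hu c hc).hasDerivAt_right A (Q.e a) x).deriv

theorem frameDeriv_conj {A : ι} {a : Fin d} (u : (ι → G) → ℂ) (x : ι → G) :
    frameDeriv Q A a (fun y => conj (u y)) x = conj (frameDeriv Q A a u x) := by
  unfold frameDeriv
  exact deriv.star

end Derivatives

/-! ## Two-sided translation flows -/

section Flow

variable {G : Type*} [Group G] {N d : ℕ} {ι : Type*} [Fintype ι] [DecidableEq ι]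
variable {ρ : G →* Matrix (Fin N) (Fin N) ℂ}

/-- The flow `x A ↦ α A t * x A * (β A t)⁻¹`. -/
def biFlow (α β : ι → OneParam ρ) (t : ℝ) (x : ι → G) : ι → G :=
  fun A => α A t * x A * (β A t)⁻¹

/-- Left multiplication, conjugation (`α = β`) and the trivial flow are all instances of `biFlow`,
so a single Noether computation covers them. -/
theorem leftFlow_eq_biFlow (γ : ι → OneParam ρ) :
    leftFlow γ = biFlow γ fun _ => OneParam.trivial ρ := by
  funext t x A
  simp [leftFlow, biFlow, OneParam.trivial]

theorem trivialFlow_eq_biFlow (ρ : G →* Matrix (Fin N) (Fin N) ℂ) :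
    (trivialFlow : ℝ → (ι → G) → (ι → G)) =
      biFlow (fun _ => OneParam.trivial ρ) fun _ => OneParam.trivial ρ := by
  funext t x A
  simp [trivialFlow, biFlow, OneParam.trivial]

variable (α β : ι → OneParam ρ)

theorem biFlow_zero (x : ι → G) : biFlow α β 0 x = x := by
  funext A
  simp [biFlow, OneParam.map_zero]

theorem hasDerivAt_biFlow (x : ι → G) (A : ι) (i j : Fin N) :
    HasDerivAt (fun t => ρ (biFlow α β t x A) i j)
      ((velocity ρ (α A) * ρ (x A) - ρ (x A) * velocity ρ (β A)) i j) 0 := by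
  have h := hasDerivAt_matrix_mul (hasDerivAt_matrix_mul (α A).hasDerivAt
    (fun i j => hasDerivAt_matrix_const (x A) i j 0)) (β A).hasDerivAt_inv i j
  simpa [OneParam.map_zero, sub_eq_add_neg, biFlow] using h

theorem hasDerivAt_lieDeriv_fderiv {F : (ι → Fin N → Fin N → ℂ) → ℂ} (hF : ContDiff ℝ ∞ F)
    {u : (ι → G) → ℂ} (hu : ∀ x, u x = F (matEmb ρ x)) (x : ι → G) :
    HasDerivAt (fun t => u (biFlow α β t x)) (fderiv ℝ F (matEmb ρ x)
      fun A => Matrix.of.symm (velocity ρ (α A) * ρ (x A) - ρ (x A) * velocity ρ (β A))) 0 := by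
  have h := hasDerivAt_smooth_curve hF hu (c := fun t => biFlow α β t x)
    (K := fun A => Matrix.of.symm (velocity ρ (α A) * ρ (x A) - ρ (x A) * velocity ρ (β A)))
    fun A i j => hasDerivAt_biFlow α β x A i j
  simpa only [biFlow_zero] using h

theorem IsSmooth.hasDerivAt_lieDeriv {u : (ι → G) → ℂ} (hu : IsSmooth ρ u) (x : ι → G) :
    HasDerivAt (fun t => u (biFlow α β t x)) (lieDeriv (biFlow α β) u x) 0 := by
  obtain ⟨F, hF, hu⟩ := hu
  exact (hasDerivAt_lieDeriv_fderiv α β hF hu x).differentiableAt.hasDerivAt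

theorem IsSmooth.lieDeriv {u : (ι → G) → ℂ} (hu : IsSmooth ρ u) :
    IsSmooth ρ (lieDeriv (biFlow α β) u) := by
  obtain ⟨F, hF, hu⟩ := hu
  refine ⟨fun X => fderiv ℝ F X fun A i j =>
    (∑ k, velocity ρ (α A) i k * X A k j) - ∑ k, X A i k * velocity ρ (β A) k j, ?_,
    fun x => (hasDerivAt_lieDeriv_fderiv α β hF hu x).deriv⟩
  refine (hF.fderiv_right (m := ∞) (by simp)).clm_apply ?_
  fun_prop

/-- In the left trivialization the generator is `Ad (x A)⁻¹` of the velocity of `α A`, minus the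
velocity of `β A`; only the first part depends on the point. -/
theorem velocity_inv_mul_biFlow (x : ι → G) (A : ι) :
    velocity ρ (fun t => (x A)⁻¹ * biFlow α β t x A) =
      velocity ρ ((α A).conjBy (x A)⁻¹) - velocity ρ (β A) := by
  refine velocity_eq fun i j => ?_
  have h := hasDerivAt_matrix_mul (fun i j => hasDerivAt_matrix_const (x A)⁻¹ i j 0)
    (hasDerivAt_biFlow α β x A) i j
  convert h using 2
  rw [velocity_conjBy, Matrix.zero_mul, zero_add, mul_sub, ← mul_assoc, ← mul_assoc, ← map_mul]
  simp

variable (Q : InvariantMetric ρ d)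

theorem generatorComponent_biFlow (A : ι) (a : Fin d) (x : ι → G) :
    generatorComponent Q (biFlow α β) A a x =
      Q.B (velocity ρ ((α A).conjBy (x A)⁻¹)) (velocity ρ (Q.e a)) -
        Q.B (velocity ρ (β A)) (velocity ρ (Q.e a)) := by
  rw [generatorComponent, velocity_inv_mul_biFlow, map_sub, LinearMap.sub_apply]

/-- Translating by `e a` changes the `α` part by `Ad (e a t)⁻¹`. By invariance this may be moved
onto `e a` itself, which it fixes. Thus each component is constant along its own frame direction, a
stronger property than vanishing divergence. -/
theorem generatorComponent_update (A : ι) (a : Fin d) (x : ι → G) (t : ℝ) :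
    generatorComponent Q (biFlow α β) A a (Function.update x A (x A * Q.e a t)) =
      generatorComponent Q (biFlow α β) A a x := by
  rw [generatorComponent_biFlow, generatorComponent_biFlow, Function.update_self, mul_inv_rev,
    OneParam.conjBy_mul, Q.conjBy_left, inv_inv, velocity_conjBy_self]

theorem IsSmooth.lieDeriv_expand {u : (ι → G) → ℂ} (hu : IsSmooth ρ u) (x : ι → G) :
    GFT.lieDeriv (biFlow α β) u x =
      ∑ A, ∑ a, (generatorComponent Q (biFlow α β) A a x : ℂ) * GFT.frameDeriv Q A a u x := by
  obtain ⟨F, hF, hu⟩ := hu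
  simp only [frameDeriv_eq_rightDeriv, GFT.rightDeriv, (exists_linear_rightDeriv hF hu _ _ x).deriv,
    GFT.lieDeriv, (hasDerivAt_lieDeriv_fderiv α β hF hu x).deriv, generatorComponent]
  -- The tangent vector is split into its slots so that each can be expanded in the frame of one
  -- copy of `G`.
  have hsum : ∀ K : ι → Fin N → Fin N → ℂ, K = ∑ A, Pi.single A (K A) := fun K =>
    (Finset.univ_sum_single K).symm
  rw [hsum (fun A => Matrix.of.symm _), map_sum]
  refine Finset.sum_congr rfl fun A _ => ?_
  rw [← fderiv_single_expand Q F A x]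
  · congr 3
    rw [velocity_inv_mul_biFlow, velocity_conjBy, inv_inv, mul_sub, ← mul_assoc, ← mul_assoc,
      ← map_mul]
    simp
  · rw [velocity_inv_mul_biFlow]
    exact Submodule.sub_mem _ (Q.spanning _) (Q.spanning _)

end Flow

/-! ## Frame derivatives and flows -/

section Commutation

variable {G : Type*} [Group G] {N d : ℕ} {ι : Type*} [Fintype ι] [DecidableEq ι]
variable {ρ : G →* Matrix (Fin N) (Fin N) ℂ} (α β : ι → OneParam ρ) (Q : InvariantMetric ρ d)

theorem lieDeriv_add {u v : (ι → G) → ℂ} (hu : IsSmooth ρ u) (hv : IsSmooth ρ v) (x : ι → G) :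
    lieDeriv (biFlow α β) (fun y => u y + v y) x =
      lieDeriv (biFlow α β) u x + lieDeriv (biFlow α β) v x :=
  ((hu.hasDerivAt_lieDeriv α β x).add (hv.hasDerivAt_lieDeriv α β x)).deriv

theorem lieDeriv_sum {C : Type*} {s : Finset C} {u : C → (ι → G) → ℂ}
    (hu : ∀ c ∈ s, IsSmooth ρ (u c)) (x : ι → G) :
    lieDeriv (biFlow α β) (fun y => ∑ c ∈ s, u c y) x =
      ∑ c ∈ s, lieDeriv (biFlow α β) (u c) x :=
  (HasDerivAt.fun_sum fun c hc => (hu c hc).hasDerivAt_lieDeriv α β x).deriv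

theorem lieDeriv_mul {u v : (ι → G) → ℂ} (hu : IsSmooth ρ u) (hv : IsSmooth ρ v) (x : ι → G) :
    lieDeriv (biFlow α β) (fun y => u y * v y) x =
      lieDeriv (biFlow α β) u x * v x + u x * lieDeriv (biFlow α β) v x := by
  simpa [biFlow_zero, lieDeriv] using
    ((hu.hasDerivAt_lieDeriv α β x).fun_mul (hv.hasDerivAt_lieDeriv α β x)).deriv

theorem lieDeriv_const_mul (z : ℂ) (u : (ι → G) → ℂ) (x : ι → G) :
    lieDeriv (biFlow α β) (fun y => z * u y) x = z * lieDeriv (biFlow α β) u x :=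
  deriv_const_mul_field z

theorem lieDeriv_conj (u : (ι → G) → ℂ) (x : ι → G) :
    lieDeriv (biFlow α β) (fun y => conj (u y)) x = conj (lieDeriv (biFlow α β) u x) := by
  unfold lieDeriv
  exact deriv.star

/-- The matrix of `ad` of the velocity of `δ` in the orthonormal basis. -/
def adRate (δ : OneParam ρ) (a b : Fin d) : ℝ :=
  deriv (fun t => Q.B (velocity ρ ((Q.e a).conjBy (δ t))) (velocity ρ (Q.e b))) 0

/-- By invariance the transposed matrix entry is the same function of `t` evaluated at `-t`, so the
derivatives at zero are opposite. -/
theorem adRate_antisymm (δ : OneParam ρ) (a b : Fin d) : adRate Q δ a b = -adRate Q δ b a := by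
  unfold adRate
  have h : ∀ t, Q.B (velocity ρ ((Q.e a).conjBy (δ t))) (velocity ρ (Q.e b)) =
      (fun s => Q.B (velocity ρ ((Q.e b).conjBy (δ s))) (velocity ρ (Q.e a))) (-t) := fun t => by
    simp only [δ.map_neg]
    rw [Q.conjBy_left, Q.symm]
  rw [funext h]
  exact (deriv_comp_neg (fun s => Q.B (velocity ρ ((Q.e b).conjBy (δ s)))
    (velocity ρ (Q.e a))) (0 : ℝ)).trans (by rw [neg_zero])

/-- `B` is only assumed linear algebraically; continuity of the functional comes from the finite
dimension of the matrix space. -/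
theorem hasDerivAt_adRate (δ : OneParam ρ) (a b : Fin d) :
    HasDerivAt (fun t => Q.B (velocity ρ ((Q.e a).conjBy (δ t))) (velocity ρ (Q.e b)))
      (adRate Q δ a b) 0 := by
  refine DifferentiableAt.hasDerivAt ?_
  let L : (Fin N → Fin N → ℂ) →ₗ[ℝ] ℝ :=
    Q.B.flip (velocity ρ (Q.e b)) ∘ₗ (Matrix.ofLinearEquiv ℝ).toLinearMap
  have hL : (fun t => Q.B (velocity ρ ((Q.e a).conjBy (δ t))) (velocity ρ (Q.e b))) =
      fun t => LinearMap.toContinuousLinearMap L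
        (Matrix.of.symm (velocity ρ ((Q.e a).conjBy (δ t)))) := rfl
  rw [hL]
  refine (LinearMap.toContinuousLinearMap L).differentiableAt.comp (0 : ℝ) ?_
  refine differentiableAt_pi.2 fun i => differentiableAt_pi.2 fun j => ?_
  simp only [velocity_conjBy]
  change DifferentiableAt ℝ (fun t => (ρ (δ t) * velocity ρ (Q.e a) * ρ (δ t)⁻¹) i j) 0
  simp only [Matrix.mul_apply]
  exact DifferentiableAt.fun_sum fun k _ => (DifferentiableAt.fun_sum fun l _ =>
    (δ.hasDerivAt i l).differentiableAt.mul_const _).mul (δ.hasDerivAt_inv k j).differentiableAt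

/-- The left factor commutes with right translations and the right factor conjugates them, so the
flow carries the translation by `y` to the translation by its `β A t` conjugate. -/
theorem biFlow_update (t : ℝ) (x : ι → G) (A : ι) (y : G) :
    biFlow α β t (Function.update x A (x A * y)) =
      Function.update (biFlow α β t x) A
        (biFlow α β t x A * (β A t * y * (β A t)⁻¹)) := by
  funext B
  by_cases h : B = A
  · subst h
    simp only [biFlow, Function.update_self]
    group
  · simp [biFlow, h]

theorem OneParam.smoothGroup_inv {X E : Type*} [NormedAddCommGroup E] [NormedSpace ℝ E]
    {r : X → E} (γ : OneParam ρ) {τ : X → ℝ} (hτ : SmoothAlong r τ) :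
    SmoothGroup ρ r fun x => (γ (τ x))⁻¹ := by
  simp only [← γ.map_neg]
  exact γ.smoothGroup hτ.neg

/-- The commutator of `E_(A,a)` with the generator of the flow. It is a combination of frame fields
of the same slot with constant antisymmetric coefficients, and only `β` contributes to it. -/
theorem frameDeriv_lieDeriv {u : (ι → G) → ℂ} (hu : IsSmooth ρ u) (A : ι) (a : Fin d)
    (x : ι → G) :
    frameDeriv Q A a (lieDeriv (biFlow α β) u) x =
      lieDeriv (biFlow α β) (frameDeriv Q A a u) x +
        ∑ b, (adRate Q (β A) a b : ℂ) * frameDeriv Q A b u x := by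
  let g : ℝ × ℝ → ℂ := fun q => u (biFlow α β q.2 (Function.update x A (x A * Q.e a q.1)))
  have hfst : SmoothAlong (_root_.id : ℝ × ℝ → ℝ × ℝ) (fun q => q.1) :=
    smoothAlong_id.2 contDiff_fst
  have hsnd : SmoothAlong (_root_.id : ℝ × ℝ → ℝ × ℝ) (fun q => q.2) :=
    smoothAlong_id.2 contDiff_snd
  have hg : ContDiff ℝ ∞ g := by
    refine smoothAlong_id.1 (hu.comp_smoothGroup fun B => ?_)
    exact (((α B).smoothGroup hsnd).mul (SmoothGroup.update (fun B => SmoothGroup.const _ (x B)) A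
      ((SmoothGroup.const _ (x A)).mul ((Q.e a).smoothGroup hfst)) B)).mul
        ((β B).smoothGroup_inv hsnd)
  -- At fixed flow time the translation derivative runs along the conjugate of `e a`; its frame
  -- expansion isolates the time dependence for the product rule.
  have h1 : ∀ t, deriv (fun s => g (s, t)) 0 =
      ∑ b, (Q.B (velocity ρ ((Q.e a).conjBy (β A t))) (velocity ρ (Q.e b)) : ℂ) *
        frameDeriv Q A b u (biFlow α β t x) := fun t => by
    rw [← hu.rightDeriv_expand Q A ((Q.e a).conjBy (β A t))]
    simp only [g, biFlow_update, rightDeriv]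
    rfl
  change deriv (fun s => deriv (fun t => g (s, t)) 0) 0 = _
  rw [deriv_deriv_comm hg, funext h1]
  have h2 := HasDerivAt.fun_sum (u := Finset.univ) fun b _ =>
    ((hasDerivAt_adRate Q (β A) a b).ofReal_comp).fun_mul
      ((hu.frameDeriv Q A b).hasDerivAt_lieDeriv α β x)
  rw [h2.deriv, Finset.sum_add_distrib, add_comm]
  simp only [biFlow_zero, OneParam.map_zero]
  congr 1
  have h3 : ∀ b, velocity ρ ((Q.e b).conjBy 1) = velocity ρ (Q.e b) := fun b => by
    simp [velocity_conjBy]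
  simp [h3, Q.orthonormal, apply_ite Complex.ofReal]

end Commutation

/-! ## Divergence of the current -/

section Divergence

variable {G : Type*} [Group G] {N d : ℕ} {ι : Type*} [Fintype ι] [DecidableEq ι]
  {C : Type*} [Fintype C]
variable {ρ : G →* Matrix (Fin N) (Fin N) ℂ} (α β : ι → OneParam ρ) (Q : InvariantMetric ρ d)

/-- The Laplacian, weighted by couplings for the copies of `G`. -/
def laplacian (κ : ι → ℝ) (u : (ι → G) → ℂ) (x : ι → G) : ℂ :=
  ∑ A, (κ A : ℂ) * ∑ a, frameDeriv Q A a (frameDeriv Q A a u) x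

theorem IsSmooth.const_mul {u : (ι → G) → ℂ} (hu : IsSmooth ρ u) (z : ℂ) :
    IsSmooth ρ fun x => z * u x :=
  SmoothAlong.mul (SmoothAlong.const _ z) hu

theorem IsSmooth.add {u v : (ι → G) → ℂ} (hu : IsSmooth ρ u) (hv : IsSmooth ρ v) :
    IsSmooth ρ fun x => u x + v x :=
  SmoothAlong.add hu hv

theorem IsSmooth.sub {u v : (ι → G) → ℂ} (hu : IsSmooth ρ u) (hv : IsSmooth ρ v) :
    IsSmooth ρ fun x => u x - v x :=
  SmoothAlong.sub hu hv

theorem IsSmooth.mul {u v : (ι → G) → ℂ} (hu : IsSmooth ρ u) (hv : IsSmooth ρ v) :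
    IsSmooth ρ fun x => u x * v x :=
  SmoothAlong.mul hu hv

theorem IsSmooth.conj {u : (ι → G) → ℂ} (hu : IsSmooth ρ u) :
    IsSmooth ρ fun x => (starRingEnd ℂ) (u x) :=
  SmoothAlong.conj hu

theorem IsSmooth.sum {D : Type*} {s : Finset D} {u : D → (ι → G) → ℂ}
    (hu : ∀ c ∈ s, IsSmooth ρ (u c)) : IsSmooth ρ fun x => ∑ c ∈ s, u c x :=
  SmoothAlong.sum hu

theorem IsSmooth.laplacian {u : (ι → G) → ℂ} (hu : IsSmooth ρ u) (κ : ι → ℝ) :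
    IsSmooth ρ (laplacian Q κ u) :=
  IsSmooth.sum fun A _ => (IsSmooth.sum fun a _ =>
    (hu.frameDeriv Q A a).frameDeriv Q A a).const_mul _

theorem isSmooth_localLagrangian {φ : C → (ι → G) → ℂ} (hφ : ∀ c, IsSmooth ρ (φ c)) (κ : ι → ℝ)
    (m : ℝ) : IsSmooth ρ (localLagrangian Q κ m φ) :=
  IsSmooth.sum fun c _ => (IsSmooth.sum fun A _ => (IsSmooth.sum fun a _ =>
    ((hφ c).conj.frameDeriv Q A a).mul ((hφ c).frameDeriv Q A a)).const_mul _).add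
      (((hφ c).conj.mul (hφ c)).const_mul _)

theorem characteristic_biFlow {φ : C → (ι → G) → ℂ} (hφ : ∀ c, IsSmooth ρ (φ c)) (θ : C → ℝ)
    (c : C) (x : ι → G) :
    characteristic (biFlow α β) θ φ c x =
      Complex.I * θ c * φ c x - lieDeriv (biFlow α β) (φ c) x := by
  have h1 : HasDerivAt (fun t : ℝ => Complex.exp (Complex.I * t * θ c)) (Complex.I * θ c) 0 := by
    have h := ((((hasDerivAt_id (0 : ℝ)).ofReal_comp).const_mul Complex.I).mul_const
      (θ c : ℂ)).cexp
    simpa using h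
  have h2 : HasDerivAt (fun t : ℝ => φ c (biFlow α β (-t) x))
      (-lieDeriv (biFlow α β) (φ c) x) 0 := by
    have h : HasDerivAt (fun t => φ c (biFlow α β t x)) (lieDeriv (biFlow α β) (φ c) x) (-0) := by
      simpa using (hφ c).hasDerivAt_lieDeriv α β x
    simpa [Function.comp_def] using h.scomp (0 : ℝ) (hasDerivAt_neg 0)
  rw [characteristic, (h1.fun_mul h2).deriv]
  simp [biFlow_zero, sub_eq_add_neg]

theorem isSmooth_characteristic {φ : C → (ι → G) → ℂ} (hφ : ∀ c, IsSmooth ρ (φ c)) (θ : C → ℝ)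
    (c : C) : IsSmooth ρ (characteristic (biFlow α β) θ φ c) := by
  rw [funext (characteristic_biFlow α β hφ θ c)]
  exact ((hφ c).const_mul _).sub ((hφ c).lieDeriv α β)

theorem sum_antisymm_mul {r : Fin d → Fin d → ℝ} (hr : ∀ a b, r a b = -r b a)
    (s : Fin d → Fin d → ℂ) (hs : ∀ a b, s a b = s b a) : ∑ a, ∑ b, (r a b : ℂ) * s a b = 0 := by
  have h : ∑ a, ∑ b, (r a b : ℂ) * s a b = -∑ a, ∑ b, (r a b : ℂ) * s a b := by
    conv_lhs => rw [Finset.sum_comm]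
    simp only [← Finset.sum_neg_distrib]
    refine Finset.sum_congr rfl fun a _ => Finset.sum_congr rfl fun b _ => ?_
    rw [hr b a, hs b a]
    push_cast
    ring
  exact self_eq_neg.1 h

/-- The Killing property of the flow. The phase contributions cancel because `iθ` is imaginary, the
Lie derivative terms cancel against the second sum, and the remaining commutator terms pair an
antisymmetric matrix with a symmetric one. -/
theorem gradient_characteristic {φ : C → (ι → G) → ℂ} (hφ : ∀ c, IsSmooth ρ (φ c)) (θ : C → ℝ)
    (c : C) (A : ι) (x : ι → G) :
    ∑ a, (frameDeriv Q A a (φ c) x *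
          conj (frameDeriv Q A a (characteristic (biFlow α β) θ φ c) x) +
        conj (frameDeriv Q A a (φ c) x) *
          frameDeriv Q A a (characteristic (biFlow α β) θ φ c) x) +
      ∑ a, (conj (lieDeriv (biFlow α β) (frameDeriv Q A a (φ c)) x) * frameDeriv Q A a (φ c) x +
        conj (frameDeriv Q A a (φ c) x) *
          lieDeriv (biFlow α β) (frameDeriv Q A a (φ c)) x) = 0 := by
  have h0 := sum_antisymm_mul (adRate_antisymm Q (β A))
    (fun a b => frameDeriv Q A a (φ c) x * conj (frameDeriv Q A b (φ c) x) +
      conj (frameDeriv Q A a (φ c) x) * frameDeriv Q A b (φ c) x) (fun a b => by ring)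
  rw [← Finset.sum_add_distrib, ← neg_eq_zero, ← h0, ← Finset.sum_neg_distrib]
  refine Finset.sum_congr rfl fun a _ => ?_
  rw [funext (characteristic_biFlow α β hφ θ c),
    frameDeriv_sub Q ((hφ c).const_mul _) ((hφ c).lieDeriv α β), frameDeriv_const_mul,
    frameDeriv_lieDeriv α β Q (hφ c)]
  simp only [map_sub, map_add, map_mul, map_sum, Complex.conj_ofReal, Complex.conj_I, mul_add,
    Finset.sum_add_distrib]
  have e1 : ∑ b, (adRate Q (β A) a b : ℂ) *
      (frameDeriv Q A a (φ c) x * conj (frameDeriv Q A b (φ c) x)) =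
      frameDeriv Q A a (φ c) x * ∑ b, (adRate Q (β A) a b : ℂ) *
        conj (frameDeriv Q A b (φ c) x) := by
    rw [Finset.mul_sum]
    exact Finset.sum_congr rfl fun b _ => by ring
  have e2 : ∑ b, (adRate Q (β A) a b : ℂ) *
      (conj (frameDeriv Q A a (φ c) x) * frameDeriv Q A b (φ c) x) =
      conj (frameDeriv Q A a (φ c) x) * ∑ b, (adRate Q (β A) a b : ℂ) *
        frameDeriv Q A b (φ c) x := by
    rw [Finset.mul_sum]
    exact Finset.sum_congr rfl fun b _ => by ring
  rw [e1, e2]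
  ring

theorem frameDeriv_current {φ : C → (ι → G) → ℂ} (hφ : ∀ c, IsSmooth ρ (φ c)) (κ : ι → ℝ) (m : ℝ)
    (θ : C → ℝ) (A : ι) (a : Fin d) (x : ι → G) :
    frameDeriv Q A a (current Q κ m φ (biFlow α β) θ A a) x =
      (κ A : ℂ) * ∑ c, (frameDeriv Q A a (frameDeriv Q A a (φ c)) x *
            conj (characteristic (biFlow α β) θ φ c x) +
          conj (frameDeriv Q A a (frameDeriv Q A a (φ c)) x) *
            characteristic (biFlow α β) θ φ c x +
        (frameDeriv Q A a (φ c) x *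
          conj (frameDeriv Q A a (characteristic (biFlow α β) θ φ c) x) +
        conj (frameDeriv Q A a (φ c) x) *
          frameDeriv Q A a (characteristic (biFlow α β) θ φ c) x)) +
      (generatorComponent Q (biFlow α β) A a x : ℂ) *
        frameDeriv Q A a (localLagrangian Q κ m φ) x := by
  have hX := isSmooth_characteristic α β hφ θ
  have hE : ∀ c, IsSmooth ρ (frameDeriv Q A a (φ c)) := fun c => (hφ c).frameDeriv Q A a
  have h1 : frameDeriv Q A a (current Q κ m φ (biFlow α β) θ A a) x =
      frameDeriv Q A a (fun y => (κ A : ℂ) * ∑ c, (frameDeriv Q A a (φ c) y *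
          conj (characteristic (biFlow α β) θ φ c y) +
        conj (frameDeriv Q A a (φ c) y) * characteristic (biFlow α β) θ φ c y) +
      (generatorComponent Q (biFlow α β) A a x : ℂ) * localLagrangian Q κ m φ y) x := by
    unfold frameDeriv current
    congr 1
    funext t
    rw [generatorComponent_update, mul_comm (localLagrangian Q κ m φ _)]
    simp only [frameDeriv_conj]
    rfl
  rw [h1, frameDeriv_add Q, frameDeriv_const_mul, frameDeriv_const_mul, frameDeriv_sum]
  · congr 2
    refine Finset.sum_congr rfl fun c _ => ?_
    rw [frameDeriv_add Q ((hE c).mul (hX c).conj) ((hE c).conj.mul (hX c)),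
      frameDeriv_mul Q (hE c) (hX c).conj, frameDeriv_mul Q (hE c).conj (hX c),
      frameDeriv_conj, frameDeriv_conj]
    ring
  · exact fun c _ => ((hE c).mul (hX c).conj).add ((hE c).conj.mul (hX c))
  · exact (IsSmooth.sum fun c _ =>
      ((hE c).mul (hX c).conj).add ((hE c).conj.mul (hX c))).const_mul _
  · exact (isSmooth_localLagrangian Q hφ κ m).const_mul _

theorem lieDeriv_localLagrangian {φ : C → (ι → G) → ℂ} (hφ : ∀ c, IsSmooth ρ (φ c)) (κ : ι → ℝ)
    (m : ℝ) (x : ι → G) :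
    lieDeriv (biFlow α β) (localLagrangian Q κ m φ) x =
      ∑ c, ((∑ A, (κ A : ℂ) * ∑ a,
        (conj (lieDeriv (biFlow α β) (frameDeriv Q A a (φ c)) x) * frameDeriv Q A a (φ c) x +
        conj (frameDeriv Q A a (φ c) x) * lieDeriv (biFlow α β) (frameDeriv Q A a (φ c)) x)) +
      (m : ℂ) * (conj (lieDeriv (biFlow α β) (φ c) x) * φ c x +
        conj (φ c x) * lieDeriv (biFlow α β) (φ c) x)) := by
  have hE : ∀ c A a, IsSmooth ρ (frameDeriv Q A a (φ c)) := fun c A a => (hφ c).frameDeriv Q A a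
  have hL : localLagrangian Q κ m φ = fun y => ∑ c, ((∑ A, (κ A : ℂ) * ∑ a,
      conj (frameDeriv Q A a (φ c) y) * frameDeriv Q A a (φ c) y) +
      (m : ℂ) * (conj (φ c y) * φ c y)) := by
    funext y
    simp only [localLagrangian, frameDeriv_conj]
  have s1 : ∀ c A, IsSmooth ρ fun y => ∑ a,
      conj (frameDeriv Q A a (φ c) y) * frameDeriv Q A a (φ c) y := fun c A =>
    IsSmooth.sum fun a _ => (hE c A a).conj.mul (hE c A a)
  have s2 : ∀ c, IsSmooth ρ fun y => (m : ℂ) * (conj (φ c y) * φ c y) := fun c =>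
    ((hφ c).conj.mul (hφ c)).const_mul _
  have s3 : ∀ c, IsSmooth ρ fun y => ∑ A, (κ A : ℂ) * ∑ a,
      conj (frameDeriv Q A a (φ c) y) * frameDeriv Q A a (φ c) y := fun c =>
    IsSmooth.sum fun A _ => (s1 c A).const_mul _
  rw [hL, lieDeriv_sum α β fun c _ => (s3 c).add (s2 c)]
  refine Finset.sum_congr rfl fun c _ => ?_
  rw [lieDeriv_add α β (s3 c) (s2 c), lieDeriv_const_mul, lieDeriv_mul α β (hφ c).conj (hφ c),
    lieDeriv_conj, lieDeriv_sum α β fun A _ => (s1 c A).const_mul _]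
  congr 1
  refine Finset.sum_congr rfl fun A _ => ?_
  rw [lieDeriv_const_mul, lieDeriv_sum α β fun a _ => (hE c A a).conj.mul (hE c A a)]
  congr 1
  refine Finset.sum_congr rfl fun a _ => ?_
  rw [lieDeriv_mul α β (hE c A a).conj (hE c A a), lieDeriv_conj]

/-- The off-shell Noether identity. The divergence of `L^L X_M` is the Lie derivative of the
Lagrangian. Its kinetic part cancels the terms in which a gradient hits `X_Q`, and its mass part
supplies the `m` terms on the right. -/
theorem divergence_current {φ : C → (ι → G) → ℂ} (hφ : ∀ c, IsSmooth ρ (φ c)) (κ : ι → ℝ) (m : ℝ)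
    (θ : C → ℝ) (x : ι → G) :
    divergence Q (current Q κ m φ (biFlow α β) θ) x =
      ∑ c, ((laplacian Q κ (φ c) x - m * φ c x) * conj (characteristic (biFlow α β) θ φ c x) +
        conj (laplacian Q κ (φ c) x - m * φ c x) * characteristic (biFlow α β) θ φ c x) := by
  have comm : ∀ f : ι → Fin d → C → ℂ, ∑ A, ∑ a, (κ A : ℂ) * ∑ c, f A a c =
      ∑ c, ∑ A, (κ A : ℂ) * ∑ a, f A a c := fun f => by
    conv_rhs => rw [Finset.sum_comm]
    refine Finset.sum_congr rfl fun A _ => ?_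
    rw [← Finset.mul_sum, ← Finset.mul_sum, Finset.sum_comm]
  have split : ∑ A, ∑ a, frameDeriv Q A a (current Q κ m φ (biFlow α β) θ A a) x = _ :=
    Finset.sum_congr rfl fun A _ => (Finset.sum_congr rfl fun a _ =>
      frameDeriv_current α β Q hφ κ m θ A a x).trans Finset.sum_add_distrib
  rw [divergence, split, Finset.sum_add_distrib, comm,
    ← (isSmooth_localLagrangian Q hφ κ m).lieDeriv_expand α β Q, lieDeriv_localLagrangian α β Q hφ,
    ← Finset.sum_add_distrib]
  have key : ∀ c, ∑ A, (κ A : ℂ) * ∑ a, (frameDeriv Q A a (φ c) x *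
          conj (frameDeriv Q A a (characteristic (biFlow α β) θ φ c) x) +
        conj (frameDeriv Q A a (φ c) x) *
          frameDeriv Q A a (characteristic (biFlow α β) θ φ c) x) +
      ∑ A, (κ A : ℂ) * ∑ a,
        (conj (lieDeriv (biFlow α β) (frameDeriv Q A a (φ c)) x) * frameDeriv Q A a (φ c) x +
        conj (frameDeriv Q A a (φ c) x) *
          lieDeriv (biFlow α β) (frameDeriv Q A a (φ c)) x) = 0 := fun c => by
    rw [← Finset.sum_add_distrib]
    refine Finset.sum_eq_zero fun A _ => ?_
    rw [← mul_add, gradient_characteristic, mul_zero]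
    exact hφ
  refine Finset.sum_congr rfl fun c _ => ?_
  have hX := characteristic_biFlow α β hφ θ c x
  simp only [Finset.sum_add_distrib, mul_add] at key ⊢
  have e1 : ∑ A, (κ A : ℂ) * ∑ a, frameDeriv Q A a (frameDeriv Q A a (φ c)) x *
      conj (characteristic (biFlow α β) θ φ c x) =
      laplacian Q κ (φ c) x * conj (characteristic (biFlow α β) θ φ c x) := by
    simp only [laplacian, Finset.sum_mul, mul_assoc]
  have e2 : ∑ A, (κ A : ℂ) * ∑ a, conj (frameDeriv Q A a (frameDeriv Q A a (φ c)) x) *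
      characteristic (biFlow α β) θ φ c x =
      conj (laplacian Q κ (φ c) x) * characteristic (biFlow α β) θ φ c x := by
    simp only [laplacian, map_sum, map_mul, Complex.conj_ofReal, Finset.sum_mul, mul_assoc]
  rw [e1, e2]
  -- Here `X_Q` can be replaced by minus the Lie derivative: the phase does not change `φ̄ φ`.
  have hm : (m : ℂ) * (φ c x * conj (characteristic (biFlow α β) θ φ c x) +
      conj (φ c x) * characteristic (biFlow α β) θ φ c x) +
      (m : ℂ) * (conj (lieDeriv (biFlow α β) (φ c) x) * φ c x +
        conj (φ c x) * lieDeriv (biFlow α β) (φ c) x) = 0 := by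
    rw [hX]
    simp only [map_sub, map_mul, Complex.conj_ofReal, Complex.conj_I]
    ring
  rw [map_sub, map_mul, Complex.conj_ofReal]
  linear_combination key c + hm

end Divergence

/-! ## Topology of compact matrix groups -/

section Topology

variable {G : Type*} [Group G] [TopologicalSpace G] [CompactSpace G] {N : ℕ} {ι : Type*}
  {ρ : G →* Matrix (Fin N) (Fin N) ℂ}

/-- By compactness `ρ` is a closed embedding. Second countability makes the product σ-algebra on `ι
→ G` the Borel one, as integrating continuous functions requires. -/
theorem secondCountableTopology_of_injective (hρ : Continuous ρ) (hinj : Function.Injective ρ) :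
    SecondCountableTopology G :=
  have : SecondCountableTopology (Matrix (Fin N) (Fin N) ℂ) :=
    inferInstanceAs (SecondCountableTopology (Fin N → Fin N → ℂ))
  (hρ.isClosedEmbedding hinj).isEmbedding.secondCountableTopology

theorem continuous_matEmb (hρ : Continuous ρ) : Continuous (matEmb ρ : (ι → G) → _) :=
  continuous_pi fun A => continuous_pi fun i => continuous_pi fun j =>
    (continuous_apply_apply i j).comp (hρ.comp (continuous_apply A))

/-- Otherwise the determinants of the powers of `g` would be unbounded on a compact group. -/
theorem norm_det_le_one (hρ : Continuous ρ) (g : G) : ‖(ρ g).det‖ ≤ 1 := by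
  by_contra! h
  obtain ⟨C, hC⟩ := (isCompact_range (hρ.matrix_det.norm)).bddAbove
  obtain ⟨n, hn⟩ := pow_unbounded_of_one_lt C h
  have := hC ⟨g ^ n, rfl⟩
  simp only [map_pow, Matrix.det_pow, norm_pow] at this
  linarith

theorem norm_det_eq_one (hρ : Continuous ρ) (g : G) : ‖(ρ g).det‖ = 1 := by
  have h : ‖(ρ g).det‖ * ‖(ρ g⁻¹).det‖ = 1 := by
    rw [← norm_mul, ← Matrix.det_mul, ← map_mul]
    simp
  nlinarith [norm_det_le_one hρ g, norm_det_le_one hρ g⁻¹, norm_nonneg (ρ g).det,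
    norm_nonneg (ρ g⁻¹).det]

/-- Matrix inversion is not smooth on the whole ambient space, as `IsSmooth` would demand. Since the
determinant has modulus one, its inverse is its conjugate, and the formula becomes polynomial in the
coefficients and their conjugates. -/
theorem map_inv_eq_adjugate (hρ : Continuous ρ) (g : G) :
    ρ g⁻¹ = conj (ρ g).det • (ρ g).adjugate := by
  have h1 : conj (ρ g).det * (ρ g).det = 1 := by
    rw [mul_comm, Complex.mul_conj, Complex.normSq_eq_norm_sq, norm_det_eq_one hρ]
    simp
  have h2 : ρ g⁻¹ * ρ g = 1 := by rw [← map_mul]; simp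
  calc ρ g⁻¹ = ρ g⁻¹ * ((conj (ρ g).det * (ρ g).det) • (1 : Matrix (Fin N) (Fin N) ℂ)) := by
        rw [h1, one_smul, mul_one]
    _ = conj (ρ g).det • (ρ g⁻¹ * (ρ g * (ρ g).adjugate)) := by
        rw [Matrix.mul_adjugate, mul_smul, Matrix.mul_smul, Matrix.mul_smul]
    _ = _ := by rw [← mul_assoc, h2, one_mul]

theorem SmoothAlong.matrix_det {n : ℕ} {X E : Type*} [NormedAddCommGroup E] [NormedSpace ℝ E]
    {r : X → E} {M : X → Matrix (Fin n) (Fin n) ℂ} (h : ∀ i j, SmoothAlong r fun x => M x i j) :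
    SmoothAlong r fun x => (M x).det := by
  simp only [Matrix.det_apply']
  exact SmoothAlong.sum fun σ _ => (SmoothAlong.const _ _).mul (SmoothAlong.prod fun i _ => h _ _)

theorem SmoothGroup.inv (hρ : Continuous ρ) {X E : Type*} [NormedAddCommGroup E] [NormedSpace ℝ E]
    {r : X → E} {c : X → G} (hc : SmoothGroup ρ r c) : SmoothGroup ρ r fun x => (c x)⁻¹ := by
  intro i j
  simp only [map_inv_eq_adjugate hρ, Matrix.smul_apply, smul_eq_mul, Matrix.adjugate_apply]
  refine (SmoothAlong.matrix_det hc).conj.mul (SmoothAlong.matrix_det fun k l => ?_)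
  by_cases hk : k = j
  · subst hk
    simpa using SmoothAlong.const _ _
  · simpa [Matrix.updateRow_ne hk] using hc k l

end Topology

/-! ## Integration on products of copies of `G` -/

section Integration

variable {G : Type*} [Group G] [TopologicalSpace G] [IsTopologicalGroup G] [CompactSpace G]
  [MeasurableSpace G] [BorelSpace G]

/-- A right translate of `μ` is again left-invariant, hence a multiple of `μ`; comparing total
masses fixes the factor as one. -/
theorem isMulRightInvariant_of_compactSpace (μ : Measure G) [μ.IsHaarMeasure]
    [IsProbabilityMeasure μ] : μ.IsMulRightInvariant := by
  refine ⟨fun g => ?_⟩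
  have : IsProbabilityMeasure (μ.map (· * g)) :=
    Measure.isProbabilityMeasure_map (measurable_mul_const g).aemeasurable
  obtain h := Measure.isMulInvariant_eq_smul_of_compactSpace (μ.map (· * g)) μ
  have h1 := congrArg (fun ν : Measure G => ν Set.univ) h
  simp only [measure_univ, Measure.smul_apply] at h1
  rw [h]
  have h2 : Measure.haarScalarFactor (μ.map (· * g)) μ = 1 := by
    have : ((Measure.haarScalarFactor (μ.map (· * g)) μ : NNReal) : ENNReal) = 1 := by
      simpa [ENNReal.smul_def] using h1.symm
    exact_mod_cast this
  rw [h2, one_smul]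

variable [SecondCountableTopology G] (μ : Measure G) [μ.IsHaarMeasure] [IsProbabilityMeasure μ]
  {N d : ℕ} {ι : Type*} [Fintype ι] [DecidableEq ι] {ρ : G →* Matrix (Fin N) (Fin N) ℂ}
  (Q : InvariantMetric ρ d)

theorem IsSmooth.integrable {u : (ι → G) → ℂ} (hu : IsSmooth ρ u) (hρ : Continuous ρ) :
    Integrable u (Measure.pi fun _ => μ) :=
  integrable_of_continuous_compactSpace (SmoothAlong.continuous (continuous_matEmb hρ) hu)

theorem measurePreserving_mul_mul (p q : ι → G) :
    MeasurePreserving (fun (x : ι → G) A => p A * x A * q A)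
      (Measure.pi fun _ => μ) (Measure.pi fun _ => μ) := by
  have := isMulRightInvariant_of_compactSpace μ
  exact measurePreserving_pi (fun _ => μ) (fun _ => μ) fun A =>
    (measurePreserving_mul_right μ (q A)).comp (measurePreserving_mul_left μ (p A))

theorem update_mul_eq (A : ι) (g : G) (x : ι → G) :
    Function.update x A (x A * g) = fun B => 1 * x B * (Pi.mulSingle A g : ι → G) B := by
  funext B
  by_cases h : B = A
  · subst h; simp
  · simp [h]

theorem MeasurePreserving.integral_comp_of_continuous {X Y : Type*} [TopologicalSpace X]
    [MeasurableSpace X] [TopologicalSpace Y] [MeasurableSpace Y] [BorelSpace Y] {ν : Measure X}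
    {ν' : Measure Y} {T : X → Y} (hT : MeasurePreserving T ν ν') {u : Y → ℂ} (hu : Continuous u) :
    ∫ x, u (T x) ∂ν = ∫ y, u y ∂ν' := by
  rw [← hT.map_eq, integral_map hT.measurable.aemeasurable hu.aestronglyMeasurable]

/-- The integral of a translated function does not depend on the translation, and differentiation
under the integral sign applies. -/
theorem integral_frameDeriv (hρ : Continuous ρ) {u : (ι → G) → ℂ} (hu : IsSmooth ρ u) (A : ι)
    (a : Fin d) : ∫ x, frameDeriv Q A a u x ∂Measure.pi (fun _ => μ) = 0 := by
  have hcont := SmoothAlong.continuous (continuous_matEmb hρ) hu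
  have hs : SmoothAlong (fun p : ℝ × (ι → G) => (p.1, matEmb ρ p.2))
      fun p => u (Function.update p.2 A (p.2 A * Q.e a p.1)) := by
    have h2 : SmoothAlong (fun p : ℝ × (ι → G) => (p.1, matEmb ρ p.2))
        fun p => matEmb ρ p.2 :=
      (SmoothAlong.id _).contDiff_comp (f := fun q : ℝ × (ι → Fin N → Fin N → ℂ) => q.2)
        contDiff_snd
    have h1 : SmoothAlong (fun p : ℝ × (ι → G) => (p.1, matEmb ρ p.2)) fun p => p.1 :=
      (SmoothAlong.id _).contDiff_comp (f := fun q : ℝ × (ι → Fin N → Fin N → ℂ) => q.1)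
        contDiff_fst
    have h3 := smoothAlong_matEmb.1 h2
    exact hu.comp_smoothGroup (SmoothGroup.update h3 A ((h3 A).mul ((Q.e a).smoothGroup h1)))
  have h := hasDerivAt_integral_of_smoothAlong (ν := Measure.pi fun _ => μ)
    (continuous_matEmb hρ) (u := fun t x => u (Function.update x A (x A * Q.e a t))) hs 0
  have hc : (fun t => ∫ x, u (Function.update x A (x A * Q.e a t)) ∂Measure.pi fun _ => μ) =
      fun _ => ∫ x, u x ∂Measure.pi fun _ => μ := by
    funext t
    simp only [update_mul_eq]
    exact MeasurePreserving.integral_comp_of_continuous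
      (measurePreserving_mul_mul μ (fun _ => 1) _) hcont
  rw [hc] at h
  exact (h.unique (hasDerivAt_const _ _))

theorem integral_frameDeriv_mul (hρ : Continuous ρ) {u v : (ι → G) → ℂ} (hu : IsSmooth ρ u)
    (hv : IsSmooth ρ v) (A : ι) (a : Fin d) :
    ∫ x, frameDeriv Q A a u x * v x ∂Measure.pi (fun _ => μ) =
      -∫ x, u x * frameDeriv Q A a v x ∂Measure.pi (fun _ => μ) := by
  have h := integral_frameDeriv μ Q hρ (hu.mul hv) A a
  simp only [frameDeriv_mul Q hu hv] at h
  rw [integral_add (((hu.frameDeriv Q A a).mul hv).integrable μ hρ)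
    ((hu.mul (hv.frameDeriv Q A a)).integrable μ hρ)] at h
  exact eq_neg_of_add_eq_zero_left h

end Integration

/-! ## Variation of the local action and field equations -/

section FieldEquation

variable {G : Type*} [Group G] [TopologicalSpace G] [IsTopologicalGroup G] [CompactSpace G]
  [MeasurableSpace G] [BorelSpace G] [SecondCountableTopology G] (μ : Measure G)
  [μ.IsHaarMeasure] [IsProbabilityMeasure μ]
  {N d : ℕ} {ι : Type*} [Fintype ι] [DecidableEq ι] {ρ : G →* Matrix (Fin N) (Fin N) ℂ}
  (Q : InvariantMetric ρ d) {C : Type*} [Fintype C]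

/-- The holomorphic half of the first variation of the local Lagrangian. -/
def localVariation (κ : ι → ℝ) (m : ℝ) (φ η : C → (ι → G) → ℂ) (x : ι → G) : ℂ :=
  ∑ c, ((∑ A, (κ A : ℂ) * ∑ a, frameDeriv Q A a (η c) x * conj (frameDeriv Q A a (φ c) x)) +
    (m : ℂ) * (η c x * conj (φ c x)))

theorem isSmooth_localVariation {φ η : C → (ι → G) → ℂ} (hφ : ∀ c, IsSmooth ρ (φ c))
    (hη : ∀ c, IsSmooth ρ (η c)) (κ : ι → ℝ) (m : ℝ) :
    IsSmooth ρ (localVariation Q κ m φ η) :=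
  IsSmooth.sum fun c _ => (IsSmooth.sum fun A _ => (IsSmooth.sum fun a _ =>
    ((hη c).frameDeriv Q A a).mul ((hφ c).frameDeriv Q A a).conj).const_mul _).add
      (((hη c).mul (hφ c).conj).const_mul _)

/-- The Lagrangian is quadratic, so its expansion in `s` is exact and the derivative of the local
action needs no limiting argument. -/
theorem localLagrangian_add {φ η : C → (ι → G) → ℂ} (hφ : ∀ c, IsSmooth ρ (φ c))
    (hη : ∀ c, IsSmooth ρ (η c)) (κ : ι → ℝ) (m : ℝ) (s : ℝ) (x : ι → G) :
    localLagrangian Q κ m (fun c x => φ c x + (s : ℂ) * η c x) x =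
      localLagrangian Q κ m φ x + s * (localVariation Q κ m φ η x +
        conj (localVariation Q κ m φ η x)) + s ^ 2 * localLagrangian Q κ m η x := by
  have hE : ∀ c A a, frameDeriv Q A a (fun y => φ c y + (s : ℂ) * η c y) x =
      frameDeriv Q A a (φ c) x + s * frameDeriv Q A a (η c) x := fun c A a => by
    rw [frameDeriv_add Q (hφ c) ((hη c).const_mul _), frameDeriv_const_mul]
  simp only [localLagrangian, localVariation, frameDeriv_conj, hE, map_sum]
  rw [← Finset.sum_add_distrib, Finset.mul_sum, Finset.mul_sum, ← Finset.sum_add_distrib,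
    ← Finset.sum_add_distrib]
  refine Finset.sum_congr rfl fun c _ => ?_
  have h : ∑ A, (κ A : ℂ) * ∑ a, conj (frameDeriv Q A a (φ c) x + s * frameDeriv Q A a (η c) x) *
        (frameDeriv Q A a (φ c) x + s * frameDeriv Q A a (η c) x) =
      ∑ A, (κ A : ℂ) * ∑ a, conj (frameDeriv Q A a (φ c) x) * frameDeriv Q A a (φ c) x +
      s * (∑ A, (κ A : ℂ) * ∑ a, frameDeriv Q A a (η c) x * conj (frameDeriv Q A a (φ c) x) +
        conj (∑ A, (κ A : ℂ) * ∑ a,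
          frameDeriv Q A a (η c) x * conj (frameDeriv Q A a (φ c) x))) +
      s ^ 2 * ∑ A, (κ A : ℂ) * ∑ a,
        conj (frameDeriv Q A a (η c) x) * frameDeriv Q A a (η c) x := by
    simp only [map_sum, map_mul, map_add, Complex.conj_ofReal, Complex.conj_conj, Finset.mul_sum,
      ← Finset.sum_add_distrib]
    exact Finset.sum_congr rfl fun A _ => Finset.sum_congr rfl fun a _ => by ring
  rw [h]
  simp only [map_add, map_mul, Complex.conj_ofReal, Complex.conj_conj]
  ring

theorem integral_localVariation (hρ : Continuous ρ) {φ η : C → (ι → G) → ℂ}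
    (hφ : ∀ c, IsSmooth ρ (φ c)) (hη : ∀ c, IsSmooth ρ (η c)) (κ : ι → ℝ) (m : ℝ) :
    ∫ x, localVariation Q κ m φ η x ∂Measure.pi (fun _ => μ) =
      ∑ c, ∫ x, η c x * conj ((m : ℂ) * φ c x - laplacian Q κ (φ c) x)
        ∂Measure.pi (fun _ => μ) := by
  have i1 : ∀ c A a, IsSmooth ρ fun x =>
      frameDeriv Q A a (η c) x * conj (frameDeriv Q A a (φ c) x) := fun c A a =>
    ((hη c).frameDeriv Q A a).mul ((hφ c).frameDeriv Q A a).conj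
  have i2 : ∀ c A, IsSmooth ρ fun x => (κ A : ℂ) * ∑ a,
      frameDeriv Q A a (η c) x * conj (frameDeriv Q A a (φ c) x) := fun c A =>
    (IsSmooth.sum fun a _ => i1 c A a).const_mul _
  have i3 : ∀ c, IsSmooth ρ fun x => (m : ℂ) * (η c x * conj (φ c x)) := fun c =>
    ((hη c).mul (hφ c).conj).const_mul _
  have i4 : ∀ c A a, IsSmooth ρ fun x =>
      η c x * conj (frameDeriv Q A a (frameDeriv Q A a (φ c)) x) := fun c A a =>
    (hη c).mul (((hφ c).frameDeriv Q A a).frameDeriv Q A a).conj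
  unfold localVariation
  rw [integral_finsetSum _ fun c _ => ((IsSmooth.sum fun A _ => i2 c A).add (i3 c)).integrable μ hρ]
  refine Finset.sum_congr rfl fun c _ => ?_
  have e1 : ∀ x, η c x * conj ((m : ℂ) * φ c x - laplacian Q κ (φ c) x) =
      (m : ℂ) * (η c x * conj (φ c x)) - ∑ A, (κ A : ℂ) * ∑ a,
        η c x * conj (frameDeriv Q A a (frameDeriv Q A a (φ c)) x) := fun x => by
    simp only [laplacian, map_sub, map_mul, map_sum, Complex.conj_ofReal, mul_sub,
      Finset.mul_sum]
    congr 1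
    · ring
    · exact Finset.sum_congr rfl fun A _ => Finset.sum_congr rfl fun a _ => by ring
  simp only [e1]
  rw [integral_add ((IsSmooth.sum fun A _ => i2 c A).integrable μ hρ) ((i3 c).integrable μ hρ),
    integral_sub ((i3 c).integrable μ hρ) ((IsSmooth.sum fun A _ =>
      (IsSmooth.sum fun a _ => i4 c A a).const_mul _).integrable μ hρ),
    integral_finsetSum _ fun A _ => (i2 c A).integrable μ hρ,
    integral_finsetSum _ fun A _ => ((IsSmooth.sum fun a _ => i4 c A a).const_mul _).integrable μ hρ,
    add_comm, sub_eq_add_neg, ← Finset.sum_neg_distrib]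
  congr 1
  refine Finset.sum_congr rfl fun A _ => ?_
  rw [integral_const_mul, integral_const_mul, integral_finsetSum _ fun a _ =>
    (i1 c A a).integrable μ hρ, integral_finsetSum _ fun a _ => (i4 c A a).integrable μ hρ,
    ← mul_neg, ← Finset.sum_neg_distrib]
  congr 1
  refine Finset.sum_congr rfl fun a _ => ?_
  rw [integral_frameDeriv_mul μ Q hρ (hη c) ((hφ c).frameDeriv Q A a).conj]
  simp only [frameDeriv_conj]

theorem hasDerivAt_localAction (hρ : Continuous ρ) {φ η : C → (ι → G) → ℂ}
    (hφ : ∀ c, IsSmooth ρ (φ c)) (hη : ∀ c, IsSmooth ρ (η c)) (κ : ι → ℝ) (m : ℝ) :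
    HasDerivAt (fun s : ℝ => localAction μ Q κ m fun c x => φ c x + (s : ℂ) * η c x)
      (∑ c, ∫ x, η c x * conj ((m : ℂ) * φ c x - laplacian Q κ (φ c) x)
          ∂Measure.pi (fun _ => μ) +
        conj (∑ c, ∫ x, η c x * conj ((m : ℂ) * φ c x - laplacian Q κ (φ c) x)
          ∂Measure.pi (fun _ => μ))) 0 := by
  have hV := isSmooth_localVariation Q hφ hη κ m
  have hL := isSmooth_localLagrangian Q hφ κ m
  have hL' := isSmooth_localLagrangian Q hη κ m
  rw [← integral_localVariation μ Q hρ hφ hη]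
  set D := ∫ x, localVariation Q κ m φ η x ∂Measure.pi (fun _ => μ) with hD
  have h1 : ∀ s : ℝ, localAction μ Q κ m (fun c x => φ c x + (s : ℂ) * η c x) =
      localAction μ Q κ m φ + s * (D + conj D) + s ^ 2 * localAction μ Q κ m η := fun s => by
    simp only [localAction, localLagrangian_add Q hφ hη]
    rw [integral_add ((hL.add ((hV.add hV.conj).const_mul _)).integrable μ hρ)
        ((hL'.const_mul _).integrable μ hρ),
      integral_add (hL.integrable μ hρ) (((hV.add hV.conj).const_mul _).integrable μ hρ),
      integral_const_mul, integral_const_mul,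
      integral_add (hV.integrable μ hρ) (hV.conj.integrable μ hρ), integral_conj]
  simp only [h1]
  have hs : HasDerivAt (fun s : ℝ => (s : ℂ)) 1 0 := (hasDerivAt_id (0 : ℝ)).ofReal_comp
  have h2 := ((hs.mul_const (D + conj D)).const_add (localAction μ Q κ m φ)).fun_add
    ((hs.fun_pow 2).mul_const (localAction μ Q κ m η))
  simpa using h2

theorem eq_zero_of_integral_normSq (hρ : Continuous ρ) {u : (ι → G) → ℂ} (hu : IsSmooth ρ u)
    (h : ∫ x, ‖u x‖ ^ 2 ∂Measure.pi (fun _ => μ) = 0) : u = 0 := by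
  have hc := SmoothAlong.continuous (continuous_matEmb hρ) hu
  have hc2 : Continuous fun x => ‖u x‖ ^ 2 := hc.norm.pow 2
  rw [integral_eq_zero_iff_of_nonneg (fun x => by positivity)
    (integrable_of_continuous_compactSpace hc2)] at h
  have h2 := (Continuous.ae_eq_iff_eq _ hc2 continuous_const).1 h
  funext x
  have h3 : ‖u x‖ ^ 2 = 0 := congrFun h2 x
  simpa using h3

/-- The fundamental lemma of the calculus of variations without bump functions: the defect of the
field equation is smooth and satisfies the constraints, so it can be used as the variation. The
functional `S` enters only through its derivative, represented by `I`. -/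
theorem field_equation (hρ : Continuous ρ) {𝒯 : Set ((ι → G) → (ι → G))} {κ : ι → ℝ} {m l : ℝ}
    {φ I : C → (ι → G) → ℂ} {S : (C → (ι → G) → ℂ) → ℂ} (hφ : φ ∈ fields ρ C 𝒯)
    (hI : I ∈ fields ρ C 𝒯)
    (hlap : ∀ c, ∀ T ∈ 𝒯, laplacian Q κ (φ c) ∘ T = laplacian Q κ (φ c))
    (hS : ∀ η ∈ fields ρ C 𝒯, HasDerivAt (fun s : ℝ => S fun c x => φ c x + (s : ℂ) * η c x)
      (l * ∑ c, ∫ x, η c x * I c x ∂Measure.pi (fun _ => μ) +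
        conj (l * ∑ c, ∫ x, η c x * I c x ∂Measure.pi (fun _ => μ))) 0)
    (hstat : IsStationary (fun φ => localAction μ Q κ m φ + S φ) (fields ρ C 𝒯) φ)
    (c : C) (x : ι → G) :
    laplacian Q κ (φ c) x - m * φ c x = l * conj (I c x) := by
  set η : C → (ι → G) → ℂ := fun c x =>
    ((m : ℂ) * φ c x - laplacian Q κ (φ c) x) + l * conj (I c x) with hη
  have hs1 : ∀ c, IsSmooth ρ fun x => (m : ℂ) * φ c x - laplacian Q κ (φ c) x := fun c =>
    ((hφ c).1.const_mul _).sub ((hφ c).1.laplacian Q κ)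
  have hηs : ∀ c, IsSmooth ρ (η c) := fun c => (hs1 c).add ((hI c).1.conj.const_mul _)
  have hmem : η ∈ fields ρ C 𝒯 := fun c => by
    refine ⟨hηs c, fun T hT => ?_⟩
    have e1 := congrFun ((hφ c).2 T hT)
    have e2 := congrFun ((hI c).2 T hT)
    have e3 := congrFun (hlap c T hT)
    simp only [Function.comp_apply] at e1 e2 e3
    funext x
    simp only [hη, Function.comp_apply, e1, e2, e3]
  have hder := (hasDerivAt_localAction μ Q hρ (fun c => (hφ c).1) hηs κ m).fun_add (hS η hmem)
  have h0 := hder.unique (hstat η hmem)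
  have hZ : ∑ c, ∫ x, η c x * conj ((m : ℂ) * φ c x - laplacian Q κ (φ c) x)
        ∂Measure.pi (fun _ => μ) + l * ∑ c, ∫ x, η c x * I c x ∂Measure.pi (fun _ => μ) =
      ((∑ c, ∫ x, ‖η c x‖ ^ 2 ∂Measure.pi (fun _ => μ) : ℝ) : ℂ) := by
    push_cast
    rw [Finset.mul_sum, ← Finset.sum_add_distrib]
    refine Finset.sum_congr rfl fun c _ => ?_
    rw [← integral_const_mul, ← integral_add (((hηs c).mul (hs1 c).conj).integrable μ hρ)
      ((((hηs c).mul (hI c).1).const_mul _).integrable μ hρ), ← integral_complex_ofReal]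
    refine integral_congr_ae (Filter.Eventually.of_forall fun x => ?_)
    have : ((‖η c x‖ ^ 2 : ℝ) : ℂ) = η c x * conj (η c x) := by
      rw [Complex.mul_conj, Complex.normSq_eq_norm_sq]
    beta_reduce
    rw [this]
    simp only [hη, map_add, map_sub, map_mul, Complex.conj_ofReal, Complex.conj_conj]
    ring
  -- For this `η` the quantity `Z` is real, so the vanishing of `Z + Z̄` gives the vanishing of `Z`.
  have h1 : ∑ c, ∫ x, ‖η c x‖ ^ 2 ∂Measure.pi (fun _ => μ) = 0 := by
    have h2 := congrArg Complex.re h0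
    have h3 := congrArg Complex.re hZ
    simp only [Complex.add_re, Complex.conj_re, Complex.ofReal_re, Complex.zero_re] at h2 h3
    linarith
  have h2 := (Finset.sum_eq_zero_iff_of_nonneg fun c _ =>
    integral_nonneg fun x => by positivity).1 h1 c (Finset.mem_univ c)
  have h3 := congrFun (eq_zero_of_integral_normSq μ hρ (hηs c) h2) x
  simp only [hη, Pi.zero_apply] at h3
  linear_combination -h3

theorem divergence_current_of_field_equation {κ : ι → ℝ} {m l : ℝ} {φ I : C → (ι → G) → ℂ}
    (hφ : ∀ c, IsSmooth ρ (φ c))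
    (heom : ∀ c x, laplacian Q κ (φ c) x - m * φ c x = l * conj (I c x))
    (α β : ι → OneParam ρ) (θ : C → ℝ) (x : ι → G) :
    divergence Q (current Q κ m φ (biFlow α β) θ) x =
      ((2 * l * ∑ c, (characteristic (biFlow α β) θ φ c x * I c x).re : ℝ) : ℂ) := by
  rw [divergence_current α β Q hφ, Finset.mul_sum]
  push_cast
  refine Finset.sum_congr rfl fun c _ => ?_
  rw [heom, Complex.re_eq_add_conj]
  simp only [map_mul, Complex.conj_ofReal, Complex.conj_conj]
  ring

theorem divergence_current_flow {κ : ι → ℝ} {m l : ℝ} {φ I : C → (ι → G) → ℂ}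
    (hφ : ∀ c, IsSmooth ρ (φ c))
    (heom : ∀ c x, laplacian Q κ (φ c) x - m * φ c x = l * conj (I c x))
    (α β : ι → OneParam ρ) (x : ι → G) :
    divergence Q (current Q κ m φ (biFlow α β) 0) x =
      ((-2 * l * ∑ c, (lieDeriv (biFlow α β) (φ c) x * I c x).re : ℝ) : ℂ) := by
  rw [divergence_current_of_field_equation Q hφ heom]
  simp only [characteristic_biFlow α β hφ, Pi.zero_apply, Complex.ofReal_zero, mul_zero, zero_mul,
    zero_sub, neg_mul, Complex.neg_re, Finset.sum_neg_distrib, mul_neg]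

theorem lieDeriv_trivialFlow (u : (ι → G) → ℂ) (x : ι → G) : lieDeriv trivialFlow u x = 0 := by
  simp [lieDeriv, trivialFlow]

theorem divergence_current_phase {κ : ι → ℝ} {m l : ℝ} {φ I : C → (ι → G) → ℂ}
    (hφ : ∀ c, IsSmooth ρ (φ c))
    (heom : ∀ c x, laplacian Q κ (φ c) x - m * φ c x = l * conj (I c x))
    (θ : C → ℝ) (x : ι → G) :
    divergence Q (current Q κ m φ trivialFlow θ) x =
      ((-2 * l * ∑ c, θ c * (φ c x * I c x).im : ℝ) : ℂ) := by
  have h := divergence_current_of_field_equation Q hφ heom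
    (fun _ => OneParam.trivial ρ) (fun _ => OneParam.trivial ρ) θ x
  simp only [characteristic_biFlow _ _ hφ] at h
  rw [← trivialFlow_eq_biFlow] at h
  rw [h]
  congr 1
  rw [Finset.mul_sum, Finset.mul_sum]
  refine Finset.sum_congr rfl fun c _ => ?_
  rw [lieDeriv_trivialFlow, sub_zero, mul_assoc Complex.I, mul_assoc Complex.I, mul_assoc (θ c : ℂ),
    Complex.I_mul_re, Complex.im_ofReal_mul]
  ring

end FieldEquation

/-! ## Non-local interactions -/

section NonLocal

variable {G : Type*} [Group G] [TopologicalSpace G] [IsTopologicalGroup G] [CompactSpace G]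
  [MeasurableSpace G] [BorelSpace G] [SecondCountableTopology G] (μ : Measure G)
  [μ.IsHaarMeasure] [IsProbabilityMeasure μ]
  {N d : ℕ} {ι V ε C : Type*} [Fintype ι] [DecidableEq ι] [Fintype V] [DecidableEq V] [Fintype ε]
  [DecidableEq ε] [Fintype C] {ρ : G →* Matrix (Fin N) (Fin N) ℂ} {f : V → ι → ε}

theorem measurable_extend {f : ι → ε} (hf : Function.Injective f) :
    Measurable fun p : (ι → G) × (ε → G) => Function.extend f p.1 p.2 := by
  refine measurable_pi_lambda _ fun e => ?_
  by_cases h : ∃ A, f A = e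
  · obtain ⟨A, rfl⟩ := h
    simp only [hf.extend_apply]
    fun_prop
  · simp only [Function.extend_apply' _ _ _ h]
    fun_prop

/-- Overwriting some coordinates of a random tuple by an independent sample does not change its law.
The overwritten coordinates integrate to one because `μ` is a probability measure. -/
theorem measurePreserving_extend {f : ι → ε} (hf : Function.Injective f) :
    MeasurePreserving (fun p : (ι → G) × (ε → G) => Function.extend f p.1 p.2)
      ((Measure.pi fun _ => μ).prod (Measure.pi fun _ => μ)) (Measure.pi fun _ => μ) := by
  classical
  refine ⟨measurable_extend hf, Eq.symm (Measure.pi_eq fun s hs => ?_)⟩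
  rw [Measure.map_apply (measurable_extend hf) (MeasurableSet.univ_pi hs)]
  have hpre : (fun p : (ι → G) × (ε → G) => Function.extend f p.1 p.2) ⁻¹' Set.univ.pi s =
      (Set.univ.pi fun A => s (f A)) ×ˢ
        (Set.univ.pi fun e => if e ∈ Set.range f then Set.univ else s e) := by
    ext p
    simp only [Set.mem_preimage, Set.mem_pi, Set.mem_univ, true_imp_iff, Set.mem_prod]
    constructor
    · refine fun h => ⟨fun A => by simpa [hf.extend_apply] using h (f A), fun e => ?_⟩
      by_cases he : e ∈ Set.range f
      · simp [he]
      · simpa [he, Function.extend_apply' _ _ _ he] using h e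
    · rintro ⟨h1, h2⟩ e
      by_cases he : e ∈ Set.range f
      · obtain ⟨A, rfl⟩ := he
        simpa [hf.extend_apply] using h1 A
      · simpa [he, Function.extend_apply' _ _ _ he] using h2 e
  rw [hpre, Measure.prod_prod, Measure.pi_pi, Measure.pi_pi,
    ← Finset.prod_mul_prod_compl (Finset.univ.image f) fun e => μ (s e)]
  rw [Finset.prod_image fun a _ b _ h => hf h]
  congr 1
  rw [← Finset.prod_mul_prod_compl (Finset.univ.image f), Finset.prod_eq_one, one_mul]
  · refine Finset.prod_congr rfl fun e he => ?_
    have : e ∉ Set.range f := by simpa using he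
    rw [if_neg this]
  · intro e he
    have : e ∈ Set.range f := by simpa using he
    rw [if_pos this, measure_univ]

theorem smoothGroup_extend {f : ι → ε} (hf : Function.Injective f) (e : ε) :
    SmoothGroup ρ (fun p : (ι → G) × (ε → G) => (matEmb ρ p.1, matEmb ρ p.2))
      fun p => Function.extend f p.1 p.2 e := by
  have h1 : SmoothAlong (fun p : (ι → G) × (ε → G) => (matEmb ρ p.1, matEmb ρ p.2))
      fun p => matEmb ρ p.1 :=
    (SmoothAlong.id _).contDiff_comp contDiff_fst
  have h2 : SmoothAlong (fun p : (ι → G) × (ε → G) => (matEmb ρ p.1, matEmb ρ p.2))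
      fun p => matEmb ρ p.2 :=
    (SmoothAlong.id _).contDiff_comp contDiff_snd
  by_cases h : ∃ A, f A = e
  · obtain ⟨A, rfl⟩ := h
    simp only [hf.extend_apply]
    exact smoothAlong_matEmb.1 h1 A
  · simp only [Function.extend_apply' _ _ _ h]
    exact smoothAlong_matEmb.1 h2 e

theorem smoothAlong_omit_integrand {ψ : V → (ι → G) → ℂ} (hψ : ∀ w, IsSmooth ρ (ψ w)) {v : V}
    (hf : Function.Injective (f v)) :
    SmoothAlong (fun p : (ι → G) × (ε → G) => (matEmb ρ p.1, matEmb ρ p.2))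
      fun p => ∏ w ∈ univ.erase v, ψ w (Function.extend (f v) p.1 p.2 ∘ f w) :=
  SmoothAlong.prod fun w _ => (hψ w).comp_smoothGroup fun A => smoothGroup_extend hf (f w A)

theorem isSmooth_omitIntegral (hρ : Continuous ρ) {ψ : V → (ι → G) → ℂ}
    (hψ : ∀ w, IsSmooth ρ (ψ w)) {v : V} (hf : Function.Injective (f v)) :
    IsSmooth ρ (omitIntegral μ f ψ v) :=
  SmoothAlong.integral (r := matEmb ρ) (continuous_matEmb hρ) (smoothAlong_omit_integrand hψ hf)

theorem continuous_omit_integrand (hρ : Continuous ρ) {ψ : V → (ι → G) → ℂ}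
    (hψ : ∀ w, IsSmooth ρ (ψ w)) {v : V} (hf : Function.Injective (f v)) :
    Continuous fun p : (ι → G) × (ε → G) =>
      ∏ w ∈ univ.erase v, ψ w (Function.extend (f v) p.1 p.2 ∘ f w) :=
  (smoothAlong_omit_integrand hψ hf).continuous
    (((continuous_matEmb hρ).comp continuous_fst).prodMk
      ((continuous_matEmb hρ).comp continuous_snd))

theorem IsSmooth.continuous (hρ : Continuous ρ) {u : (ι → G) → ℂ} (hu : IsSmooth ρ u) :
    Continuous u :=
  SmoothAlong.continuous (continuous_matEmb hρ) hu

/-- Fubini, after splitting the variables by `Function.extend` into those seen by the factor `v` and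
the rest; `η` depends only on the former. -/
theorem integral_mul_omitIntegral (hρ : Continuous ρ) {ψ : V → (ι → G) → ℂ}
    (hψ : ∀ w, IsSmooth ρ (ψ w)) {η : (ι → G) → ℂ} (hη : IsSmooth ρ η) {v : V}
    (hf : Function.Injective (f v)) :
    ∫ g : ε → G, η (g ∘ f v) * ∏ w ∈ univ.erase v, ψ w (g ∘ f w) ∂Measure.pi (fun _ => μ) =
      ∫ x, η x * omitIntegral μ f ψ v x ∂Measure.pi (fun _ => μ) := by
  have hcont : Continuous fun g : ε → G => η (g ∘ f v) * ∏ w ∈ univ.erase v, ψ w (g ∘ f w) := by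
    refine ((hη.continuous hρ).comp (by fun_prop)).mul (continuous_finsetProd _ fun w _ =>
      ((hψ w).continuous hρ).comp (by fun_prop))
  rw [← MeasurePreserving.integral_comp_of_continuous (measurePreserving_extend μ hf) hcont,
    integral_prod]
  · refine integral_congr_ae (Filter.Eventually.of_forall fun x => ?_)
    simp only [Function.extend_comp hf, omitIntegral]
    exact integral_const_mul _ _
  · refine integrable_of_continuous_compactSpace ?_
    simp only [Function.extend_comp hf]
    exact ((hη.continuous hρ).comp continuous_fst).mul (continuous_omit_integrand hρ hψ hf)

theorem hasDerivAt_interaction (hρ : Continuous ρ) (hf : ∀ v, Function.Injective (f v))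
    {ψ η : V → (ι → G) → ℂ} (hψ : ∀ v, IsSmooth ρ (ψ v)) (hη : ∀ v, IsSmooth ρ (η v)) :
    HasDerivAt (fun s : ℝ => interaction μ f fun v x => ψ v x + (s : ℂ) * η v x)
      (∑ v, ∫ x, η v x * omitIntegral μ f ψ v x ∂Measure.pi (fun _ => μ)) 0 := by
  have h1 : SmoothAlong (fun p : ℝ × (ε → G) => (p.1, matEmb ρ p.2)) fun p => (p.1 : ℂ) :=
    (SmoothAlong.id _).contDiff_comp
      (f := fun q : ℝ × (ε → Fin N → Fin N → ℂ) => (q.1 : ℂ))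
      (Complex.ofRealCLM.contDiff.comp contDiff_fst)
  have h2 : SmoothAlong (fun p : ℝ × (ε → G) => (p.1, matEmb ρ p.2)) fun p => matEmb ρ p.2 :=
    (SmoothAlong.id _).contDiff_comp contDiff_snd
  have h3 : ∀ {u : (ι → G) → ℂ}, IsSmooth ρ u → ∀ v,
      SmoothAlong (fun p : ℝ × (ε → G) => (p.1, matEmb ρ p.2)) fun p => u (p.2 ∘ f v) :=
    fun hu v => hu.comp_smoothGroup fun A => smoothAlong_matEmb.1 h2 (f v A)
  have h := hasDerivAt_integral_of_smoothAlong (ν := Measure.pi fun _ : ε => μ)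
    (continuous_matEmb hρ)
    (u := fun s g => ∏ v, (ψ v (g ∘ f v) + (s : ℂ) * η v (g ∘ f v)))
    (SmoothAlong.prod fun v _ => (h3 (hψ v) v).add (h1.mul (h3 (hη v) v))) 0
  refine HasDerivAt.congr_deriv (f := fun s : ℝ => interaction μ f fun v x =>
    ψ v x + (s : ℂ) * η v x) h (Eq.symm ?_)
  have hs : HasDerivAt (fun s : ℝ => (s : ℂ)) 1 0 := (hasDerivAt_id (0 : ℝ)).ofReal_comp
  have hd : ∀ g : ε → G, deriv (fun s : ℝ => ∏ v, (ψ v (g ∘ f v) + (s : ℂ) * η v (g ∘ f v))) 0 =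
      ∑ v, η v (g ∘ f v) * ∏ w ∈ univ.erase v, ψ w (g ∘ f w) := fun g => by
    have := HasDerivAt.fun_finsetProd (u := Finset.univ) fun v _ =>
      ((hs.mul_const (η v (g ∘ f v))).const_add (ψ v (g ∘ f v)))
    rw [this.deriv]
    refine Finset.sum_congr rfl fun v _ => ?_
    simp [mul_comm]
  refine Eq.trans ?_ (integral_congr_ae (Filter.Eventually.of_forall fun g => (hd g).symm))
  rw [integral_finsetSum]
  · exact Finset.sum_congr rfl fun v _ => (integral_mul_omitIntegral μ hρ hψ (hη v) (hf v)).symm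
  · intro v _
    exact integrable_of_continuous_compactSpace (((hη v).continuous hρ |>.comp (by fun_prop)).mul
      (continuous_finsetProd _ fun w _ => ((hψ w).continuous hρ).comp (by fun_prop)))

theorem prod_erase_equiv (σ : Equiv.Perm V) (v : V) (F : V → ℂ) :
    ∏ w ∈ univ.erase (σ v), F w = ∏ w ∈ univ.erase v, F (σ w) := by
  refine (Finset.prod_equiv σ (fun w => ?_) fun w _ => rfl).symm
  simp

/-- Symmetries of the interaction pattern up to permutations of the slots. -/
theorem omitIntegral_symm {σ : Equiv.Perm V} {τ : Equiv.Perm ε} {π : V → Equiv.Perm ι}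
    (h : ∀ w, f (σ w) = τ ∘ f w ∘ π w) {ψ ψ' : V → (ι → G) → ℂ}
    (hψ : ∀ w y, ψ (σ w) (y ∘ π w) = ψ' w y) {v : V} (hf : Function.Injective (f v))
    (x : ι → G) : omitIntegral μ f ψ (σ v) (x ∘ π v) = omitIntegral μ f ψ' v x := by
  -- Relabelling the variables by `τ` matches the two ways of inserting `x`; the remaining
  -- relabelling of the integrated `g` preserves the product measure.
  have hext : ∀ g : ε → G, Function.extend (f (σ v)) (x ∘ π v) g ∘ τ =
      Function.extend (f v) x (g ∘ τ) := fun g => by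
    have hinj : Function.Injective (f (σ v)) := by
      rw [h]
      exact τ.injective.comp (hf.comp (π v).injective)
    funext e
    by_cases he : ∃ A, f v A = e
    · obtain ⟨A, rfl⟩ := he
      rw [hf.extend_apply]
      have := hinj.extend_apply (x ∘ π v) g ((π v).symm A)
      rw [h] at this ⊢
      simpa using this
    · rw [Function.extend_apply' _ _ _ he, Function.comp_apply, Function.extend_apply']
      · rfl
      · rintro ⟨A, hA⟩
        refine he ⟨π v A, τ.injective ?_⟩
        rw [← hA, h]
        rfl
  unfold omitIntegral
  have hm : MeasurePreserving (MeasurableEquiv.arrowCongr' τ.symm (MeasurableEquiv.refl G))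
      (Measure.pi fun _ : ε => μ) (Measure.pi fun _ => μ) :=
    measurePreserving_arrowCongr' _ _ _ _ fun _ => MeasurePreserving.id μ
  rw [← hm.integral_comp' fun g => ∏ w ∈ univ.erase v, ψ' w (Function.extend (f v) x g ∘ f w)]
  refine integral_congr_ae (Filter.Eventually.of_forall fun g => ?_)
  beta_reduce
  rw [prod_erase_equiv]
  refine Finset.prod_congr rfl fun w _ => ?_
  rw [← hψ w]
  congr 1
  change _ = Function.extend (f v) x (g ∘ τ) ∘ f w ∘ π w
  rw [← hext g, h w]
  rfl

/-- Invariance under translations of the variables. -/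
theorem omitIntegral_translate (hρ : Continuous ρ) (p q : ε → G) {ψ : V → (ι → G) → ℂ}
    (hψs : ∀ w, IsSmooth ρ (ψ w))
    (hψ : ∀ w y, ψ w (fun A => p (f w A) * y A * q (f w A)) = ψ w y) {v : V}
    (hf : Function.Injective (f v)) (x : ι → G) :
    omitIntegral μ f ψ v (fun A => p (f v A) * x A * q (f v A)) = omitIntegral μ f ψ v x := by
  unfold omitIntegral
  have hc : Continuous fun g : ε → G => ∏ w ∈ univ.erase v,
      ψ w (Function.extend (f v) (fun A => p (f v A) * x A * q (f v A)) g ∘ f w) :=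
    (continuous_omit_integrand hρ hψs hf).comp (continuous_const.prodMk continuous_id)
  rw [← MeasurePreserving.integral_comp_of_continuous (measurePreserving_mul_mul μ p q) hc]
  refine integral_congr_ae (Filter.Eventually.of_forall fun g => ?_)
  refine Finset.prod_congr rfl fun w _ => ?_
  refine (congrArg (ψ w) ?_).trans (hψ w _)
  funext A
  simp only [Function.comp_apply]
  by_cases he : ∃ B, f v B = f w A
  · obtain ⟨B, hB⟩ := he
    rw [← hB, hf.extend_apply, hf.extend_apply]
  · rw [Function.extend_apply' _ _ _ he, Function.extend_apply' _ _ _ he]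

theorem omitIntegral_conj (ψ : V → (ι → G) → ℂ) (v : V) (x : ι → G) :
    omitIntegral μ f (fun w y => conj (ψ w y)) v x = conj (omitIntegral μ f ψ v x) := by
  simp only [omitIntegral, ← integral_conj, map_prod]

variable (Q : InvariantMetric ρ d)

/-- Only the pairing of `I` with admissible variations is prescribed. This leaves the freedom to
replace the raw omitted integrals by a representative that satisfies the constraints. -/
theorem action_field_equation (hρ : Continuous ρ) (hf : ∀ v, Function.Injective (f v))
    {𝒯 : Set ((ι → G) → (ι → G))} {κ : ι → ℝ} {m l : ℝ} {col : V → C} {φ I : C → (ι → G) → ℂ}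
    (hφ : φ ∈ fields ρ C 𝒯) (hI : I ∈ fields ρ C 𝒯)
    (hlap : ∀ c, ∀ T ∈ 𝒯, laplacian Q κ (φ c) ∘ T = laplacian Q κ (φ c))
    (hpair : ∀ η ∈ fields ρ C 𝒯,
      ∑ v, ∫ x, η (col v) x * omitIntegral μ f (fun v => φ (col v)) v x
        ∂Measure.pi (fun _ => μ) = ∑ c, ∫ x, η c x * I c x ∂Measure.pi (fun _ => μ))
    (hstat : IsStationary (action μ Q κ m l f col) (fields ρ C 𝒯) φ) (c : C) (x : ι → G) :
    laplacian Q κ (φ c) x - m * φ c x = l * conj (I c x) := by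
  refine field_equation μ Q hρ (S := fun φ => (l : ℂ) * interaction μ f (fun v => φ (col v)) +
    conj ((l : ℂ) * interaction μ f fun v => φ (col v))) hφ hI hlap (fun η hη => ?_) hstat c x
  rw [← hpair η hη]
  have h := (hasDerivAt_interaction μ hρ hf (fun v => (hφ (col v)).1)
    fun v => (hη (col v)).1).const_mul (l : ℂ)
  exact h.add h.star

end NonLocal

/-! ## Symmetries of the Laplacian -/

section LaplacianSymmetry

variable {G : Type*} [Group G] {N d : ℕ} {ι : Type*} [Fintype ι] [DecidableEq ι]
variable {ρ : G →* Matrix (Fin N) (Fin N) ℂ} (Q : InvariantMetric ρ d)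

/-- The Casimir operator does not depend on the orthonormal basis, and `Ad g` carries one
orthonormal basis to another. -/
theorem sum_rightDeriv_conjBy {u : (ι → G) → ℂ} (hu : IsSmooth ρ u) (A : ι) (g : G) (z : ι → G) :
    ∑ a, rightDeriv A ((Q.e a).conjBy g) (rightDeriv A ((Q.e a).conjBy g) u) z =
      ∑ a, frameDeriv Q A a (frameDeriv Q A a u) z := by
  set R : Fin d → Fin d → ℂ := fun a b =>
    (Q.B (velocity ρ ((Q.e a).conjBy g)) (velocity ρ (Q.e b)) : ℂ) with hR
  have h1 : ∀ a, rightDeriv A ((Q.e a).conjBy g) (rightDeriv A ((Q.e a).conjBy g) u) z =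
      ∑ c, ∑ b, R a c * R a b * frameDeriv Q A c (frameDeriv Q A b u) z := fun a => by
    have e : rightDeriv A ((Q.e a).conjBy g) u = fun y => ∑ b, R a b * frameDeriv Q A b u y :=
      funext fun y => hu.rightDeriv_expand Q A _ y
    rw [(hu.rightDeriv A _).rightDeriv_expand Q, e]
    refine Finset.sum_congr rfl fun c _ => ?_
    rw [frameDeriv_sum_mul Q (R a) fun b => hu.frameDeriv Q A b, Finset.mul_sum]
    exact Finset.sum_congr rfl fun b _ => by rw [hR]; ring
  have h2 : ∀ b c, ∑ a, R a b * R a c = if b = c then 1 else 0 := fun b c => by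
    have := congrArg (fun r : ℝ => (r : ℂ)) (Q.adjoint_orthogonal g b c)
    simpa [hR, apply_ite Complex.ofReal] using this
  simp only [h1]
  rw [Finset.sum_comm]
  refine Finset.sum_congr rfl fun c _ => ?_
  rw [Finset.sum_comm]
  simp only [← Finset.sum_mul, h2]
  simp

/-- Near `x` the map permutes the slots and conjugates increments, so it only rotates the frame
within each copy of `G`. The condition is needed just for slots with nonzero coupling, which the
Barrett–Crane constraints rely on. -/
theorem laplacian_comp {T : (ι → G) → (ι → G)} {π : Equiv.Perm ι} {κ : ι → ℝ}
    (hκ : ∀ A, κ (π A) = κ A) {u : (ι → G) → ℂ} (hu : IsSmooth ρ u) (huT : ∀ y, u (T y) = u y)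
    (x : ι → G) (h : ι → G)
    (hT : ∀ A, κ A ≠ 0 → ∀ y, T (Function.update x A (x A * y)) =
      Function.update (T x) (π A) (T x (π A) * (h A * y * (h A)⁻¹))) :
    laplacian Q κ u (T x) = laplacian Q κ u x := by
  unfold laplacian
  rw [← Equiv.sum_comp π]
  refine Finset.sum_congr rfl fun A _ => ?_
  by_cases h0 : κ A = 0
  · simp [hκ, h0]
  rw [hκ, ← sum_rightDeriv_conjBy Q hu (π A) (h A) (T x)]
  congr 1
  refine Finset.sum_congr rfl fun a _ => ?_
  simp only [frameDeriv_eq_rightDeriv, rightDeriv, Function.update_self, Function.update_idem,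
    mul_assoc]
  congr 1
  funext s
  congr 1
  funext t
  rw [← huT (Function.update x A _), hT A h0]
  congr 3
  simp only [OneParam.conjBy]
  group

theorem laplacian_comp_gauge {κ : ι → ℝ} {u : (ι → G) → ℂ} (hu : IsSmooth ρ u)
    (huT : ∀ T ∈ gaugeMaps G ι, u ∘ T = u) :
    ∀ T ∈ gaugeMaps G ι, laplacian Q κ u ∘ T = laplacian Q κ u := by
  rintro T ⟨h, rfl⟩
  funext x
  refine laplacian_comp Q (π := Equiv.refl ι) (T := fun x A => x A * h) (fun _ => rfl) hu
    (fun y => congrFun (huT _ ⟨h, rfl⟩) y) x (fun _ => h⁻¹) fun A _ y => ?_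
  funext B
  by_cases hB : B = A
  · subst hB
    simp [mul_assoc]
  · simp [hB]

theorem laplacian_comp_cyclic {κ : ℝ} {u : (Fin 3 → G) → ℂ} (hu : IsSmooth ρ u)
    (huT : ∀ T ∈ cyclicMaps G, u ∘ T = u) :
    ∀ T ∈ cyclicMaps G, laplacian Q (fun _ => κ) u ∘ T = laplacian Q (fun _ => κ) u := by
  rintro T ⟨r, rfl⟩
  funext x
  refine laplacian_comp Q (π := Equiv.subRight r) (T := fun x i => x (i + r)) (fun _ => rfl) hu
    (fun y => congrFun (huT _ ⟨r, rfl⟩) y) x (fun _ => 1) fun A _ y => ?_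
  funext B
  by_cases hB : B + r = A
  · subst hB
    simp
  · have : B ≠ A - r := fun h => hB (by rw [h, sub_add_cancel])
    simp [hB, this]

end LaplacianSymmetry

/-! ## Simplicial models -/

section Models

variable {G : Type*} [Group G] [TopologicalSpace G] [IsTopologicalGroup G] [CompactSpace G]
  [MeasurableSpace G] [BorelSpace G] [SecondCountableTopology G] (μ : Measure G)
  [μ.IsHaarMeasure] [IsProbabilityMeasure μ]
  {N d : ℕ} {ι V ε C : Type*} [Fintype ι] [DecidableEq ι] [Fintype V] [DecidableEq V] [Fintype ε]
  [DecidableEq ε] [Fintype C] {ρ : G →* Matrix (Fin N) (Fin N) ℂ} {f : V → ι → ε}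

theorem omitIntegral_comp_gauge (hρ : Continuous ρ) {ψ : V → (ι → G) → ℂ}
    (hψs : ∀ w, IsSmooth ρ (ψ w)) (hψ : ∀ w, ∀ T ∈ gaugeMaps G ι, ψ w ∘ T = ψ w) {v : V}
    (hf : Function.Injective (f v)) :
    ∀ T ∈ gaugeMaps G ι, omitIntegral μ f ψ v ∘ T = omitIntegral μ f ψ v := by
  rintro T ⟨h, rfl⟩
  funext x
  have := omitIntegral_translate μ hρ (f := f) (fun _ => 1) (fun _ => h) hψs
    (fun w y => by simpa using congrFun (hψ w _ ⟨h, rfl⟩) y) hf x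
  simpa using this

theorem omitIntegral_mem_fields (hρ : Continuous ρ) {𝒯 : Set ((ι → G) → (ι → G))}
    (h𝒯 : 𝒯 = ∅ ∨ 𝒯 = gaugeMaps G ι) {ψ : V → (ι → G) → ℂ}
    (hψ : ψ ∈ fields ρ V 𝒯) (hf : ∀ v, Function.Injective (f v)) :
    omitIntegral μ f ψ ∈ fields ρ V 𝒯 := fun v => by
  refine ⟨isSmooth_omitIntegral μ hρ (fun w => (hψ w).1) (hf v), ?_⟩
  rcases h𝒯 with rfl | rfl
  · simp
  · exact omitIntegral_comp_gauge μ hρ (fun w => (hψ w).1) (fun w => (hψ w).2) (hf v)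

variable (Q : InvariantMetric ρ d)

theorem laplacian_comp_of_mem_fields {𝒯 : Set ((ι → G) → (ι → G))}
    (h𝒯 : 𝒯 = ∅ ∨ 𝒯 = gaugeMaps G ι) {κ : ι → ℝ} {φ : C → (ι → G) → ℂ} (hφ : φ ∈ fields ρ C 𝒯)
    (c : C) : ∀ T ∈ 𝒯, laplacian Q κ (φ c) ∘ T = laplacian Q κ (φ c) := by
  rcases h𝒯 with rfl | rfl
  · simp
  · exact laplacian_comp_gauge Q (hφ c).1 (hφ c).2

theorem const_mul_mem_fields {𝒯 : Set ((ι → G) → (ι → G))} {u : (ι → G) → ℂ}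
    (hu : IsSmooth ρ u) (huT : ∀ T ∈ 𝒯, u ∘ T = u) (z : ℂ) :
    (fun (_ : Unit) x => z * u x) ∈ fields ρ Unit 𝒯 :=
  fun _ => ⟨hu.const_mul z, fun T hT => funext fun x =>
    congrArg (z * ·) (congrFun (huT T hT) x)⟩

/-- The field equation of a single field whose interaction treats all factors alike. -/
theorem field_equation_of_omitIntegral_eq [Nonempty V] (hρ : Continuous ρ)
    (hf : ∀ v, Function.Injective (f v))
    {𝒯 : Set ((ι → G) → (ι → G))} {κ : ι → ℝ} {m l : ℝ} {φ : Unit → (ι → G) → ℂ}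
    (hφ : φ ∈ fields ρ Unit 𝒯) {o : (ι → G) → ℂ}
    (ho : ∀ v x, omitIntegral μ f (fun _ => φ ()) v x = o x)
    (hoT : ∀ T ∈ 𝒯, o ∘ T = o)
    (hlap : ∀ T ∈ 𝒯, laplacian Q κ (φ ()) ∘ T = laplacian Q κ (φ ()))
    (hstat : IsStationary (action μ Q κ m l f fun _ => ()) (fields ρ Unit 𝒯) φ) (x : ι → G) :
    laplacian Q κ (φ ()) x - m * φ () x = l * conj ((Fintype.card V : ℂ) * o x) := by
  have hos : IsSmooth ρ o := by
    rw [← funext (ho (Classical.arbitrary V))]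
    exact isSmooth_omitIntegral μ hρ (fun _ => (hφ ()).1) (hf _)
  refine action_field_equation μ Q hρ hf hφ
    (I := fun _ x => (Fintype.card V : ℂ) * o x) ?_ (fun _ => hlap) (fun η _ => ?_) hstat () x
  · exact const_mul_mem_fields hos hoT _
  · simp only [ho, Finset.univ_unique, Finset.sum_singleton, Finset.sum_const, nsmul_eq_mul,
      Finset.card_univ]
    rw [← integral_const_mul]
    exact integral_congr_ae (Filter.Eventually.of_forall fun x => by
      change _ * (η () x * o x) = η () x * (_ * o x)
      ring)

theorem divergence_current_unit {κ : ι → ℝ} {m l z : ℝ} {φ : Unit → (ι → G) → ℂ}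
    (hφ : IsSmooth ρ (φ ())) {o : (ι → G) → ℂ}
    (heom : ∀ x, laplacian Q κ (φ ()) x - m * φ () x = l * conj ((z : ℂ) * o x))
    (α β : ι → OneParam ρ) (x : ι → G) :
    divergence Q (current Q κ m φ (biFlow α β) 0) x =
      ((-(2 * z) * l * (lieDeriv (biFlow α β) (φ ()) x * o x).re : ℝ) : ℂ) := by
  rw [divergence_current_flow Q (I := fun _ x => (z : ℂ) * o x) (fun _ => hφ) (fun _ => heom)]
  congr 1
  simp only [Finset.univ_unique, Finset.sum_singleton, PUnit.default_eq_unit]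
  rw [mul_left_comm, Complex.re_ofReal_mul]
  ring

/-- The cyclic symmetry of the edges of the simplicial pattern. -/
def simplicialPerm : Equiv.Perm (Fin 6) where
  toFun := ![2, 3, 4, 1, 5, 0]
  invFun := ![5, 3, 0, 1, 2, 4]
  left_inv := by decide
  right_inv := by decide

/-- The cyclic symmetry of the triangles of the Ooguri pattern. -/
def ooguriPerm : Equiv.Perm (Fin 10) where
  toFun := ![3, 4, 5, 6, 2, 7, 8, 1, 9, 0]
  invFun := ![9, 7, 4, 0, 1, 2, 3, 5, 6, 8]
  left_inv := by decide
  right_inv := by decide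

theorem simplicialPattern_succ : ∀ w, simplicialPattern (Equiv.addRight (1 : Fin 4) w) =
    simplicialPerm ∘ simplicialPattern w ∘ (1 : Equiv.Perm (Fin 3)) := by decide

theorem ooguriPattern_succ : ∀ w, ooguriPattern (Equiv.addRight (1 : Fin 5) w) =
    ooguriPerm ∘ ooguriPattern w ∘ (1 : Equiv.Perm (Fin 4)) := by decide

theorem simplicialPattern_injective : ∀ v, Function.Injective (simplicialPattern v) := by decide

theorem ooguriPattern_injective : ∀ v, Function.Injective (ooguriPattern v) := by decide

theorem coloredPattern_injective : ∀ v, Function.Injective (coloredPattern v) := by decide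

theorem boulatovPattern_injective : ∀ v, Function.Injective (boulatovPattern v) := by decide

theorem boulatovPattern'_injective : ∀ v, Function.Injective (boulatovPattern' v) := by decide

/-- Addition in `Fin (n + 1)` is cyclic; this turns invariance under the cyclic shift of the factors
into equality of all omitted integrals. -/
theorem eq_zero_of_succ {n : ℕ} {Z : Type*} (F : Fin (n + 1) → Z) (h : ∀ v, F (v + 1) = F v)
    (v : Fin (n + 1)) : F v = F 0 := by
  induction v using Fin.induction with
  | zero => rfl
  | succ i ih => rw [← ih, ← Fin.coeSucc_eq_succ, h]

theorem omitIntegral_simplicial (u : (Fin 3 → G) → ℂ) (v : Fin 4) :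
    omitIntegral μ simplicialPattern (fun _ => u) v =
      omitIntegral μ simplicialPattern (fun _ => u) 0 :=
  eq_zero_of_succ _ (fun v => funext fun x => omitIntegral_symm μ (ψ' := fun _ => u)
    simplicialPattern_succ (fun _ _ => rfl) (simplicialPattern_injective v) x) v

theorem omitIntegral_ooguri (u : (Fin 4 → G) → ℂ) (v : Fin 5) :
    omitIntegral μ ooguriPattern (fun _ => u) v = omitIntegral μ ooguriPattern (fun _ => u) 0 :=
  eq_zero_of_succ _ (fun v => funext fun x => omitIntegral_symm μ (ψ' := fun _ => u)
    ooguriPattern_succ (fun _ _ => rfl) (ooguriPattern_injective v) x) v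

/-- Rotation of the tetrahedron about its first vertex, acting on the edges. -/
def boulatovRotation : Equiv.Perm (Fin 6) where
  toFun := ![1, 2, 0, 4, 5, 3]
  invFun := ![2, 0, 1, 5, 3, 4]
  left_inv := by decide
  right_inv := by decide

/-- Rotation of the tetrahedron about its first vertex, acting on the vertices. -/
def boulatovRotationVertex : Equiv.Perm (Fin 4) where
  toFun := ![0, 2, 3, 1]
  invFun := ![0, 3, 1, 2]
  left_inv := by decide
  right_inv := by decide

/-- Half-turn of the tetrahedron, acting on the edges. -/
def boulatovHalfTurn : Equiv.Perm (Fin 6) where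
  toFun := ![0, 3, 4, 1, 2, 5]
  invFun := ![0, 3, 4, 1, 2, 5]
  left_inv := by decide
  right_inv := by decide

/-- Half-turn of the tetrahedron, acting on the vertices. -/
def boulatovHalfTurnVertex : Equiv.Perm (Fin 4) where
  toFun := ![1, 0, 3, 2]
  invFun := ![1, 0, 3, 2]
  left_inv := by decide
  right_inv := by decide

/-- The tetrahedral symmetries respect the order of the slots only up to a cyclic shift in each
factor, which cyclically invariant fields absorb. -/
theorem boulatovPattern_rotation : ∀ w, boulatovPattern (boulatovRotationVertex w) =
    boulatovRotation ∘ boulatovPattern w ∘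
      Equiv.addRight ((![2, 0, 0, 0] : Fin 4 → Fin 3) w) := by decide

theorem boulatovPattern_halfTurn : ∀ w, boulatovPattern (boulatovHalfTurnVertex w) =
    boulatovHalfTurn ∘ boulatovPattern w ∘
      Equiv.addRight ((![0, 0, 1, 2] : Fin 4 → Fin 3) w) := by decide

theorem comp_add_of_cyclic {u : (Fin 3 → G) → ℂ} (hu : ∀ T ∈ cyclicMaps G, u ∘ T = u)
    (r : Fin 3) (y : Fin 3 → G) : u (y ∘ Equiv.addRight r) = u y :=
  congrFun (hu _ ⟨r, rfl⟩) y

theorem omitIntegral_boulatov {u : (Fin 3 → G) → ℂ} (hu : ∀ T ∈ cyclicMaps G, u ∘ T = u)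
    (v : Fin 4) :
    omitIntegral μ boulatovPattern (fun _ => u) v =
      omitIntegral μ boulatovPattern (fun _ => u) 0 := by
  have h1 : ∀ v x, omitIntegral μ boulatovPattern (fun _ => u) (boulatovRotationVertex v)
      (x ∘ Equiv.addRight ((![2, 0, 0, 0] : Fin 4 → Fin 3) v)) =
      omitIntegral μ boulatovPattern (fun _ => u) v x := fun v x =>
    omitIntegral_symm μ (ψ' := fun _ => u)
      (π := fun w => Equiv.addRight ((![2, 0, 0, 0] : Fin 4 → Fin 3) w))
      boulatovPattern_rotation (fun w y => comp_add_of_cyclic hu _ y)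
      (boulatovPattern_injective v) x
  have h2 : ∀ v x, omitIntegral μ boulatovPattern (fun _ => u) (boulatovHalfTurnVertex v)
      (x ∘ Equiv.addRight ((![0, 0, 1, 2] : Fin 4 → Fin 3) v)) =
      omitIntegral μ boulatovPattern (fun _ => u) v x := fun v x =>
    omitIntegral_symm μ (ψ' := fun _ => u)
      (π := fun w => Equiv.addRight ((![0, 0, 1, 2] : Fin 4 → Fin 3) w))
      boulatovPattern_halfTurn (fun w y => comp_add_of_cyclic hu _ y)
      (boulatovPattern_injective v) x
  -- The half-turn carries vertex 0 to 1, the rotation carries 1 to 2 and 2 to 3, and the slot shift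
  -- is zero at each vertex used, so no argument is permuted.
  have e1 : omitIntegral μ boulatovPattern (fun _ => u) 1 =
      omitIntegral μ boulatovPattern (fun _ => u) 0 := funext fun x => by
    simpa [boulatovHalfTurnVertex] using h2 0 x
  have e2 : omitIntegral μ boulatovPattern (fun _ => u) 2 =
      omitIntegral μ boulatovPattern (fun _ => u) 1 := funext fun x => by
    simpa [boulatovRotationVertex] using h1 1 x
  have e3 : omitIntegral μ boulatovPattern (fun _ => u) 3 =
      omitIntegral μ boulatovPattern (fun _ => u) 2 := funext fun x => by
    simpa [boulatovRotationVertex] using h1 2 x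
  fin_cases v
  · rfl
  · exact e1
  · exact e2.trans e1
  · exact e3.trans (e2.trans e1)

/-- The rotation fixes the omitted vertex 0 and shifts its slots by two; this shift generates all
cyclic permutations. -/
theorem omitIntegral_boulatov_cyclic {u : (Fin 3 → G) → ℂ}
    (hu : ∀ T ∈ cyclicMaps G, u ∘ T = u) :
    ∀ T ∈ cyclicMaps G, omitIntegral μ boulatovPattern (fun _ => u) 0 ∘ T =
      omitIntegral μ boulatovPattern (fun _ => u) 0 := by
  have h1 : ∀ x, omitIntegral μ boulatovPattern (fun _ => u) 0
      (x ∘ Equiv.addRight (2 : Fin 3)) = omitIntegral μ boulatovPattern (fun _ => u) 0 x :=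
    fun x => omitIntegral_symm μ (σ := boulatovRotationVertex) (ψ' := fun _ => u)
      (π := fun w => Equiv.addRight ((![2, 0, 0, 0] : Fin 4 → Fin 3) w))
      boulatovPattern_rotation (fun w y => comp_add_of_cyclic hu _ y)
      (boulatovPattern_injective 0) x
  rintro T ⟨r, rfl⟩
  funext x
  have h2 := h1 (x ∘ Equiv.addRight (2 : Fin 3))
  rw [h1 x] at h2
  fin_cases r
  · simp
  -- A shift by one is two shifts by two, modulo three.
  · have h3 : ∀ i : Fin 3, i + 2 + 2 = i + 1 := by decide
    rw [← h2]
    change omitIntegral μ boulatovPattern (fun _ => u) 0 (fun i => x (i + 1)) =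
      omitIntegral μ boulatovPattern (fun _ => u) 0 (fun i => x (i + 2 + 2))
    simp only [h3]
  · exact h1 x

end Models

/-! ### Field equations and current divergences of the models on copies of `G` -/

section ModelDivergences

variable {G : Type*} [Group G] [TopologicalSpace G] [IsTopologicalGroup G] [CompactSpace G]
  [MeasurableSpace G] [BorelSpace G] [SecondCountableTopology G] (μ : Measure G)
  [μ.IsHaarMeasure] [IsProbabilityMeasure μ]
  {N d : ℕ} {ρ : G →* Matrix (Fin N) (Fin N) ℂ} (Q : InvariantMetric ρ d) {κ m l : ℝ}

theorem colored_field_equation (hρ : Continuous ρ) {𝒯 : Set ((Fin 3 → G) → (Fin 3 → G))}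
    (h𝒯 : 𝒯 = ∅ ∨ 𝒯 = gaugeMaps G (Fin 3)) {φ : Fin 4 → (Fin 3 → G) → ℂ}
    (hφ : φ ∈ fields ρ (Fin 4) 𝒯)
    (hstat : IsStationary (action μ Q (fun _ => κ) m l coloredPattern id)
      (fields ρ (Fin 4) 𝒯) φ) (c : Fin 4) (x : Fin 3 → G) :
    laplacian Q (fun _ => κ) (φ c) x - m * φ c x =
      l * conj (omitIntegral μ coloredPattern φ c x) :=
  action_field_equation μ Q hρ coloredPattern_injective hφ
    (omitIntegral_mem_fields μ hρ h𝒯 hφ coloredPattern_injective)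
    (laplacian_comp_of_mem_fields Q h𝒯 hφ) (fun _ _ => rfl) hstat c x

theorem simplicial_divergence (hρ : Continuous ρ) {𝒯 : Set ((Fin 3 → G) → (Fin 3 → G))}
    (h𝒯 : 𝒯 = ∅ ∨ 𝒯 = gaugeMaps G (Fin 3)) {φ : Unit → (Fin 3 → G) → ℂ}
    (hφ : φ ∈ fields ρ Unit 𝒯)
    (hstat : IsStationary (action μ Q (fun _ => κ) m l simplicialPattern fun _ => ())
      (fields ρ Unit 𝒯) φ) (γ : Fin 3 → OneParam ρ) (x : Fin 3 → G) :
    divergence Q (current Q (fun _ => κ) m φ (leftFlow γ) 0) x =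
      ((-8 * l * (lieDeriv (leftFlow γ) (φ ()) x *
        omitIntegral μ simplicialPattern (fun _ => φ ()) 0 x).re : ℝ) : ℂ) := by
  have heom := field_equation_of_omitIntegral_eq μ Q hρ simplicialPattern_injective hφ
      (fun v x => congrFun (omitIntegral_simplicial μ (φ ()) v) x)
      (omitIntegral_mem_fields μ hρ h𝒯 (ψ := fun _ => φ ()) (fun _ => hφ ())
        simplicialPattern_injective 0).2
      (laplacian_comp_of_mem_fields Q h𝒯 hφ ()) hstat
  rw [leftFlow_eq_biFlow, divergence_current_unit Q (z := 4) (l := l) (hφ ()).1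
    fun x => by simpa using heom x]
  norm_num

theorem ooguri_divergence (hρ : Continuous ρ) {𝒯 : Set ((Fin 4 → G) → (Fin 4 → G))}
    (h𝒯 : 𝒯 = ∅ ∨ 𝒯 = gaugeMaps G (Fin 4)) {φ : Unit → (Fin 4 → G) → ℂ}
    (hφ : φ ∈ fields ρ Unit 𝒯)
    (hstat : IsStationary (action μ Q (fun _ => κ) m l ooguriPattern fun _ => ())
      (fields ρ Unit 𝒯) φ) (γ : Fin 4 → OneParam ρ) (x : Fin 4 → G) :
    divergence Q (current Q (fun _ => κ) m φ (leftFlow γ) 0) x =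
      ((-10 * l * (lieDeriv (leftFlow γ) (φ ()) x *
        omitIntegral μ ooguriPattern (fun _ => φ ()) 0 x).re : ℝ) : ℂ) := by
  have heom := field_equation_of_omitIntegral_eq μ Q hρ ooguriPattern_injective hφ
      (fun v x => congrFun (omitIntegral_ooguri μ (φ ()) v) x)
      (omitIntegral_mem_fields μ hρ h𝒯 (ψ := fun _ => φ ()) (fun _ => hφ ())
        ooguriPattern_injective 0).2
      (laplacian_comp_of_mem_fields Q h𝒯 hφ ()) hstat
  rw [leftFlow_eq_biFlow, divergence_current_unit Q (z := 5) (l := l) (hφ ()).1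
    fun x => by simpa using heom x]
  norm_num

/-! ### Cyclically invariant fields -/

theorem laplacian_comp_of_cyclic {𝒯 : Set ((Fin 3 → G) → (Fin 3 → G))}
    (h𝒯 : 𝒯 = cyclicMaps G ∨ 𝒯 = cyclicMaps G ∪ gaugeMaps G (Fin 3))
    {φ : Unit → (Fin 3 → G) → ℂ} (hφ : φ ∈ fields ρ Unit 𝒯) :
    ∀ T ∈ 𝒯, laplacian Q (fun _ => κ) (φ ()) ∘ T = laplacian Q (fun _ => κ) (φ ()) := by
  rcases h𝒯 with rfl | rfl
  · exact laplacian_comp_cyclic Q (hφ ()).1 (hφ ()).2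
  · rintro T (hT | hT)
    · exact laplacian_comp_cyclic Q (hφ ()).1 (fun T hT => (hφ ()).2 T (Or.inl hT)) T hT
    · exact laplacian_comp_gauge Q (hφ ()).1 (fun T hT => (hφ ()).2 T (Or.inr hT)) T hT

theorem boulatov_divergence (hρ : Continuous ρ) {𝒯 : Set ((Fin 3 → G) → (Fin 3 → G))}
    (h𝒯 : 𝒯 = cyclicMaps G ∨ 𝒯 = cyclicMaps G ∪ gaugeMaps G (Fin 3))
    {φ : Unit → (Fin 3 → G) → ℂ} (hφ : φ ∈ fields ρ Unit 𝒯)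
    (hstat : IsStationary (action μ Q (fun _ => κ) m l boulatovPattern fun _ => ())
      (fields ρ Unit 𝒯) φ) (γ : Fin 3 → OneParam ρ) (x : Fin 3 → G) :
    divergence Q (current Q (fun _ => κ) m φ (leftFlow γ) 0) x =
      ((-8 * l * (lieDeriv (leftFlow γ) (φ ()) x *
        omitIntegral μ boulatovPattern (fun _ => φ ()) 0 x).re : ℝ) : ℂ) := by
  have hsub : cyclicMaps G ⊆ 𝒯 := by
    rcases h𝒯 with rfl | rfl
    · exact subset_rfl
    · exact Set.subset_union_left
  have hcyc : ∀ T ∈ cyclicMaps G, φ () ∘ T = φ () := fun T hT => (hφ ()).2 T (hsub hT)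
  have ho : ∀ T ∈ 𝒯, omitIntegral μ boulatovPattern (fun _ => φ ()) 0 ∘ T =
      omitIntegral μ boulatovPattern (fun _ => φ ()) 0 := by
    have hc := omitIntegral_boulatov_cyclic μ hcyc
    rcases h𝒯 with rfl | rfl
    · exact hc
    · rintro T (hT | hT)
      · exact hc T hT
      · exact omitIntegral_comp_gauge μ hρ (fun _ => (hφ ()).1)
          (fun _ T hT => (hφ ()).2 T (Or.inr hT)) (boulatovPattern_injective 0) T hT
  have heom := field_equation_of_omitIntegral_eq μ Q hρ boulatovPattern_injective hφ
    (fun v x => congrFun (omitIntegral_boulatov μ hcyc v) x) ho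
    (laplacian_comp_of_cyclic Q h𝒯 hφ) hstat
  rw [leftFlow_eq_biFlow, divergence_current_unit Q (z := 4) (l := l) (hφ ()).1
    fun x => by simpa using heom x]
  norm_num

/-- The average over the cyclic permutations of the three arguments. -/
def cyclicAverage (o : (Fin 3 → G) → ℂ) (x : Fin 3 → G) : ℂ :=
  (1 / 3 : ℂ) * ∑ r : Fin 3, o fun i => x (i + r)

theorem isSmooth_cyclicAverage {o : (Fin 3 → G) → ℂ} (ho : IsSmooth ρ o) :
    IsSmooth ρ (cyclicAverage o) :=
  (IsSmooth.sum fun r _ => ho.comp_smoothGroup (r := matEmb ρ)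
    (c := fun (x : Fin 3 → G) i => x (i + r)) fun A => smoothGroup_eval (A + r)).const_mul _

theorem cyclicAverage_comp_cyclic (o : (Fin 3 → G) → ℂ) :
    ∀ T ∈ cyclicMaps G, cyclicAverage o ∘ T = cyclicAverage o := by
  rintro T ⟨s, rfl⟩
  funext x
  simp only [cyclicAverage, Function.comp_apply]
  congr 1
  rw [← Equiv.sum_comp (Equiv.addRight s) fun r => o fun i => x (i + r)]
  simp only [Equiv.coe_addRight, add_assoc]

theorem cyclicAverage_comp_gauge {o : (Fin 3 → G) → ℂ}
    (ho : ∀ T ∈ gaugeMaps G (Fin 3), o ∘ T = o) :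
    ∀ T ∈ gaugeMaps G (Fin 3), cyclicAverage o ∘ T = cyclicAverage o := by
  rintro T ⟨h, rfl⟩
  funext x
  simp only [cyclicAverage, Function.comp_apply]
  congr 1
  exact Finset.sum_congr rfl fun r _ => congrFun (ho _ ⟨h, rfl⟩) fun i => x (i + r)

/-- Permuting the variables preserves the product measure and fixes `η`, so every term of the
average has the same pairing with `η`. -/
theorem integral_mul_cyclicAverage (hρ : Continuous ρ) {η o : (Fin 3 → G) → ℂ}
    (hη : IsSmooth ρ η) (hηc : ∀ T ∈ cyclicMaps G, η ∘ T = η) (ho : IsSmooth ρ o) :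
    ∫ x, η x * cyclicAverage o x ∂Measure.pi (fun _ => μ) =
      ∫ x, η x * o x ∂Measure.pi (fun _ => μ) := by
  have hr : ∀ r : Fin 3, IsSmooth ρ fun x => o fun i => x (i + r) := fun r =>
    ho.comp_smoothGroup (r := matEmb ρ) (c := fun (x : Fin 3 → G) i => x (i + r))
      fun A => smoothGroup_eval (A + r)
  have h1 : ∀ r : Fin 3, ∫ x, η x * o (fun i => x (i + r)) ∂Measure.pi (fun _ => μ) =
      ∫ x, η x * o x ∂Measure.pi (fun _ => μ) := fun r => by
    have hm : MeasurePreserving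
        (MeasurableEquiv.arrowCongr' (Equiv.addRight r).symm (MeasurableEquiv.refl G))
        (Measure.pi fun _ : Fin 3 => μ) (Measure.pi fun _ => μ) :=
      measurePreserving_arrowCongr' _ _ _ _ fun _ => MeasurePreserving.id μ
    rw [← hm.integral_comp' fun x => η x * o x]
    refine integral_congr_ae (Filter.Eventually.of_forall fun x => ?_)
    exact congrArg (· * _) (congrFun (hηc _ ⟨r, rfl⟩) x).symm
  have h2 : ∀ x, η x * cyclicAverage o x =
      (1 / 3 : ℂ) * ∑ r : Fin 3, η x * o fun i => x (i + r) := fun x => by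
    rw [cyclicAverage, ← Finset.mul_sum]
    ring
  simp only [h2]
  rw [integral_const_mul, integral_finsetSum _ fun r _ => (hη.mul (hr r)).integrable μ hρ]
  simp only [h1]
  simp

theorem boulatov'_divergence (hρ : Continuous ρ) {𝒯 : Set ((Fin 3 → G) → (Fin 3 → G))}
    (h𝒯 : 𝒯 = cyclicMaps G ∨ 𝒯 = cyclicMaps G ∪ gaugeMaps G (Fin 3))
    {φ : Unit → (Fin 3 → G) → ℂ} (hφ : φ ∈ fields ρ Unit 𝒯)
    (hstat : IsStationary (action μ Q (fun _ => κ) m l boulatovPattern' fun _ => ())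
      (fields ρ Unit 𝒯) φ) (γ : Fin 3 → OneParam ρ) (x : Fin 3 → G) :
    divergence Q (current Q (fun _ => κ) m φ (leftFlow γ) 0) x =
      ((-2 * l * (lieDeriv (leftFlow γ) (φ ()) x *
        ((1 / 3 : ℂ) * ∑ r : Fin 3, ∑ v, omitIntegral μ boulatovPattern'
          (fun _ => φ ()) v (fun i => x (i + r)))).re : ℝ) : ℂ) := by
  have hsub : cyclicMaps G ⊆ 𝒯 := by
    rcases h𝒯 with rfl | rfl
    · exact subset_rfl
    · exact Set.subset_union_left
  set o : (Fin 3 → G) → ℂ := fun x => ∑ v, omitIntegral μ boulatovPattern' (fun _ => φ ()) v x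
    with ho
  have hov : ∀ v, IsSmooth ρ (omitIntegral μ boulatovPattern' (fun _ => φ ()) v) := fun v =>
    isSmooth_omitIntegral μ hρ (fun _ => (hφ ()).1) (boulatovPattern'_injective v)
  have hos : IsSmooth ρ o := IsSmooth.sum fun v _ => hov v
  have hmem : (fun (_ : Unit) => cyclicAverage o) ∈ fields ρ Unit 𝒯 := fun _ => by
    refine ⟨isSmooth_cyclicAverage hos, ?_⟩
    rcases h𝒯 with rfl | rfl
    · exact cyclicAverage_comp_cyclic o
    · rintro T (hT | hT)
      · exact cyclicAverage_comp_cyclic o T hT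
      · refine cyclicAverage_comp_gauge (fun T hT => funext fun x => ?_) T hT
        exact Finset.sum_congr rfl fun v _ => congrFun (omitIntegral_comp_gauge μ hρ
          (fun _ => (hφ ()).1) (fun _ T hT => (hφ ()).2 T (Or.inr hT))
          (boulatovPattern'_injective v) T hT) x
  -- The omitted integrals are kept separate for this pattern. Their sum is replaced by its cyclic
  -- average, which is an admissible variation with the same pairings.
  have heom := action_field_equation μ Q hρ boulatovPattern'_injective hφ hmem
    (fun _ => laplacian_comp_of_cyclic Q h𝒯 hφ) (fun η hη => by
      simp only [Finset.univ_unique, Finset.sum_singleton]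
      rw [integral_mul_cyclicAverage μ hρ (hη _).1 (fun T hT => (hη _).2 T (hsub hT)) hos, ho,
        ← integral_finsetSum _ fun v _ => ((hη _).1.mul (hov v)).integrable μ hρ]
      simp only [Finset.mul_sum]) hstat
  rw [leftFlow_eq_biFlow, divergence_current_flow Q (fun c => (hφ c).1) heom]
  simp [cyclicAverage, ho]

/-! ### The alternating interaction -/

/-- The cyclic shift of the pattern exchanges the factors `φ` and `φ̄`. -/
theorem omitIntegral_alternating_succ (u : (Fin 3 → G) → ℂ) (v : Fin 4) (x : Fin 3 → G) :
    omitIntegral μ simplicialPattern (alternating u) (v + 1) x =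
      conj (omitIntegral μ simplicialPattern (alternating u) v x) := by
  rw [← omitIntegral_conj]
  refine omitIntegral_symm μ simplicialPattern_succ (fun w y => ?_)
    (simplicialPattern_injective v) x
  fin_cases w <;> simp [alternating]

theorem isSmooth_alternating {ι : Type*} [Fintype ι] [DecidableEq ι] {u : (ι → G) → ℂ}
    (hu : IsSmooth ρ u) (v : Fin 4) : IsSmooth ρ (alternating u v) := by
  fin_cases v
  · exact hu
  · exact hu.conj
  · exact hu
  · exact hu.conj

theorem alternating_comp {ι : Type*} {u : (ι → G) → ℂ} {T : (ι → G) → (ι → G)}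
    (h : u ∘ T = u) (v : Fin 4) : alternating u v ∘ T = alternating u v := by
  have h' : (fun x => conj (u x)) ∘ T = fun x => conj (u x) :=
    funext fun x => congrArg _ (congrFun h x)
  fin_cases v
  · exact h
  · exact h'
  · exact h
  · exact h'

/-- This interaction already has a derivative of the form `Z + Z̄` without an added conjugate:
varying the two factors `φ` gives two equal terms, varying the two factors `φ̄` gives their
conjugates. Hence the factor 2 instead of 4. -/
theorem alternating_field_equation (hρ : Continuous ρ) {𝒯 : Set ((Fin 3 → G) → (Fin 3 → G))}
    (h𝒯 : 𝒯 = ∅ ∨ 𝒯 = gaugeMaps G (Fin 3)) {φ : Unit → (Fin 3 → G) → ℂ}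
    (hφ : φ ∈ fields ρ Unit 𝒯)
    (hstat : IsStationary (alternatingAction μ Q (fun _ => κ) m l simplicialPattern)
      (fields ρ Unit 𝒯) φ) (x : Fin 3 → G) :
    laplacian Q (fun _ => κ) (φ ()) x - m * φ () x =
      l * conj (((2 : ℝ) : ℂ) * omitIntegral μ simplicialPattern (alternating (φ ())) 0 x) := by
  set o := omitIntegral μ simplicialPattern (alternating (φ ())) with ho
  have hψ : alternating (φ ()) ∈ fields ρ (Fin 4) 𝒯 := fun v =>
    ⟨isSmooth_alternating (hφ ()).1 v, fun T hT => alternating_comp ((hφ ()).2 T hT) v⟩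
  have homem := omitIntegral_mem_fields μ hρ h𝒯 hψ simplicialPattern_injective
  have h1 : ∀ x, o 1 x = conj (o 0 x) := omitIntegral_alternating_succ μ (φ ()) 0
  have h2 : ∀ x, o 2 x = o 0 x := fun x => by
    rw [← Complex.conj_conj (o 0 x), ← h1 x]
    exact omitIntegral_alternating_succ μ (φ ()) 1 x
  have h3 : ∀ x, o 3 x = conj (o 0 x) := fun x => by
    rw [← h2]
    exact omitIntegral_alternating_succ μ (φ ()) 2 x
  refine field_equation μ Q hρ (φ := φ) (I := fun _ x => ((2 : ℝ) : ℂ) * o 0 x)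
    (S := fun φ => (l : ℂ) * interaction μ simplicialPattern (alternating (φ ()))) hφ
    (const_mul_mem_fields (homem 0).1 (homem 0).2 _)
    (laplacian_comp_of_mem_fields Q h𝒯 hφ) (fun η hη => ?_) hstat () x
  have hd := (hasDerivAt_interaction μ hρ simplicialPattern_injective (fun v => (hψ v).1)
    fun v => isSmooth_alternating (hη ()).1 v).const_mul (l : ℂ)
  have e1 : ∀ s : ℝ, (fun v x => alternating (φ ()) v x + (s : ℂ) * alternating (η ()) v x) =
      alternating fun x => φ () x + (s : ℂ) * η () x := fun s => by
    funext v x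
    fin_cases v <;> simp [alternating]
  simp only [e1] at hd
  refine hd.congr_deriv ?_
  have e2 : ∫ x, conj (η () x) * conj (o 0 x) ∂Measure.pi (fun _ => μ) =
      conj (∫ x, η () x * o 0 x ∂Measure.pi (fun _ => μ)) := by
    rw [← integral_conj]
    simp only [map_mul]
  have e3 : ∫ x, η () x * (((2 : ℝ) : ℂ) * o 0 x) ∂Measure.pi (fun _ => μ) =
      2 * ∫ x, η () x * o 0 x ∂Measure.pi (fun _ => μ) := by
    rw [← integral_const_mul]
    congr 1
    funext x
    push_cast
    ring
  simp only [Fin.sum_univ_four, ← ho, h1, h2, h3, Finset.univ_unique, Finset.sum_singleton,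
    PUnit.default_eq_unit, e3, map_mul, Complex.conj_ofReal]
  simp only [alternating, Matrix.cons_val_zero, Matrix.cons_val_one, Matrix.cons_val, e2]
  rw [show conj (2 : ℂ) = 2 from Complex.conj_ofNat 2]
  ring

end ModelDivergences

/-! ## The Barrett–Crane model -/

section BarrettCrane

variable {G : Type*} [Group G] {N d : ℕ} {ρ : G →* Matrix (Fin N) (Fin N) ℂ}
  (Q : InvariantMetric ρ d)

/-- Commuting a simplicity transformation past a constraint map only translates and conjugates its
parameter, a substitution that preserves Haar measure on the `u`. -/
theorem bcMap_one_comp (h : Bool → G) (u u' : Fin 4 → G) (x : BCSlot → G) :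
    bcMap 1 u (bcMap h u' x) =
      bcMap h 1 (bcMap 1 (fun j => u' j * h true * u j * (h true)⁻¹) x) := by
  funext A
  rcases A with ⟨j, _ | _⟩ | _ <;> simp only [bcMap, Sum.elim_inl, Sum.elim_inr, Pi.one_apply] <;>
    group

/-- The constraint map acts on each `g` slot by a right translation once the normal is fixed.
Varying the normal would also move the `g_-` slots, so its coupling is set to zero. -/
theorem laplacian_comp_bcMap {κ : ℝ} {w : (BCSlot → G) → ℂ} (hw : IsSmooth ρ w)
    (hT : ∀ T ∈ bcMaps G, w ∘ T = w) :
    ∀ T ∈ bcMaps G, laplacian Q (bcCoupling κ 0) w ∘ T = laplacian Q (bcCoupling κ 0) w := by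
  rintro T ⟨h, u, rfl⟩
  funext x
  refine laplacian_comp Q (π := Equiv.refl _) (fun _ => rfl) hw
    (fun y => congrFun (hT _ ⟨h, u, rfl⟩) y) x
    -- If the slot is multiplied on the right by `R`, then `x y R = (x R) (R⁻¹ y R)`, so the
    -- conjugating element is `R⁻¹`.
    (Sum.elim (fun p => match p with
      | (j, false) => (x (.inr ()) * u j * (x (.inr ()))⁻¹ * h false)⁻¹
      | (j, true) => (u j * h true)⁻¹) fun _ => 1) fun A hA y => ?_
  rcases A with ⟨j, s⟩ | _
  · funext B
    by_cases hB : B = .inl (j, s)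
    · subst hB
      cases s <;> simp [bcMap, mul_assoc]
    · rcases B with ⟨i, s'⟩ | _
      · have hr : (Sum.inr () : BCSlot) ≠ .inl (j, s) := by simp
        cases s' <;> simp only [bcMap, Sum.elim_inl, Equiv.refl_apply, Function.update_of_ne hB,
          Function.update_of_ne hr]
      · simp [bcMap]
  · exact absurd rfl hA

variable [TopologicalSpace G] [IsTopologicalGroup G] [CompactSpace G]
  [MeasurableSpace G] [BorelSpace G] [SecondCountableTopology G] (μ : Measure G)
  [μ.IsHaarMeasure] [IsProbabilityMeasure μ]

theorem smoothGroup_bcMap (hρ : Continuous ρ) {X E : Type*} [NormedAddCommGroup E]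
    [NormedSpace ℝ E] {r : X → E} {u : X → Fin 4 → G} {x : X → BCSlot → G} (h : Bool → G)
    (hu : ∀ j, SmoothGroup ρ r fun p => u p j) (hx : ∀ A, SmoothGroup ρ r fun p => x p A)
    (A : BCSlot) : SmoothGroup ρ r fun p => bcMap h (u p) (x p) A := by
  rcases A with ⟨j, _ | _⟩ | _
  · exact ((hx _).mul (((hx _).mul (hu j)).mul ((hx _).inv hρ))).mul (SmoothGroup.const _ _)
  · exact ((hx _).mul (hu j)).mul (SmoothGroup.const _ _)
  · exact ((SmoothGroup.const _ _).mul (hx _)).mul (SmoothGroup.const _ _)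

theorem smoothAlong_bcMap (hρ : Continuous ρ) {w : (BCSlot → G) → ℂ} (hw : IsSmooth ρ w) :
    SmoothAlong (fun p : (BCSlot → G) × (Fin 4 → G) => (matEmb ρ p.1, matEmb ρ p.2))
      fun p => w (bcMap 1 p.2 p.1) := by
  have h1 : SmoothAlong (fun p : (BCSlot → G) × (Fin 4 → G) => (matEmb ρ p.1, matEmb ρ p.2))
      fun p => matEmb ρ p.1 :=
    (SmoothAlong.id _).contDiff_comp contDiff_fst
  have h2 : SmoothAlong (fun p : (BCSlot → G) × (Fin 4 → G) => (matEmb ρ p.1, matEmb ρ p.2))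
      fun p => matEmb ρ p.2 :=
    (SmoothAlong.id _).contDiff_comp contDiff_snd
  exact hw.comp_smoothGroup fun A =>
    smoothGroup_bcMap hρ 1 (smoothAlong_matEmb.1 h2) (smoothAlong_matEmb.1 h1) A

theorem continuous_bcMap (hρ : Continuous ρ) {w : (BCSlot → G) → ℂ} (hw : IsSmooth ρ w) :
    Continuous fun p : (BCSlot → G) × (Fin 4 → G) => w (bcMap 1 p.2 p.1) :=
  (smoothAlong_bcMap hρ hw).continuous (((continuous_matEmb hρ).comp continuous_fst).prodMk
    ((continuous_matEmb hρ).comp continuous_snd))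

theorem isSmooth_simplicityAverage (hρ : Continuous ρ) {w : (BCSlot → G) → ℂ}
    (hw : IsSmooth ρ w) : IsSmooth ρ (simplicityAverage μ w) :=
  SmoothAlong.integral (r := matEmb ρ) (continuous_matEmb hρ) (smoothAlong_bcMap hρ hw)

/-- Averaging enforces the `u` invariance, while invariance under the `h` transformations is
inherited from `w`. -/
theorem simplicityAverage_comp (hρ : Continuous ρ) {w : (BCSlot → G) → ℂ} (hw : IsSmooth ρ w)
    (hwh : ∀ h x, w (bcMap h 1 x) = w x) :
    ∀ T ∈ bcMaps G, simplicityAverage μ w ∘ T = simplicityAverage μ w := by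
  rintro T ⟨h, u', rfl⟩
  funext x
  simp only [simplicityAverage, Function.comp_apply, bcMap_one_comp, hwh]
  exact MeasurePreserving.integral_comp_of_continuous
    (measurePreserving_mul_mul μ (fun j => u' j * h true) fun _ => (h true)⁻¹)
    (u := fun u => w (bcMap 1 u x))
    ((continuous_bcMap hρ hw).comp (continuous_const.prodMk continuous_id))

/-- A skew product over the normal: `k` stays fixed, and for each `k` the other slots are translated
on the right. -/
theorem measurePreserving_bcMap (u : Fin 4 → G) :
    MeasurePreserving (bcMap 1 u : (BCSlot → G) → _) (Measure.pi fun _ => μ)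
      (Measure.pi fun _ => μ) := by
  let q : (Unit → G) → Fin 4 × Bool → G := fun k p =>
    if p.2 then u p.1 else k () * u p.1 * (k ())⁻¹
  have hm := measurePreserving_sumPiEquivProdPi (X := fun _ : BCSlot => G) fun _ => μ
  have hskew : MeasurePreserving
      (fun p : (Unit → G) × (Fin 4 × Bool → G) => (p.1, fun A => 1 * p.2 A * q p.1 A))
      ((Measure.pi fun _ => μ).prod (Measure.pi fun _ => μ))
      ((Measure.pi fun _ => μ).prod (Measure.pi fun _ => μ)) := by
    refine (MeasurePreserving.id _).skew_product (g := fun (k : Unit → G) (g : Fin 4 × Bool → G) A => 1 * g A * q k A) ?_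
      (Filter.Eventually.of_forall fun k =>
        (measurePreserving_mul_mul μ (fun _ => 1) (q k)).map_eq)
    refine measurable_pi_lambda _ fun A => ?_
    rcases A with ⟨j, _ | _⟩
    · simp only [q, Function.uncurry, Bool.false_eq_true, if_false]
      fun_prop
    · simp only [q, Function.uncurry, if_true]
      fun_prop
  have h := hm.symm.comp (Measure.measurePreserving_swap.comp
    (hskew.comp (Measure.measurePreserving_swap.comp hm)))
  convert h using 1
  funext x A
  rcases A with ⟨j, _ | _⟩ | _
  · simp [bcMap, q, MeasurableEquiv.sumPiEquivProdPi, Equiv.sumPiEquivProdPi]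
  · simp [bcMap, q, MeasurableEquiv.sumPiEquivProdPi, Equiv.sumPiEquivProdPi]
  · simp [bcMap, MeasurableEquiv.sumPiEquivProdPi, Equiv.sumPiEquivProdPi]

theorem integral_mul_simplicityAverage (hρ : Continuous ρ) {η w : (BCSlot → G) → ℂ}
    (hη : IsSmooth ρ η) (hηT : ∀ T ∈ bcMaps G, η ∘ T = η) (hw : IsSmooth ρ w) :
    ∫ x, η x * simplicityAverage μ w x ∂Measure.pi (fun _ => μ) =
      ∫ x, η x * w x ∂Measure.pi (fun _ => μ) := by
  have h1 : ∀ x, η x * simplicityAverage μ w x =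
      ∫ u : Fin 4 → G, η x * w (bcMap 1 u x) ∂Measure.pi (fun _ => μ) := fun x =>
    (integral_const_mul _ _).symm
  have hc : Continuous fun p : (BCSlot → G) × (Fin 4 → G) => η p.1 * w (bcMap 1 p.2 p.1) :=
    ((hη.continuous hρ).comp continuous_fst).mul (continuous_bcMap hρ hw)
  simp only [h1]
  rw [integral_integral_swap (integrable_of_continuous_compactSpace hc)]
  have h2 : ∀ u : Fin 4 → G, ∫ x, η x * w (bcMap 1 u x) ∂Measure.pi (fun _ => μ) =
      ∫ x, η x * w x ∂Measure.pi (fun _ => μ) := fun u => by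
    rw [← MeasurePreserving.integral_comp_of_continuous (measurePreserving_bcMap μ u)
      (u := fun x => η x * w x) ((hη.continuous hρ).mul (hw.continuous hρ))]
    refine integral_congr_ae (Filter.Eventually.of_forall fun x => ?_)
    exact congrArg (· * _) (congrFun (hηT _ ⟨1, u, rfl⟩) x).symm
  simp only [h2]
  simp

theorem bcPattern_injective (v : Fin 5) : Function.Injective (bcPattern v) :=
  (((ooguriPattern_injective v).prodMap Function.injective_id)).sumMap
    fun _ _ _ => Subsingleton.elim _ _

theorem bcPattern_succ (w : Fin 5) : bcPattern (Equiv.addRight (1 : Fin 5) w) =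
    Equiv.sumCongr (Equiv.prodCongr ooguriPerm (Equiv.refl Bool)) (Equiv.addRight (1 : Fin 5)) ∘
      bcPattern w ∘ (1 : Equiv.Perm BCSlot) := by
  funext A
  rcases A with ⟨j, s⟩ | _
  · have h := congrFun (ooguriPattern_succ w) j
    simp only [Equiv.coe_addRight, Function.comp_apply, Equiv.Perm.coe_one, id] at h
    simp [bcPattern, h]
  · simp [bcPattern]

theorem omitIntegral_bc (w : (BCSlot → G) → ℂ) (v : Fin 5) :
    omitIntegral μ bcPattern (fun _ => w) v = omitIntegral μ bcPattern (fun _ => w) 0 :=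
  eq_zero_of_succ _ (fun v => funext fun x => omitIntegral_symm μ (ψ' := fun _ => w)
    bcPattern_succ (fun _ _ => rfl) (bcPattern_injective v) x) v

/-- The `h` transformations act on a shared variable in the same way in every factor, so they can be
absorbed by translating the integration variables. The `u` transformations involve the normal of the
individual factor, which is why they are handled by averaging. -/
theorem omitIntegral_bc_comp (hρ : Continuous ρ) {w : (BCSlot → G) → ℂ} (hw : IsSmooth ρ w)
    (hT : ∀ T ∈ bcMaps G, w ∘ T = w) (h : Bool → G) (x : BCSlot → G) :
    omitIntegral μ bcPattern (fun _ => w) 0 (bcMap h 1 x) =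
      omitIntegral μ bcPattern (fun _ => w) 0 x := by
  let p : (Fin 10 × Bool) ⊕ Fin 5 → G := Sum.elim (fun _ => 1) fun _ => (h false)⁻¹
  let q : (Fin 10 × Bool) ⊕ Fin 5 → G := Sum.elim (fun e => h e.2) fun _ => h true
  have hpq : ∀ v y, (fun A => p (bcPattern v A) * y A * q (bcPattern v A)) = bcMap h 1 y := by
    intro v y
    funext A
    rcases A with ⟨j, _ | _⟩ | _ <;> simp [bcPattern, bcMap, p, q]
  have := omitIntegral_translate μ hρ (f := bcPattern) p q (fun _ => hw)
    (fun v y => by rw [hpq]; exact congrFun (hT _ ⟨h, 1, rfl⟩) y) (bcPattern_injective 0) x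
  rwa [hpq] at this

variable {κ m l : ℝ}

theorem bc_field_equation (hρ : Continuous ρ) {κ' : ℝ} {φ : Unit → (BCSlot → G) → ℂ}
    (hφ : IsSmooth ρ (φ ()))
    (hstat : IsStationary (action μ Q (bcCoupling κ κ') m l bcPattern fun _ => ())
      (fields ρ Unit ∅) φ) (x : BCSlot → G) :
    laplacian Q (bcCoupling κ κ') (φ ()) x - m * φ () x =
      l * conj (((5 : ℝ) : ℂ) * omitIntegral μ bcPattern (fun _ => φ ()) 0 x) := by
  simpa using field_equation_of_omitIntegral_eq μ Q hρ bcPattern_injective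
    (φ := φ) (fun _ => ⟨hφ, by simp⟩) (fun v x => congrFun (omitIntegral_bc μ (φ ()) v) x)
    (by simp) (by simp) hstat x

/-- The raw omitted integral need not obey the simplicity constraint; its average does, and has the
same pairing with constrained variations. -/
theorem bc_constrained_field_equation (hρ : Continuous ρ) {φ : Unit → (BCSlot → G) → ℂ}
    (hφ : φ ∈ fields ρ Unit (bcMaps G))
    (hstat : IsStationary (action μ Q (bcCoupling κ 0) m l bcPattern fun _ => ())
      (fields ρ Unit (bcMaps G)) φ) (x : BCSlot → G) :
    laplacian Q (bcCoupling κ 0) (φ ()) x - m * φ () x =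
      l * conj (((5 : ℝ) : ℂ) *
        simplicityAverage μ (omitIntegral μ bcPattern (fun _ => φ ()) 0) x) := by
  have ho : IsSmooth ρ (omitIntegral μ bcPattern (fun _ => φ ()) 0) :=
    isSmooth_omitIntegral μ hρ (fun _ => (hφ ()).1) (bcPattern_injective 0)
  refine action_field_equation μ Q hρ bcPattern_injective hφ
    (I := fun _ x => ((5 : ℝ) : ℂ) *
      simplicityAverage μ (omitIntegral μ bcPattern (fun _ => φ ()) 0) x)
    (const_mul_mem_fields (isSmooth_simplicityAverage μ hρ ho) (simplicityAverage_comp μ hρ ho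
      (omitIntegral_bc_comp μ hρ (hφ ()).1 (hφ ()).2)) _)
    (fun _ => laplacian_comp_bcMap Q (hφ ()).1 (hφ ()).2) (fun η hη => ?_) hstat () x
  have h1 : ∫ x, η () x * (((5 : ℝ) : ℂ) *
      simplicityAverage μ (omitIntegral μ bcPattern (fun _ => φ ()) 0) x)
        ∂Measure.pi (fun _ => μ) =
      5 * ∫ x, η () x * omitIntegral μ bcPattern (fun _ => φ ()) 0 x
        ∂Measure.pi (fun _ => μ) := by
    rw [← integral_mul_simplicityAverage μ hρ (hη ()).1 (hη ()).2 ho, ← integral_const_mul]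
    congr 1
    funext x
    push_cast
    ring
  simp only [omitIntegral_bc μ (φ ()), Finset.sum_const, Finset.univ_unique,
    PUnit.default_eq_unit, h1]
  simp

end BarrettCrane

theorem velocity_const {G : Type*} [Group G] {N : ℕ} {ρ : G →* Matrix (Fin N) (Fin N) ℂ} (g : G) :
    velocity ρ (fun _ => g) = 0 :=
  velocity_eq fun i j => hasDerivAt_matrix_const g i j 0

end GFT

end


/-! ### The theorem for all models -/

open GFT in
theorem mainTheorem6
    {G : Type*} [Group G] [TopologicalSpace G] [IsTopologicalGroup G] [CompactSpace G]
    [MeasurableSpace G] [BorelSpace G]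
    (μ : Measure G) [μ.IsHaarMeasure] [IsProbabilityMeasure μ]
    {N d : ℕ} (ρ : G →* Matrix (Fin N) (Fin N) ℂ) (hρ : Continuous ρ)
    (hρ_inj : Function.Injective ρ) (Q : InvariantMetric ρ d) (κ m l : ℝ) :
    -- colored simplicial model `φ¹_{1,2,3} φ²_{1,4,5} φ³_{6,2,5} φ⁴_{6,4,3}`
    (∀ 𝒯 : Set ((Fin 3 → G) → (Fin 3 → G)), 𝒯 = ∅ ∨ 𝒯 = gaugeMaps G (Fin 3) →
      ∀ φ ∈ fields ρ (Fin 4) 𝒯,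
      IsStationary (action μ Q (fun _ => κ) m l coloredPattern id) (fields ρ (Fin 4) 𝒯) φ →
        (∀ (γ : Fin 3 → OneParam ρ) (x : Fin 3 → G),
          divergence Q (current Q (fun _ => κ) m φ (leftFlow γ) 0) x =
            ((-2 * l * ∑ c, (lieDeriv (leftFlow γ) (φ c) x *
              omitIntegral μ coloredPattern φ c x).re : ℝ) : ℂ)) ∧
        (∀ θ : Fin 4 → ℝ, ∑ c, θ c = 0 → ∀ x : Fin 3 → G,
          divergence Q (current Q (fun _ => κ) m φ trivialFlow θ) x =
            ((-2 * l * ∑ c, θ c * (φ c x * omitIntegral μ coloredPattern φ c x).im : ℝ) : ℂ))) ∧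
    -- simplicial model `φ_{1,2,3} φ_{3,4,5} φ_{5,2,6} φ_{6,4,1}`
    (∀ 𝒯 : Set ((Fin 3 → G) → (Fin 3 → G)), 𝒯 = ∅ ∨ 𝒯 = gaugeMaps G (Fin 3) →
      ∀ φ ∈ fields ρ Unit 𝒯,
      IsStationary (action μ Q (fun _ => κ) m l simplicialPattern fun _ => ())
        (fields ρ Unit 𝒯) φ →
      ∀ (γ₁ γ₂ : OneParam ρ) (x : Fin 3 → G),
        divergence Q (current Q (fun _ => κ) m φ (leftFlow ![γ₁, γ₂, γ₁]) 0) x =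
          ((-8 * l * (lieDeriv (leftFlow ![γ₁, γ₂, γ₁]) (φ ()) x *
            omitIntegral μ simplicialPattern (fun _ => φ ()) 0 x).re : ℝ) : ℂ)) ∧
    -- Boulatov model `φ_{1,2,3} φ_{1,4,5} φ_{2,5,6} φ_{3,6,4}` with cyclically invariant fields
    (∀ 𝒯 : Set ((Fin 3 → G) → (Fin 3 → G)),
      𝒯 = cyclicMaps G ∨ 𝒯 = cyclicMaps G ∪ gaugeMaps G (Fin 3) →
      ∀ φ ∈ fields ρ Unit 𝒯,
        (IsStationary (action μ Q (fun _ => κ) m l boulatovPattern fun _ => ())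
          (fields ρ Unit 𝒯) φ →
        ∀ (γ : OneParam ρ) (x : Fin 3 → G),
          divergence Q (current Q (fun _ => κ) m φ (leftFlow fun _ => γ) 0) x =
            ((-8 * l * (lieDeriv (leftFlow fun _ => γ) (φ ()) x *
              omitIntegral μ boulatovPattern (fun _ => φ ()) 0 x).re : ℝ) : ℂ)) ∧
        -- the variant `φ_{1,2,3} φ_{4,3,5} φ_{5,2,6} φ_{6,4,1}`
        (IsStationary (action μ Q (fun _ => κ) m l boulatovPattern' fun _ => ())
          (fields ρ Unit 𝒯) φ →
        ∀ (γ : OneParam ρ) (x : Fin 3 → G),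
          divergence Q (current Q (fun _ => κ) m φ (leftFlow fun _ => γ) 0) x =
            ((-2 * l * (lieDeriv (leftFlow fun _ => γ) (φ ()) x *
              ((1 / 3 : ℂ) * ∑ r : Fin 3, ∑ v, omitIntegral μ boulatovPattern'
                (fun _ => φ ()) v (fun i => x (i + r)))).re : ℝ) : ℂ))) ∧
    -- the model `φ_{1,2,3} φ̄_{3,4,5} φ_{5,2,6} φ̄_{6,4,1}`
    (∀ 𝒯 : Set ((Fin 3 → G) → (Fin 3 → G)), 𝒯 = ∅ ∨ 𝒯 = gaugeMaps G (Fin 3) →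
      ∀ φ ∈ fields ρ Unit 𝒯,
      IsStationary (alternatingAction μ Q (fun _ => κ) m l simplicialPattern)
        (fields ρ Unit 𝒯) φ →
        (∀ (γ₁ γ₂ : OneParam ρ) (x : Fin 3 → G),
          divergence Q (current Q (fun _ => κ) m φ (leftFlow ![γ₁, γ₂, γ₁]) 0) x =
            ((-4 * l * (lieDeriv (leftFlow ![γ₁, γ₂, γ₁]) (φ ()) x *
              omitIntegral μ simplicialPattern (alternating (φ ())) 0 x).re : ℝ) : ℂ)) ∧
        (∀ (θ : ℝ) (x : Fin 3 → G),
          divergence Q (current Q (fun _ => κ) m φ trivialFlow fun _ => θ) x =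
            ((-4 * l * θ * (φ () x *
              omitIntegral μ simplicialPattern (alternating (φ ())) 0 x).im : ℝ) : ℂ))) ∧
    -- Ooguri model
    (∀ 𝒯 : Set ((Fin 4 → G) → (Fin 4 → G)), 𝒯 = ∅ ∨ 𝒯 = gaugeMaps G (Fin 4) →
      ∀ φ ∈ fields ρ Unit 𝒯,
      IsStationary (action μ Q (fun _ => κ) m l ooguriPattern fun _ => ())
        (fields ρ Unit 𝒯) φ →
      ∀ (γ₁ γ₂ : OneParam ρ) (x : Fin 4 → G),
        divergence Q (current Q (fun _ => κ) m φ (leftFlow ![γ₁, γ₂, γ₂, γ₁]) 0) x =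
          ((-10 * l * (lieDeriv (leftFlow ![γ₁, γ₂, γ₂, γ₁]) (φ ()) x *
            omitIntegral μ ooguriPattern (fun _ => φ ()) 0 x).re : ℝ) : ℂ)) ∧
    -- Barrett–Crane model (for `G = SU(2)`), with its two families of symmetries
    (∀ φ ∈ fields ρ Unit (bcMaps G), ∀ Φ : ℝ → (BCSlot → G) → (BCSlot → G),
      (∃ σ : Fin 2 → Bool → OneParam ρ, Φ = spinFlow σ) ∨ (∃ γ : OneParam ρ, Φ = conjFlow γ) →
        -- equations of motion from arbitrary variations of the action
        (∀ κ' : ℝ,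
          IsStationary (action μ Q (bcCoupling κ κ') m l bcPattern fun _ => ())
            (fields ρ Unit ∅) φ →
          ∀ x : BCSlot → G,
            divergence Q (current Q (bcCoupling κ κ') m φ Φ 0) x =
              ((-10 * l * (lieDeriv Φ (φ ()) x *
                omitIntegral μ bcPattern (fun _ => φ ()) 0 x).re : ℝ) : ℂ)) ∧
        -- equations of motion from variations that satisfy the constraints
        (IsStationary (action μ Q (bcCoupling κ 0) m l bcPattern fun _ => ())
            (fields ρ Unit (bcMaps G)) φ →
          ∀ x : BCSlot → G,
            divergence Q (current Q (bcCoupling κ 0) m φ Φ 0) x =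
              ((-10 * l * (lieDeriv Φ (φ ()) x * simplicityAverage μ
                (omitIntegral μ bcPattern (fun _ => φ ()) 0) x).re : ℝ) : ℂ))) ∧
    -- in static models the `U(1)` currents vanish
    ((∀ φ ∈ fields ρ (Fin 4) (∅ : Set ((Fin 3 → G) → (Fin 3 → G))), ∀ θ : Fin 4 → ℝ,
        current Q (fun _ => 0) m φ trivialFlow θ = 0) ∧
      (∀ φ ∈ fields ρ Unit (∅ : Set ((Fin 3 → G) → (Fin 3 → G))), ∀ θ : ℝ,
        current Q (fun _ => 0) m φ trivialFlow (fun _ => θ) = 0)) := by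
  have := secondCountableTopology_of_injective hρ hρ_inj
  refine ⟨fun 𝒯 h𝒯 φ hφ hstat => ?_, fun 𝒯 h𝒯 φ hφ hstat γ₁ γ₂ x =>
    simplicial_divergence μ Q hρ h𝒯 hφ hstat _ x, fun 𝒯 h𝒯 φ hφ => ⟨fun hstat γ x =>
    boulatov_divergence μ Q hρ h𝒯 hφ hstat _ x, fun hstat γ x =>
    boulatov'_divergence μ Q hρ h𝒯 hφ hstat _ x⟩, fun 𝒯 h𝒯 φ hφ hstat => ?_,
    fun 𝒯 h𝒯 φ hφ hstat γ₁ γ₂ x => ooguri_divergence μ Q hρ h𝒯 hφ hstat _ x,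
    fun φ hφ Φ hΦ => ?_, ?_, ?_⟩
  · have heom := colored_field_equation μ Q hρ h𝒯 hφ hstat
    refine ⟨fun γ x => ?_, fun θ _ x =>
      divergence_current_phase Q (fun c => (hφ c).1) heom θ x⟩
    rw [leftFlow_eq_biFlow, divergence_current_flow Q (fun c => (hφ c).1) heom]
  · have heom := alternating_field_equation μ Q hρ h𝒯 hφ hstat
    refine ⟨fun γ₁ γ₂ x => ?_, fun θ x => ?_⟩
    · rw [leftFlow_eq_biFlow, divergence_current_unit Q (hφ ()).1 heom]
      norm_num
    · rw [divergence_current_phase Q (I := fun _ x => ((2 : ℝ) : ℂ) *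
        omitIntegral μ simplicialPattern (alternating (φ ())) 0 x) (fun c => (hφ c).1)
        (fun _ => heom)]
      congr 1
      simp only [Finset.univ_unique, Finset.sum_singleton, PUnit.default_eq_unit]
      -- The real factor 2 from the two equal variations is pulled out of the imaginary part.
      rw [mul_left_comm (φ () x), Complex.im_ofReal_mul]
      ring
  -- Spin(4) multiplication and simultaneous conjugation are both two-sided translations, so the
  -- field equation alone determines the divergence in either case.
  · obtain ⟨α, β, rfl⟩ : ∃ α β : BCSlot → OneParam ρ, Φ = biFlow α β := by
      rcases hΦ with ⟨σ, rfl⟩ | ⟨γ, rfl⟩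
      · exact ⟨_, _, leftFlow_eq_biFlow _⟩
      · exact ⟨_, _, rfl⟩
    refine ⟨fun κ' hstat x => ?_, fun hstat x => ?_⟩
    · rw [divergence_current_unit Q (hφ ()).1 (bc_field_equation Q μ hρ (hφ ()).1 hstat)]
      norm_num
    · rw [divergence_current_unit Q (hφ ()).1
        (bc_constrained_field_equation Q μ hρ hφ hstat)]
      norm_num
  · intro φ _ θ
    funext A a x
    -- The gradient part carries the factor `κ = 0`, and the Lagrangian part carries `X_M = 0`.
    simp [current, generatorComponent, trivialFlow, velocity_const]
  · intro φ _ θ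
    funext A a x
    simp [current, generatorComponent, trivialFlow, velocity_const]
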